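/- Let $0\le r\le N$ be integers, let $\mathbb G=G(r,N)$ be the Grassmannian of $r$-dimensional subspaces of $\mathbb C^N$, and let $\mathbb P=\mathbb P^{N-1}=G(1,N)$. Let $V$ and $Q$ be the tautological subbundle and the universal quotient bundle on $\mathbb G$, let $x_1,\dots,x_r$ be the Chern roots of $V^*$, and write $$H^\bullet(\mathbb G)=\mathbb C[x_1,\dots,x_r]^{\mathfrak S_r}/\langle h_{N-r+1},\dots,h_N\rangle ,$$ where $h_k=h_k(x_1,\dots,x_r)$ is the complete symmetric polynomial; put $\sigma_1=h_1=x_1+\cdots+x_r$, and recall $c_k(Q)=h_k$. For a partition $\lambda$ in the $r\times(N-r)$ rectangle let $$\sigma_\lambda=\frac{\det(x_i^{\lambda_j+r-j})_{1\le i,j\le r}}{\det(x_i^{r-j})_{1\le i,j\le r}}\in H^\bullet(\mathbb G)$$ be the Schubert class. Let $h=c_1(\mathcal O(1))\in H^\bullet(\mathbb P)$ be the hyperplane class; thus $1,h,\dots,h^{N-1}$ is a basis of $H^\bullet(\mathbb P)$. The Satake identification is the linear map $$\mathrm{Sat}\colon \wedge^r H^\bullet(\mathbb P)\to H^\bullet(\mathbb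 G),\qquad h^{\lambda_1+r-1}\wedge h^{\lambda_2+r-2}\wedge\cdots\wedge h^{\lambda_r}\mapsto \sigma_\lambda ,$$ for $\lambda$ in the $r\times(N-r)$ rectangle. For a smooth projective variety $F$ let $\widehat\Gamma_F=\prod_{i}\Gamma(1+\delta_i)$, where the $\delta_i$ are the Chern roots of the tangent bundle $TF$ and $\Gamma(1+z)$ is expanded in its Taylor series at $z=0$ (recall $T\mathbb G=\mathrm{Hom}(V,Q)$). For a vector bundle $E$ with Chern roots $\varepsilon_j$ let $\mathrm{Ch}(E)=\sum_j e^{2\pi \mathtt i\,\varepsilon_j}$. Let $S^\nu$ be the Schur functor of a partition $\nu$. Then for every partition $N-r\ge\nu_1\ge\nu_2\ge\cdots\ge\nu_r\ge0$, $$\widehat\Gamma_{\mathbb G}\,\mathrm{Ch}(S^\nu V^*)=(2\pi\mathtt i)^{-\binom r2}\,e^{-(r-1)\pi\mathtt i\,\sigma_1}\;\mathrm{Sat}\Bigl(\widehat\Gamma_{\mathbb P}\mathrm{Ch}(\mathcal O(\nu_1+r-1))\wedge\widehat\Gamma_{\mathbb P}\mathrm{Ch}(\mathcal O(\nu_2+r-2))\wedge\cdots\wedge\widehat\Gamma_{\mathbb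 P}\mathrm{Ch}(\mathcal O(\nu_r))\Bigr)$$ in $H^\bullet(\mathbb G)$. -/

import Mathlib

open scoped TensorProduct

noncomputable section

namespace GammaGrassmannian

/-! ### Cohomology of the Grassmannian `G(r,N)` -/

/-- Symmetric polynomials in `x_1, …, x_r` (the Chern roots of the dual `V^*` of the
tautological bundle). -/
abbrev SymPoly (r : ℕ) : Type :=
  MvPolynomial.symmetricSubalgebra (Fin r) ℂ

/-- The complete symmetric polynomial `h_k(x_1, …, x_r)`. -/
def hSym (r k : ℕ) : SymPoly r :=
  ⟨MvPolynomial.hsymm (Fin r) ℂ k, MvPolynomial.hsymm_isSymmetric (Fin r) ℂ k⟩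

/-- The ideal `⟨h_{N-r+1}, …, h_N⟩`. -/
def relIdeal (r N : ℕ) : Ideal (SymPoly r) :=
  Ideal.span {f | ∃ k : ℕ, N + 1 ≤ k + r ∧ k ≤ N ∧ f = hSym r k}

/-- `H(G(r,N)) = ℂ[x_1, …, x_r]^{S_r} / ⟨h_{N-r+1}, …, h_N⟩`.
In particular `HG 1 N` is the cohomology of the projective space `ℙ^{N-1} = G(1,N)`. -/
abbrev HG (r N : ℕ) : Type := SymPoly r ⧸ relIdeal r N

/-- The cohomology class of a symmetric polynomial in the Chern roots of `V^*`. -/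
def toHG (r N : ℕ) (f : SymPoly r) : HG r N := Ideal.Quotient.mk (relIdeal r N) f

/-- The special Schubert class `σ_k = h_k(x_1, …, x_r) = c_k(Q)`. For `r = 1`, `k = 1` this is
the hyperplane class of `ℙ^{N-1}`. -/
def specialClass (r N k : ℕ) : HG r N := toHG r N (hSym r k)

/-! ### Schur polynomials and Schubert classes -/

/-- The matrix `(x_i ^ {a_j})`. -/
def alternant (r : ℕ) (a : Fin r → ℕ) : Matrix (Fin r) (Fin r) (MvPolynomial (Fin r) ℂ) :=
  Matrix.of fun i j => MvPolynomial.X i ^ a j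

theorem rename_det_alternant {r : ℕ} (a : Fin r → ℕ) (e : Equiv.Perm (Fin r)) :
    MvPolynomial.rename e (alternant r a).det
      = ((Equiv.Perm.sign e : ℤ) : MvPolynomial (Fin r) ℂ) * (alternant r a).det := by
  rw [← Matrix.det_permute, AlgHom.map_det]
  congr 1
  ext1 i j
  simp [alternant]

theorem det_alternant_rev_ne_zero (r : ℕ) :
    (alternant r (fun j => (j.rev : ℕ))).det ≠ 0 := by
  have h : alternant r (fun j => (j.rev : ℕ))
      = (Matrix.vandermonde (fun i : Fin r => (MvPolynomial.X i : MvPolynomial (Fin r) ℂ))).submatrix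
        id Fin.revPerm := by
    ext1 i j
    simp [alternant, Matrix.vandermonde_apply]
  rw [h, Matrix.det_permute']
  refine mul_ne_zero ?_ ?_
  · rcases Int.units_eq_one_or (Equiv.Perm.sign (Fin.revPerm : Equiv.Perm (Fin r))) with h | h <;>
      simp [h]
  · exact Matrix.det_vandermonde_ne_zero_iff.2 (MvPolynomial.X_injective)

/-- `det (x_i ^ {r-j})` divides `det (x_i ^ {a_j})`. -/
theorem det_alternant_dvd {r : ℕ} (a : Fin r → ℕ) :
    (alternant r (fun j => (j.rev : ℕ))).det ∣ (alternant r a).det := by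
  classical
  let P : Polynomial (MvPolynomial (Fin r) ℂ) :=
    ∏ i : Fin r, (Polynomial.X - Polynomial.C (MvPolynomial.X i))
  have hP : P.Monic := Polynomial.monic_prod_of_monic _ _ fun i _ => Polynomial.monic_X_sub_C _
  have hdeg : P.natDegree = r := by simp [P]
  have hroot : ∀ i : Fin r, P.eval (MvPolynomial.X i) = 0 := fun i => by
    simp only [P, Polynomial.eval_prod]
    exact Finset.prod_eq_zero (Finset.mem_univ i) (by simp)
  let p : Fin r → Polynomial (MvPolynomial (Fin r) ℂ) := fun j =>
    (Polynomial.X ^ a j) %ₘ P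
  have heval : ∀ i j, (p j).eval (MvPolynomial.X i) = MvPolynomial.X i ^ a j := fun i j => by
    have h := congrArg (Polynomial.eval (MvPolynomial.X i : MvPolynomial (Fin r) ℂ))
      (Polynomial.modByMonic_add_div (Polynomial.X ^ a j) P)
    simpa [hroot i] using h
  have hlt : ∀ j, (p j).natDegree < r ∨ p j = 0 := fun j => by
    by_cases h0 : p j = 0
    · exact Or.inr h0
    · left
      have h := Polynomial.degree_modByMonic_lt (Polynomial.X ^ a j) hP
      exact (Polynomial.natDegree_lt_natDegree h0 h).trans_eq hdeg
  let Cm : Matrix (Fin r) (Fin r) (MvPolynomial (Fin r) ℂ) :=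
    Matrix.of fun k j => (p j).coeff (k.rev : ℕ)
  refine ⟨Cm.det, ?_⟩
  rw [← Matrix.det_mul]
  congr 1
  ext1 i j
  rw [Matrix.mul_apply]
  simp only [alternant, Matrix.of_apply, Cm]
  rw [← heval i j]
  have h1 : (p j).eval (MvPolynomial.X i : MvPolynomial (Fin r) ℂ)
      = ∑ k ∈ Finset.range r, (p j).coeff k * MvPolynomial.X i ^ k := by
    rcases hlt j with h | h
    · exact Polynomial.eval_eq_sum_range' h _
    · simp [h]
  rw [h1, ← Fin.sum_univ_eq_sum_range (fun k => (p j).coeff k * MvPolynomial.X i ^ k) r]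
  rw [← Equiv.sum_comp Fin.revPerm]
  exact Finset.sum_congr rfl fun k _ => by simp [mul_comm]

/-- The Schur polynomial
`σ_λ(x_1, …, x_r) = det (x_i ^ {λ_j + r - j}) / det (x_i ^ {r - j})`. -/
def schurPoly {r : ℕ} (l : Fin r → ℕ) : MvPolynomial (Fin r) ℂ :=
  Classical.choose (det_alternant_dvd fun j => l j + (j.rev : ℕ))

theorem schurPoly_spec {r : ℕ} (l : Fin r → ℕ) :
    (alternant r fun j => l j + (j.rev : ℕ)).det
      = (alternant r fun j => (j.rev : ℕ)).det * schurPoly l :=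
  Classical.choose_spec (det_alternant_dvd fun j => l j + (j.rev : ℕ))

theorem schurPoly_isSymmetric {r : ℕ} (l : Fin r → ℕ) : (schurPoly l).IsSymmetric := by
  intro e
  have h := congrArg (MvPolynomial.rename e) (schurPoly_spec l)
  rw [map_mul, rename_det_alternant, rename_det_alternant, schurPoly_spec l, mul_assoc] at h
  have hs : ((Equiv.Perm.sign e : ℤ) : MvPolynomial (Fin r) ℂ) ≠ 0 := by
    rcases Int.units_eq_one_or (Equiv.Perm.sign e) with h | h <;> simp [h]
  exact (mul_left_cancel₀ (det_alternant_rev_ne_zero r) (mul_left_cancel₀ hs h)).symm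

/-- The Schubert class `σ_λ`. -/
def schubertClass {r : ℕ} (N : ℕ) (l : Fin r → ℕ) : HG r N :=
  toHG r N ⟨schurPoly l, schurPoly_isSymmetric l⟩

/-! ### The Satake identification -/

theorem hSym_one_eq_pow (k : ℕ) : hSym 1 k = hSym 1 1 ^ k := by
  apply Subtype.ext
  have h : ∀ k : ℕ, MvPolynomial.hsymm (Fin 1) ℂ k = MvPolynomial.X 0 ^ k := fun k => by
    rw [MvPolynomial.hsymm, Fintype.sum_unique]
    have hs : ((default : Sym (Fin 1) k) : Multiset (Fin 1)) = Multiset.replicate k 0 := by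
      rw [Multiset.eq_replicate]
      exact ⟨(default : Sym (Fin 1) k).2, fun b _ => Subsingleton.elim _ _⟩
    change (((default : Sym (Fin 1) k) : Multiset (Fin 1)).map _).prod = _
    rw [hs]
    simp
  simp [hSym, h]

theorem relIdeal_one (N : ℕ) : relIdeal 1 N = Ideal.span {hSym 1 1 ^ N} := by
  rw [relIdeal, ← hSym_one_eq_pow]
  congr 1
  ext f
  constructor
  · rintro ⟨k, h1, h2, rfl⟩
    obtain rfl : k = N := by omega
    rfl
  · rintro rfl
    exact ⟨N, le_rfl, le_rfl, rfl⟩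

theorem aeval_hSym_one_bijective :
    Function.Bijective (Polynomial.aeval (R := ℂ) (hSym 1 1)) := by
  have h : ∀ f : Polynomial ℂ, ((Polynomial.aeval (hSym 1 1) f : SymPoly 1) :
      MvPolynomial (Fin 1) ℂ) = (MvPolynomial.uniqueAlgEquiv ℂ (Fin 1)).symm f := by
    have h' : ((MvPolynomial.symmetricSubalgebra (Fin 1) ℂ).val).comp
        (Polynomial.aeval (hSym 1 1))
        = ((MvPolynomial.uniqueAlgEquiv ℂ (Fin 1)).symm : Polynomial ℂ →ₐ[ℂ] _) := by
      ext1
      simp [hSym, MvPolynomial.uniqueAlgEquiv]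
    exact fun f => DFunLike.congr_fun h' f
  constructor
  · intro f g hfg
    apply (MvPolynomial.uniqueAlgEquiv ℂ (Fin 1)).symm.injective
    rw [← h, ← h, hfg]
  · intro f
    refine ⟨MvPolynomial.uniqueAlgEquiv ℂ (Fin 1) f, Subtype.ext ?_⟩
    rw [h, AlgEquiv.symm_apply_apply]

/-- The classes `1, h, …, h^{N-1}` form a basis of the cohomology of `ℙ^{N-1}`. -/
theorem exists_hyperplaneBasis (N : ℕ) :
    ∃ b : Module.Basis (Fin N) ℂ (HG 1 N), ∀ k, b k = specialClass 1 N 1 ^ (k : ℕ) := by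
  let e : Polynomial ℂ ≃ₐ[ℂ] SymPoly 1 :=
    AlgEquiv.ofBijective (Polynomial.aeval (hSym 1 1)) aeval_hSym_one_bijective
  have heX : e Polynomial.X = hSym 1 1 := Polynomial.aeval_X _
  have hI : relIdeal 1 N
      = (Ideal.span {(Polynomial.X : Polynomial ℂ) ^ N}).map (e : Polynomial ℂ →+* SymPoly 1) := by
    rw [relIdeal_one, Ideal.map_span, Set.image_singleton, map_pow]
    simp [heX]
  let E : AdjoinRoot ((Polynomial.X : Polynomial ℂ) ^ N) ≃ₐ[ℂ] HG 1 N :=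
    Ideal.quotientEquivAlg _ _ e hI
  have hm : ((Polynomial.X : Polynomial ℂ) ^ N).Monic := Polynomial.monic_X_pow N
  have hdim : (AdjoinRoot.powerBasis' hm).dim = N := by simp
  refine ⟨((AdjoinRoot.powerBasis' hm).basis.reindex (finCongr hdim)).map E.toLinearEquiv,
    fun k => ?_⟩
  have hr : E (AdjoinRoot.root ((Polynomial.X : Polynomial ℂ) ^ N)) = specialClass 1 N 1 := by
    change Ideal.Quotient.mk _ (e Polynomial.X) = _
    rw [heX]
    rfl
  simp [hr]

/-- The basis `1, h, …, h^{N-1}` of the cohomology of `ℙ^{N-1}`. -/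
def hyperplaneBasis (N : ℕ) : Module.Basis (Fin N) ℂ (HG 1 N) :=
  Classical.choose (exists_hyperplaneBasis N)

theorem hyperplaneBasis_apply (N : ℕ) (k : Fin N) :
    hyperplaneBasis N k = specialClass 1 N 1 ^ (k : ℕ) :=
  Classical.choose_spec (exists_hyperplaneBasis N) k

/-- The induced basis of `⋀^r H(ℙ^{N-1})`: the wedges `h^{a_1} ∧ ⋯ ∧ h^{a_r}` with
`a_1 > ⋯ > a_r`. The index type carries the reversed order so that exponents decrease. -/
def wedgeBasis (r N : ℕ) :
    Module.Basis (Set.powersetCard (Fin N)ᵒᵈ r) ℂ (⋀[ℂ]^r (HG 1 N)) :=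
  ((hyperplaneBasis N).reindex OrderDual.toDual).exteriorPower r

/-- The exponents `a_1 > ⋯ > a_r` of an element of `wedgeBasis`. -/
def wedgeExponents {r N : ℕ} (s : Set.powersetCard (Fin N)ᵒᵈ r) (j : Fin r) : ℕ :=
  (OrderDual.ofDual (Set.powersetCard.ofFinEmbEquiv.symm s j) : Fin N)

/-- The Satake identification `⋀^r H(ℙ^{N-1}) → H(G(r,N))`: the linear map with
`h^{λ_1 + r - 1} ∧ h^{λ_2 + r - 2} ∧ ⋯ ∧ h^{λ_r} ↦ σ_λ` (see `satake_wedge`). -/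
def satake (r N : ℕ) : ⋀[ℂ]^r (HG 1 N) →ₗ[ℂ] HG r N :=
  (wedgeBasis r N).constr ℂ fun s =>
    schubertClass N fun j => wedgeExponents s j - (j.rev : ℕ)

theorem satake_wedge {r N : ℕ} (hrN : r ≤ N) (l : Fin r → ℕ) (hl : Antitone l)
    (hbox : ∀ j, l j ≤ N - r) :
    satake r N (exteriorPower.ιMulti ℂ r
      fun j : Fin r => specialClass 1 N 1 ^ (l j + (j.rev : ℕ))) = schubertClass N l := by
  have hlt : ∀ j : Fin r, l j + (j.rev : ℕ) < N := fun j => by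
    have h1 := hbox j
    have h2 := j.rev.isLt
    omega
  let f : Fin r ↪o (Fin N)ᵒᵈ := OrderEmbedding.ofStrictMono
    (fun j => OrderDual.toDual ⟨l j + (j.rev : ℕ), hlt j⟩) (by
      intro i j hij
      have h1 := hl hij.le
      have h2 : (i : ℕ) < j := hij
      have h3 := j.isLt
      change l j + (j.rev : ℕ) < l i + (i.rev : ℕ)
      simp only [Fin.val_rev]
      omega)
  have hs : wedgeBasis r N (Set.powersetCard.ofFinEmbEquiv f)
      = exteriorPower.ιMulti ℂ r
        fun j : Fin r => specialClass 1 N 1 ^ (l j + (j.rev : ℕ)) := by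
    rw [wedgeBasis, exteriorPower.basis_apply]
    simp only [exteriorPower.ιMulti_family, Equiv.symm_apply_apply]
    congr 1
    ext1 j
    simp [hyperplaneBasis_apply, f]
  rw [← hs, satake, Module.Basis.constr_basis]
  congr 1
  ext j
  simp [wedgeExponents, f]

/-! ### Characteristic classes -/

/-- The part of degree at most `D` in the `δ_p` of `∏_p φ(δ_p)`, for a power series `φ`. -/
def truncProd {A ι : Type*} [CommRing A] [Algebra ℂ A] [Fintype ι] [DecidableEq ι]
    (φ : PowerSeries ℂ) (δ : ι → A) (D : ℕ) : A :=
  ∑ d ∈ Finset.range (D + 1), ∑ a ∈ Finset.piAntidiag (Finset.univ : Finset ι) d,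
    ∏ p, (PowerSeries.coeff (a p) φ) • δ p ^ a p

theorem map_truncProd {A B ι : Type*} [CommRing A] [Algebra ℂ A] [CommRing B] [Algebra ℂ B]
    [Fintype ι] [DecidableEq ι] (F : A →ₐ[ℂ] B) (φ : PowerSeries ℂ) (δ : ι → A) (D : ℕ) :
    F (truncProd φ δ D) = truncProd φ (fun p => F (δ p)) D := by
  simp [truncProd, map_sum, map_prod]

theorem truncProd_comp {A ι : Type*} [CommRing A] [Algebra ℂ A] [Fintype ι] [DecidableEq ι]
    (φ : PowerSeries ℂ) (δ : ι → A) (D : ℕ) (e : Equiv.Perm ι) :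
    truncProd φ (fun p => δ (e p)) D = truncProd φ δ D := by
  unfold truncProd
  refine Finset.sum_congr rfl fun d _ => ?_
  refine Finset.sum_nbij' (fun a => a ∘ e.symm) (fun a => a ∘ e) ?_ ?_ ?_ ?_ ?_
  · intro a ha
    simp only [Finset.mem_piAntidiag, Finset.mem_univ, implies_true, and_true] at ha ⊢
    rw [← ha]
    exact Equiv.sum_comp e.symm a
  · intro a ha
    simp only [Finset.mem_piAntidiag, Finset.mem_univ, implies_true, and_true] at ha ⊢
    rw [← ha]
    exact Equiv.sum_comp e a
  · intro a _
    ext p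
    simp
  · intro a _
    ext p
    simp
  · intro a _
    rw [← Equiv.prod_comp e (fun p => (PowerSeries.coeff ((a ∘ e.symm) p) φ) •
      δ p ^ (a ∘ e.symm) p)]
    simp

/-- The Taylor series of `Γ(1 + z)` at `z = 0`. -/
def gammaSeries : PowerSeries ℂ :=
  PowerSeries.mk fun n => iteratedDeriv n Complex.Gamma 1 / (n.factorial : ℂ)

/-- The part of degree at most `D` of `e^a`, for a class `a` of degree two. -/
def truncExp {A : Type*} [CommRing A] [Algebra ℂ A] (D : ℕ) (a : A) : A :=
  ∑ k ∈ Finset.range (D + 1), ((k.factorial : ℂ)⁻¹) • a ^ k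

theorem map_truncExp {A B : Type*} [CommRing A] [Algebra ℂ A] [CommRing B] [Algebra ℂ B]
    (F : A →ₐ[ℂ] B) (D : ℕ) (a : A) : F (truncExp D a) = truncExp D (F a) := by
  simp [truncExp, map_sum]

/-! ### The Gamma class of the Grassmannian -/

/-- Evaluation of a symmetric polynomial in `y_1, …, y_m` (with coefficients in
`ℂ[x_1, …, x_r]`) at the Chern roots `y_1, …, y_m` of the universal quotient bundle `Q`, whose
Chern classes are `e_k(y) = c_k(Q) = h_k(x)`: a symmetric polynomial is written as a polynomial in
the elementary symmetric polynomials `e_k(y)`, and `h_k(x)` is substituted for `e_k(y)`. -/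
def evalQuotientRoots (r m : ℕ) :
    MvPolynomial.symmetricSubalgebra (Fin m) (MvPolynomial (Fin r) ℂ)
      →ₐ[MvPolynomial (Fin r) ℂ] MvPolynomial (Fin r) ℂ :=
  (MvPolynomial.aeval fun k : Fin m => MvPolynomial.hsymm (Fin r) ℂ (k + 1)).comp
    (MvPolynomial.esymmAlgEquiv (Fin m) (MvPolynomial (Fin r) ℂ)
      (Fintype.card_fin m)).symm.toAlgHom

/-- The Chern roots `x_i + y_j` of the tangent bundle `T G(r,N) = Hom(V, Q) = V^* ⊗ Q`, where
`x_i` and `y_j` are the Chern roots of `V^*` and of `Q`. -/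
def tangentRoot {r m : ℕ} (p : Fin r × Fin m) : MvPolynomial (Fin m) (MvPolynomial (Fin r) ℂ) :=
  MvPolynomial.C (MvPolynomial.X p.1) + MvPolynomial.X p.2

/-- `∏ Γ(1 + δ)` over the Chern roots `δ` of the tangent bundle of `G(r, r + m)`, up to degree
`r m = dim G(r, r + m)`. -/
def gammaRoots (r m : ℕ) : MvPolynomial (Fin m) (MvPolynomial (Fin r) ℂ) :=
  truncProd gammaSeries (tangentRoot (r := r) (m := m)) (r * m)

theorem gammaRoots_isSymmetric (r m : ℕ) : (gammaRoots r m).IsSymmetric := by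
  intro e
  have h := map_truncProd ((MvPolynomial.rename e : MvPolynomial (Fin m) (MvPolynomial (Fin r) ℂ)
    →ₐ[MvPolynomial (Fin r) ℂ] _).restrictScalars ℂ) gammaSeries
    (tangentRoot (r := r) (m := m)) (r * m)
  rw [AlgHom.restrictScalars_apply] at h
  rw [gammaRoots, h, ← truncProd_comp gammaSeries tangentRoot (r * m)
    (Equiv.prodCongr (Equiv.refl (Fin r)) e)]
  congr 1
  ext1 p
  simp [tangentRoot]

/-- The Gamma class of `G(r, r + m)` as a polynomial in the Chern roots of `V^*`. -/
def gammaPoly (r m : ℕ) : MvPolynomial (Fin r) ℂ :=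
  evalQuotientRoots r m ⟨gammaRoots r m, gammaRoots_isSymmetric r m⟩

theorem map_aeval_of_fixed {K B ι : Type*} [CommRing K] [CommRing B] [Algebra K B]
    (ρ : K →+* K) (ψ : B →+* B) (hc : ∀ k, ψ (algebraMap K B k) = algebraMap K B (ρ k))
    (b : ι → B) (hb : ∀ i, ψ (b i) = b i) (q : MvPolynomial ι K) :
    ψ (MvPolynomial.aeval b q) = MvPolynomial.aeval b (MvPolynomial.map ρ q) := by
  induction q using MvPolynomial.induction_on with
  | C k => simp [hc]
  | add p q hp hq => simp [hp, hq]
  | mul_X p i hp => simp [hp, hb]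

theorem gammaPoly_isSymmetric (r m : ℕ) : (gammaPoly r m).IsSymmetric := by
  intro e
  let E := MvPolynomial.esymmAlgEquiv (Fin m) (MvPolynomial (Fin r) ℂ) (Fintype.card_fin m)
  let G : MvPolynomial.symmetricSubalgebra (Fin m) (MvPolynomial (Fin r) ℂ) :=
    ⟨gammaRoots r m, gammaRoots_isSymmetric r m⟩
  let ρ : MvPolynomial (Fin r) ℂ →+* MvPolynomial (Fin r) ℂ :=
    (MvPolynomial.rename e : MvPolynomial (Fin r) ℂ →ₐ[ℂ] MvPolynomial (Fin r) ℂ)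
  let q : MvPolynomial (Fin m) (MvPolynomial (Fin r) ℂ) := E.symm G
  have hE : ∀ p, ((E p : MvPolynomial.symmetricSubalgebra (Fin m) (MvPolynomial (Fin r) ℂ)) :
      MvPolynomial (Fin m) (MvPolynomial (Fin r) ℂ))
      = MvPolynomial.aeval (fun i : Fin m => MvPolynomial.esymm (Fin m) _ (i + 1)) p := fun p =>
    MvPolynomial.esymmAlgHom_apply p
  have hG : MvPolynomial.map ρ (gammaRoots r m) = gammaRoots r m := by
    have h := map_truncProd (MvPolynomial.mapAlgHom (σ := Fin m)
      (MvPolynomial.rename e : MvPolynomial (Fin r) ℂ →ₐ[ℂ] MvPolynomial (Fin r) ℂ)) gammaSeries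
      (tangentRoot (r := r) (m := m)) (r * m)
    rw [MvPolynomial.mapAlgHom_apply] at h
    refine h.trans ?_
    rw [gammaRoots, ← truncProd_comp gammaSeries tangentRoot (r * m)
      (Equiv.prodCongr e (Equiv.refl (Fin m)))]
    congr 1
    ext1 p
    simp [tangentRoot]
  have hq : MvPolynomial.map ρ q = q := by
    apply E.injective
    apply Subtype.ext
    have h1 : ((E q : MvPolynomial.symmetricSubalgebra (Fin m) (MvPolynomial (Fin r) ℂ)) :
      MvPolynomial (Fin m) (MvPolynomial (Fin r) ℂ)) = gammaRoots r m := by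
      simp [q, G]
    rw [h1, ← hG, ← h1, hE, hE]
    refine (map_aeval_of_fixed ρ (MvPolynomial.map ρ) (fun k => ?_) _ (fun i => ?_) q).symm
    · rw [MvPolynomial.algebraMap_eq, MvPolynomial.map_C]
    · exact MvPolynomial.map_esymm _ _ _ _
  change ρ (MvPolynomial.aeval (fun k : Fin m => MvPolynomial.hsymm (Fin r) ℂ (k + 1)) q)
    = MvPolynomial.aeval (fun k : Fin m => MvPolynomial.hsymm (Fin r) ℂ (k + 1)) q
  rw [map_aeval_of_fixed ρ ρ (fun k => rfl) _ (fun i => MvPolynomial.rename_hsymm _ _ _ e) q, hq]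

/-- The Gamma class of `G(r,N)`. -/
def gammaClass (r N : ℕ) : HG r N :=
  toHG r N ⟨gammaPoly r (N - r), gammaPoly_isSymmetric r (N - r)⟩

/-! ### Schur functors and the bundles `S^ν V^*` -/

/-- The boxes of the Young diagram with rows of lengths `ν_1, …, ν_r`. -/
abbrev Boxes {r : ℕ} (ν : Fin r → ℕ) : Type := Σ i : Fin r, Fin (ν i)

/-- The permutations of the boxes that preserve each row. -/
abbrev RowPerm {r : ℕ} (ν : Fin r → ℕ) : Type :=
  {p : Equiv.Perm (Boxes ν) // ∀ c, (p c).1 = c.1}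

/-- The permutations of the boxes that preserve each column. -/
abbrev ColPerm {r : ℕ} (ν : Fin r → ℕ) : Type :=
  {q : Equiv.Perm (Boxes ν) // ∀ c, ((q c).2 : ℕ) = (c.2 : ℕ)}

/-- The Young symmetrizer `∑_{p, q} sgn(q) p q` (`p` preserving rows, `q` preserving columns)
acting on the tensor power `W^{⊗ |ν|}`, whose factors are indexed by the boxes of `ν`. -/
def youngSymmetrizer {r : ℕ} (ν : Fin r → ℕ) (W : Type*) [AddCommGroup W] [Module ℂ W] :
    Module.End ℂ (⨂[ℂ] _ : Boxes ν, W) :=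
  ∑ p : RowPerm ν, ∑ q : ColPerm ν, ((Equiv.Perm.sign q.1 : ℤ) : ℂ) •
    ((PiTensorProduct.reindex ℂ (fun _ : Boxes ν => W) p.1).toLinearMap ∘ₗ
      (PiTensorProduct.reindex ℂ (fun _ : Boxes ν => W) q.1).toLinearMap)

/-- The Schur functor `S^ν` on vector spaces: the image of the Young symmetrizer on
`W^{⊗ |ν|}`; a linear endomorphism `g` of `W` acts through `g^{⊗ |ν|}`. -/
def schurFunctor {r : ℕ} (ν : Fin r → ℕ) (W : Type*) [AddCommGroup W] [Module ℂ W] :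
    Submodule ℂ (⨂[ℂ] _ : Boxes ν, W) :=
  LinearMap.range (youngSymmetrizer ν W)

/-- The action of the diagonal matrix `diag(t_1, …, t_r)` on `(ℂ^r)^{⊗ |ν|}`. -/
def torusAction {r : ℕ} (ν : Fin r → ℕ) (t : Fin r → ℂˣ) :
    Module.End ℂ (⨂[ℂ] _ : Boxes ν, (Fin r → ℂ)) :=
  PiTensorProduct.map fun _ => Matrix.toLin' (Matrix.diagonal fun i => (t i : ℂ))

/-- The subspace of weight `μ` of `S^ν(ℂ^r)`, on which `diag(t_1, …, t_r)` acts by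
`t_1^{μ_1} ⋯ t_r^{μ_r}`. -/
def schurWeightSpace {r : ℕ} (ν μ : Fin r → ℕ) :
    Submodule ℂ (⨂[ℂ] _ : Boxes ν, (Fin r → ℂ)) :=
  schurFunctor ν (Fin r → ℂ) ⊓
    ⨅ t : Fin r → ℂˣ, Module.End.eigenspace (torusAction ν t) (∏ i, (t i : ℂ) ^ μ i)

/-- The multiplicity of the weight `μ` in `S^ν(ℂ^r)`. -/
def weightMult {r : ℕ} (ν μ : Fin r → ℕ) : ℕ :=
  Module.finrank ℂ (schurWeightSpace ν μ)

theorem weightMult_le_comp {r : ℕ} (ν μ : Fin r → ℕ) (e : Equiv.Perm (Fin r)) :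
    weightMult ν μ ≤ weightMult ν (μ ∘ e) := by
  let π : (Fin r → ℂ) ≃ₗ[ℂ] (Fin r → ℂ) := LinearEquiv.funCongrLeft ℂ ℂ e
  let T : (⨂[ℂ] _ : Boxes ν, (Fin r → ℂ)) ≃ₗ[ℂ] (⨂[ℂ] _ : Boxes ν, (Fin r → ℂ)) :=
    PiTensorProduct.congr fun _ => π
  have hT : ∀ w : Boxes ν → Fin r → ℂ,
      T (PiTensorProduct.tprod ℂ w) = PiTensorProduct.tprod ℂ fun c => π (w c) := fun w =>
    PiTensorProduct.congr_tprod _ w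
  have hreindex : ∀ (p : Equiv.Perm (Boxes ν)) x,
      PiTensorProduct.reindex ℂ (fun _ : Boxes ν => (Fin r → ℂ)) p (T x)
        = T (PiTensorProduct.reindex ℂ (fun _ : Boxes ν => (Fin r → ℂ)) p x) := fun p x => by
    induction x using PiTensorProduct.induction_on with
    | smul_tprod a w => simp only [map_smul, hT, PiTensorProduct.reindex_tprod]
    | add x y hx hy => simp only [map_add, hx, hy]
  have hyoung : ∀ x, youngSymmetrizer ν (Fin r → ℂ) (T x)
      = T (youngSymmetrizer ν (Fin r → ℂ) x) := fun x => by
    simp only [youngSymmetrizer, LinearMap.sum_apply, LinearMap.smul_apply,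
      LinearMap.comp_apply, LinearEquiv.coe_coe, map_sum, map_smul]
    simp only [hreindex]
  have htorus : ∀ (t : Fin r → ℂˣ) x,
      torusAction ν t (T x) = T (torusAction ν (t ∘ e.symm) x) := fun t x => by
    induction x using PiTensorProduct.induction_on with
    | smul_tprod a w =>
      simp only [map_smul, hT, torusAction, PiTensorProduct.map_tprod]
      congr 2
      ext1 c
      ext1 i
      simp [π, LinearEquiv.funCongrLeft_apply, Matrix.mulVec_diagonal, LinearMap.funLeft_apply]
    | add x y hx hy => simp only [map_add, hx, hy]
  rw [weightMult, weightMult, ← LinearEquiv.finrank_map_eq T]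
  apply Submodule.finrank_mono
  rintro _ ⟨x, hx, rfl⟩
  rw [schurWeightSpace, SetLike.mem_coe, Submodule.mem_inf, Submodule.mem_iInf] at hx
  rw [schurWeightSpace, Submodule.mem_inf, Submodule.mem_iInf]
  refine ⟨?_, fun t => ?_⟩
  · obtain ⟨y, hy⟩ := hx.1
    exact ⟨T y, by rw [hyoung, hy]; rfl⟩
  · have h := hx.2 (t ∘ e.symm)
    rw [Module.End.mem_eigenspace_iff] at h ⊢
    change torusAction ν t (T x) = _ • T x
    rw [htorus, h, map_smul]
    congr 1
    rw [← Equiv.prod_comp e]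
    simp

theorem weightMult_comp {r : ℕ} (ν μ : Fin r → ℕ) (e : Equiv.Perm (Fin r)) :
    weightMult ν (μ ∘ e) = weightMult ν μ := by
  refine le_antisymm ?_ (weightMult_le_comp ν μ e)
  have h := weightMult_le_comp ν (μ ∘ e) e.symm
  rwa [Function.comp_assoc, Equiv.self_comp_symm, Function.comp_id] at h

/-- The modified Chern character `Ch(S^ν V^*) = ∑_δ e^{2πi δ}` of the bundle `S^ν V^*` on
`G(r,N)`, up to degree `D`, as a polynomial in the Chern roots `x_1, …, x_r` of `V^*`.
When `V^*` splits into line bundles `L_1, …, L_r`, the bundle `S^ν V^*` is the sum over the weights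
`μ` of `S^ν(ℂ^r)` (with multiplicity) of `L_1^{μ_1} ⊗ ⋯ ⊗ L_r^{μ_r}`, so that its Chern roots are
the `μ_1 x_1 + ⋯ + μ_r x_r`. All weights satisfy `μ_1 + ⋯ + μ_r = |ν|`. -/
def chSchurPoly {r : ℕ} (ν : Fin r → ℕ) (D : ℕ) : MvPolynomial (Fin r) ℂ :=
  ∑ μ ∈ Finset.piAntidiag (Finset.univ : Finset (Fin r)) (∑ i, ν i),
    (weightMult ν μ : ℂ) •
      truncExp D ((2 * Real.pi * Complex.I : ℂ) • ∑ i, (μ i : ℂ) • MvPolynomial.X i)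

theorem chSchurPoly_isSymmetric {r : ℕ} (ν : Fin r → ℕ) (D : ℕ) :
    (chSchurPoly ν D).IsSymmetric := by
  intro e
  simp only [chSchurPoly, map_sum, map_smul, map_truncExp, MvPolynomial.rename_X]
  refine Finset.sum_nbij' (fun a => a ∘ e.symm) (fun a => a ∘ e) ?_ ?_ ?_ ?_ ?_
  · intro a ha
    simp only [Finset.mem_piAntidiag, Finset.mem_univ, implies_true, and_true] at ha ⊢
    rw [← ha]
    exact Equiv.sum_comp e.symm a
  · intro a ha
    simp only [Finset.mem_piAntidiag, Finset.mem_univ, implies_true, and_true] at ha ⊢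
    rw [← ha]
    exact Equiv.sum_comp e a
  · intro a _
    ext p
    simp
  · intro a _
    ext p
    simp
  · intro a _
    rw [weightMult_comp, ← Equiv.sum_comp e (fun i => ((a ∘ e.symm) i : ℂ) •
      (MvPolynomial.X i : MvPolynomial (Fin r) ℂ))]
    simp

/-- `Ch(S^ν V^*)` in the cohomology of `G(r,N)`; the dimension of `G(r,N)` is `r (N - r)`. -/
def chSchurBundle {r : ℕ} (N : ℕ) (ν : Fin r → ℕ) : HG r N :=
  toHG r N ⟨chSchurPoly ν (r * (N - r)), chSchurPoly_isSymmetric ν (r * (N - r))⟩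

/-- `Ch(O(k)) = e^{2πi k h}` in the cohomology of `ℙ^{N-1}`. -/
def chO (N : ℕ) (k : ℤ) : HG 1 N :=
  truncExp (N - 1) ((2 * Real.pi * Complex.I * k : ℂ) • specialClass 1 N 1)

end GammaGrassmannian

end

/-!
Pulled back to the cohomology `ℂ[x_1, …, x_r] / ⟨h_{N-r+1}, …, h_N⟩` of the bundle of complete
flags of `V`, and multiplied by the Vandermonde determinant of the `x_i`, the Satake identification
becomes `u_1 ∧ ⋯ ∧ u_r ↦ det (u_j(x_i))`. Pulling back and multiplying by the Vandermonde
determinant is injective on `H^•(𝔾)`, so it is enough to compute one determinant of power series.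

Taking `Γ(1 + x_i)^N` out of each row leaves `det (e^{2πi (ν_j + r - j) x_i})`. By the Weyl
character formula it is `Ch(S^ν V^*)` times the product of the `e^{2πi x_i} - e^{2πi x_j}` over
`i < j`, and Euler's reflection formula turns each factor into
`2πi (x_i - x_j) e^{πi (x_i + x_j)} / (Γ(1 + x_i - x_j) Γ(1 + x_j - x_i))`. Since
`T𝔾 ⊕ V^* ⊗ V` and `(V^*)^{⊕ N}` have the same Chern character, what remains is the Gamma class
of `𝔾`.

With the Schur functor given by the Young symmetrizer, the Weyl character formula is obtained as
follows. The sum of all transpositions acts on the image of the symmetrizer by a scalar. On words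
this sum is essentially the Casimir operator of `gl_r`, and taking traces over weight spaces shows
that the character times the Vandermonde determinant is an eigenvector of the Laplacian
`∑_k (x_k ∂/∂x_k)^2`. An antisymmetric eigenvector whose dominant monomial is
`∏_j x_j ^ (ν_j + r - j)` is the corresponding alternant.
-/

open scoped TensorProduct PowerSeries

noncomputable section

namespace GammaGrassmannian

/-! ### Power series in a bookkeeping variable -/

section CoeffSum

variable {A B : Type*} [CommRing A] [CommRing B]

/-- The sum of the coefficients of degree at most `D`: a truncated class is recovered from its
graded generating series `∑ u_d t^d` by setting `t = 1`. -/
def coeffSum (D : ℕ) : A⟦X⟧ →ₗ[A] A :=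
  ∑ d ∈ Finset.range (D + 1), PowerSeries.coeff d

theorem coeffSum_apply (D : ℕ) (u : A⟦X⟧) :
    coeffSum D u = ∑ d ∈ Finset.range (D + 1), PowerSeries.coeff d u := by
  simp only [coeffSum, LinearMap.sum_apply]

theorem coeffSum_map (F : A →+* B) (D : ℕ) (u : A⟦X⟧) :
    coeffSum D (PowerSeries.map F u) = F (coeffSum D u) := by
  simp only [coeffSum_apply, PowerSeries.coeff_map, map_sum]

theorem coeffSum_mul_eq_sum_filter (D : ℕ) (u v : A⟦X⟧) :
    coeffSum D (u * v) =
      ∑ p ∈ (Finset.range (D + 1) ×ˢ Finset.range (D + 1)).filter (fun p => p.1 + p.2 ≤ D),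
        PowerSeries.coeff p.1 u * PowerSeries.coeff p.2 v := by
  simp_rw [coeffSum_apply, PowerSeries.coeff_mul]
  rw [Finset.sum_sigma']
  refine Finset.sum_bij' (fun x _ => x.2) (fun p _ => ⟨p.1 + p.2, p⟩) ?_ ?_ ?_
    (fun _ _ => rfl) (fun _ _ => rfl)
  · rintro ⟨d, p⟩ hx
    simp only [Finset.mem_sigma, Finset.mem_range, Finset.HasAntidiagonal.mem_antidiagonal,
      Finset.mem_filter, Finset.mem_product] at hx ⊢
    omega
  · intro p hp
    simp only [Finset.mem_sigma, Finset.mem_range, Finset.HasAntidiagonal.mem_antidiagonal,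
      Finset.mem_filter, Finset.mem_product, and_true] at hp ⊢
    omega
  · rintro ⟨d, p⟩ hx
    simp only [Finset.mem_sigma, Finset.HasAntidiagonal.mem_antidiagonal] at hx
    obtain ⟨-, rfl⟩ := hx
    rfl

theorem coeffSum_mul (D : ℕ) (u v : A⟦X⟧)
    (h : ∀ i j, D < i + j → PowerSeries.coeff i u * PowerSeries.coeff j v = 0) :
    coeffSum D (u * v) = coeffSum D u * coeffSum D v := by
  rw [coeffSum_mul_eq_sum_filter, coeffSum_apply, coeffSum_apply, Finset.sum_mul_sum,
    ← Finset.sum_product']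
  refine Finset.sum_subset (Finset.filter_subset _ _) fun p hp hp' => h _ _ ?_
  simp only [Finset.mem_filter, not_and, not_le] at hp'
  exact hp' hp

end CoeffSum

section ScaledSeries

variable {A B : Type*} [CommRing A] [Algebra ℂ A] [CommRing B] [Algebra ℂ B]

/-- The series `φ(a t)` in `A⟦t⟧`, for a power series `φ` over `ℂ`. -/
def scaledSeries (a : A) : ℂ⟦X⟧ →+* A⟦X⟧ :=
  (PowerSeries.rescale a).comp (PowerSeries.map (algebraMap ℂ A))

theorem coeff_scaledSeries (a : A) (φ : ℂ⟦X⟧) (n : ℕ) :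
    PowerSeries.coeff n (scaledSeries a φ) = PowerSeries.coeff n φ • a ^ n := by
  rw [scaledSeries, RingHom.comp_apply, PowerSeries.coeff_rescale, PowerSeries.coeff_map,
    Algebra.smul_def, mul_comm]

theorem map_scaledSeries (F : A →ₐ[ℂ] B) (a : A) (φ : ℂ⟦X⟧) :
    PowerSeries.map (F : A →+* B) (scaledSeries a φ) = scaledSeries (F a) φ := by
  ext n
  simp [coeff_scaledSeries]

theorem scaledSeries_smul (c : ℂ) (a : A) (φ : ℂ⟦X⟧) :
    scaledSeries (c • a) φ = scaledSeries a (PowerSeries.rescale c φ) := by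
  ext n
  rw [coeff_scaledSeries, coeff_scaledSeries, PowerSeries.coeff_rescale, smul_pow, smul_smul,
    mul_comm]

theorem scaledSeries_X (a : A) :
    scaledSeries a PowerSeries.X = PowerSeries.C a * PowerSeries.X := by
  rw [scaledSeries, RingHom.comp_apply, PowerSeries.map_X, PowerSeries.rescale_X]

theorem scaledSeries_C (a : A) (c : ℂ) :
    scaledSeries a (PowerSeries.C c) = PowerSeries.C (algebraMap ℂ A c) := by
  ext n
  rw [coeff_scaledSeries, PowerSeries.coeff_C, PowerSeries.coeff_C]
  split_ifs with h
  · rw [h, pow_zero, Algebra.algebraMap_eq_smul_one]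
  · rw [zero_smul]

theorem scaledSeries_zero (φ : ℂ⟦X⟧) :
    scaledSeries (0 : A) φ = PowerSeries.C (algebraMap ℂ A (PowerSeries.constantCoeff φ)) := by
  ext (_ | n)
  · simp [coeff_scaledSeries, Algebra.smul_def]
  · simp [coeff_scaledSeries]

/-- The series `e^{a t}`. -/
def expSeries (a : A) : A⟦X⟧ := scaledSeries a (PowerSeries.exp ℂ)

theorem expSeries_smul (c : ℂ) (a : A) :
    expSeries (c • a) = scaledSeries a (PowerSeries.rescale c (PowerSeries.exp ℂ)) :=
  scaledSeries_smul c a _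

theorem map_expSeries (F : A →ₐ[ℂ] B) (a : A) :
    PowerSeries.map (F : A →+* B) (expSeries a) = expSeries (F a) :=
  map_scaledSeries F a _

theorem expSeries_zero : expSeries (0 : A) = 1 := by
  simp [expSeries, scaledSeries_zero]

theorem expSeries_add (a b : A) : expSeries (a + b) = expSeries a * expSeries b := by
  let : Algebra ℚ A := Algebra.compHom A (algebraMap ℚ ℂ)
  have : IsScalarTower ℚ ℂ A := IsScalarTower.of_algebraMap_eq fun _ => rfl
  have map_exp : PowerSeries.map (algebraMap ℂ A) (PowerSeries.exp ℂ) = PowerSeries.exp A :=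
    PowerSeries.map_exp _
  simp only [expSeries, scaledSeries, RingHom.comp_apply, map_exp]
  exact (PowerSeries.exp_mul_exp_eq_exp_add a b).symm

theorem expSeries_sum {ι : Type*} (s : Finset ι) (a : ι → A) :
    expSeries (∑ i ∈ s, a i) = ∏ i ∈ s, expSeries (a i) := by
  classical
  induction s using Finset.induction_on with
  | empty => exact expSeries_zero
  | insert i s hi ih => rw [Finset.sum_insert hi, Finset.prod_insert hi, expSeries_add, ih]

theorem expSeries_nsmul (k : ℕ) (a : A) : expSeries (k • a) = expSeries a ^ k := by
  simpa using expSeries_sum (Finset.range k) fun _ => a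

theorem coeff_prod_scaledSeries {ι : Type*} [Fintype ι] [DecidableEq ι]
    (φ : ℂ⟦X⟧) (δ : ι → A) (d : ℕ) :
    PowerSeries.coeff d (∏ p, scaledSeries (δ p) φ) =
      ∑ a ∈ Finset.piAntidiag (Finset.univ : Finset ι) d,
        ∏ p, (PowerSeries.coeff (a p) φ) • δ p ^ a p := by
  rw [PowerSeries.coeff_prod]
  refine Finset.sum_equiv Finsupp.equivFunOnFinite (fun l => ?_) fun l _ => ?_
  · simp [Finset.mem_finsuppAntidiag, Finset.mem_piAntidiag]
  · simp [coeff_scaledSeries]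

theorem truncProd_eq_coeffSum {ι : Type*} [Fintype ι] [DecidableEq ι]
    (φ : ℂ⟦X⟧) (δ : ι → A) (D : ℕ) :
    truncProd φ δ D = coeffSum D (∏ p, scaledSeries (δ p) φ) := by
  simp only [truncProd, coeffSum_apply, coeff_prod_scaledSeries]

theorem truncExp_eq_coeffSum (D : ℕ) (a : A) : truncExp D a = coeffSum D (expSeries a) := by
  simp [truncExp, coeffSum_apply, expSeries, coeff_scaledSeries, PowerSeries.coeff_exp]

end ScaledSeries

/-! ### The reflection formula for the Gamma series -/

/-- The Taylor series of `f` at `0`. -/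
def taylorSeries (f : ℂ → ℂ) : ℂ⟦X⟧ :=
  PowerSeries.mk fun n => iteratedDeriv n f 0 / (n.factorial : ℂ)

theorem taylorSeries_congr {f g : ℂ → ℂ} (h : f =ᶠ[nhds 0] g) :
    taylorSeries f = taylorSeries g := by
  ext n
  simp only [taylorSeries, PowerSeries.coeff_mk, h.iteratedDeriv_eq]

theorem taylorSeries_sub {f g : ℂ → ℂ} (hf : AnalyticAt ℂ f 0) (hg : AnalyticAt ℂ g 0) :
    taylorSeries (f - g) = taylorSeries f - taylorSeries g := by
  ext n
  simp only [taylorSeries, map_sub, PowerSeries.coeff_mk,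
    iteratedDeriv_sub hf.contDiffAt hg.contDiffAt, sub_div]

theorem taylorSeries_mul {f g : ℂ → ℂ} (hf : AnalyticAt ℂ f 0) (hg : AnalyticAt ℂ g 0) :
    taylorSeries (f * g) = taylorSeries f * taylorSeries g := by
  ext n
  simp only [taylorSeries, PowerSeries.coeff_mul, PowerSeries.coeff_mk]
  rw [iteratedDeriv_mul hf.contDiffAt hg.contDiffAt, Finset.sum_div,
    Finset.Nat.sum_antidiagonal_eq_sum_range_succ
      (fun i j => iteratedDeriv i f 0 / (i.factorial : ℂ) * (iteratedDeriv j g 0 / j.factorial)) n]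
  refine Finset.sum_congr rfl fun i hi => ?_
  rw [Nat.cast_choose ℂ (Nat.lt_succ_iff.1 (Finset.mem_range.1 hi))]
  have hfact : ∀ k : ℕ, (k.factorial : ℂ) ≠ 0 := fun k => by exact_mod_cast k.factorial_ne_zero
  field_simp [hfact]

theorem taylorSeries_one : taylorSeries 1 = 1 := by
  ext n
  rcases n with _ | n
  · simp [taylorSeries]
  · simp [taylorSeries, PowerSeries.coeff_one, Pi.one_def, iteratedDeriv_const]

theorem taylorSeries_const_mul (c : ℂ) :
    taylorSeries (fun z => c * z) = PowerSeries.C c * PowerSeries.X := by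
  ext n
  simp only [taylorSeries, PowerSeries.coeff_C_mul, PowerSeries.coeff_X, PowerSeries.coeff_mk]
  rcases n with _ | _ | n
  · simp
  · simp
  · rw [iteratedDeriv_succ', iteratedDeriv_succ']
    simp

theorem taylorSeries_exp_mul (c : ℂ) :
    taylorSeries (fun z => Complex.exp (c * z)) = PowerSeries.rescale c (PowerSeries.exp ℂ) := by
  ext n
  simp [taylorSeries, PowerSeries.coeff_rescale, PowerSeries.coeff_exp,
    iteratedDeriv_cexp_const_mul, div_eq_mul_inv]

theorem taylorSeries_Gamma_one_add :
    taylorSeries (fun z => Complex.Gamma (1 + z)) = gammaSeries := by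
  ext n
  simp [taylorSeries, gammaSeries, iteratedDeriv_comp_const_add]

theorem taylorSeries_Gamma_one_sub :
    taylorSeries (fun z => Complex.Gamma (1 - z)) = PowerSeries.rescale (-1) gammaSeries := by
  rw [← taylorSeries_Gamma_one_add]
  ext n
  have h := iteratedDeriv_comp_neg n (fun z => Complex.Gamma (1 + z)) 0
  simp only [← sub_eq_add_neg, neg_zero] at h
  simp [taylorSeries, PowerSeries.coeff_rescale, h, mul_div_assoc]

theorem analyticAt_Gamma_one : AnalyticAt ℂ Complex.Gamma 1 := by
  have hinv : AnalyticAt ℂ (fun z => (Complex.Gamma z)⁻¹) 1 :=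
    Complex.differentiable_one_div_Gamma.analyticAt 1
  simpa [Pi.inv_def] using hinv.inv (by simp)

theorem sin_pi_mul_ne_zero {z : ℂ} (hz : z ≠ 0) (hz' : ‖z‖ < 1) :
    Complex.sin (Real.pi * z) ≠ 0 := by
  intro h
  obtain ⟨k, hk⟩ := Complex.sin_eq_zero_iff.1 h
  have hzk : z = k :=
    mul_left_cancel₀ (Complex.ofReal_ne_zero.2 Real.pi_ne_zero) (by rw [hk, mul_comm])
  rw [hzk, Complex.norm_intCast] at hz'
  have hk0 : k = 0 := Int.abs_lt_one_iff.1 (by exact_mod_cast hz')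
  exact hz (by rw [hzk, hk0, Int.cast_zero])

theorem exp_two_pi_I_mul_sub_one (z : ℂ) :
    Complex.exp (2 * Real.pi * Complex.I * z) - 1 =
      2 * Complex.I * Complex.sin (Real.pi * z) * Complex.exp (Real.pi * Complex.I * z) := by
  have hsq : Complex.exp (2 * Real.pi * Complex.I * z) =
      Complex.exp (Real.pi * Complex.I * z) * Complex.exp (Real.pi * Complex.I * z) := by
    rw [← Complex.exp_add]; ring_nf
  have hinv :
      Complex.exp (-(Real.pi * Complex.I * z)) * Complex.exp (Real.pi * Complex.I * z) = 1 := by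
    rw [← Complex.exp_add, neg_add_cancel, Complex.exp_zero]
  rw [Complex.sin, show -(Real.pi * z) * Complex.I = -(Real.pi * Complex.I * z) by ring,
    show Real.pi * z * Complex.I = Real.pi * Complex.I * z by ring, hsq]
  generalize Complex.exp (-(Real.pi * Complex.I * z)) = F at *
  generalize Complex.exp (Real.pi * Complex.I * z) = E at *
  linear_combination (E * E - F * E) * Complex.I_sq + hinv

theorem Gamma_one_add_mul_Gamma_one_sub {z : ℂ} (hz : ‖z‖ < 1) :
    Complex.Gamma (1 + z) * Complex.Gamma (1 - z) *
        (Complex.exp (2 * Real.pi * Complex.I * z) - 1) =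
      2 * Real.pi * Complex.I * z * Complex.exp (Real.pi * Complex.I * z) := by
  rcases eq_or_ne z 0 with rfl | h0
  · simp
  have hsin := sin_pi_mul_ne_zero h0 hz
  rw [add_comm 1 z, Complex.Gamma_add_one z h0, exp_two_pi_I_mul_sub_one, mul_assoc z,
    Complex.Gamma_mul_Gamma_one_sub]
  generalize Complex.sin (Real.pi * z) = s at *
  field_simp

theorem gammaSeries_reflection :
    gammaSeries * PowerSeries.rescale (-1) gammaSeries *
        (PowerSeries.rescale (2 * Real.pi * Complex.I : ℂ) (PowerSeries.exp ℂ) - 1) =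
      PowerSeries.C (2 * Real.pi * Complex.I : ℂ) * PowerSeries.X *
        PowerSeries.rescale (Real.pi * Complex.I : ℂ) (PowerSeries.exp ℂ) := by
  have hΓadd : AnalyticAt ℂ (fun z => Complex.Gamma (1 + z)) 0 :=
    AnalyticAt.fun_comp (by simpa using analyticAt_Gamma_one) (by fun_prop)
  have hΓsub : AnalyticAt ℂ (fun z => Complex.Gamma (1 - z)) 0 :=
    AnalyticAt.fun_comp (by simpa using analyticAt_Gamma_one) (by fun_prop)
  have hexp : ∀ c : ℂ, AnalyticAt ℂ (fun z => Complex.exp (c * z)) 0 := fun c => by fun_prop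
  have hlin : AnalyticAt ℂ (fun z : ℂ => (2 * Real.pi * Complex.I : ℂ) * z) 0 := by fun_prop
  have hone : AnalyticAt ℂ (1 : ℂ → ℂ) 0 := analyticAt_const
  rw [← taylorSeries_Gamma_one_sub, ← taylorSeries_Gamma_one_add, ← taylorSeries_exp_mul,
    ← taylorSeries_exp_mul, ← taylorSeries_const_mul, ← taylorSeries_one,
    ← taylorSeries_sub (hexp _) hone, ← taylorSeries_mul hΓadd hΓsub,
    ← taylorSeries_mul (hΓadd.mul hΓsub) ((hexp _).sub hone), ← taylorSeries_mul hlin (hexp _)]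
  refine taylorSeries_congr ?_
  filter_upwards [Metric.ball_mem_nhds (0 : ℂ) one_pos] with z hz
  exact Gamma_one_add_mul_Gamma_one_sub (by simpa using hz)

theorem constantCoeff_gammaSeries : PowerSeries.constantCoeff gammaSeries = 1 := by
  simp [gammaSeries, ← PowerSeries.coeff_zero_eq_constantCoeff_apply]

theorem constantCoeff_gammaSeries_inv : PowerSeries.constantCoeff gammaSeries⁻¹ = 1 := by
  rw [PowerSeries.constantCoeff_inv, constantCoeff_gammaSeries, inv_one]

theorem gammaSeries_mul_inv : gammaSeries * gammaSeries⁻¹ = 1 :=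
  PowerSeries.mul_inv_cancel _ (by simp [constantCoeff_gammaSeries])

/-- This is the reflection formula `Γ(1 + z) Γ(1 - z) = πz / sin πz` at `z = (x - y) t`. -/
theorem expSeries_sub_expSeries {A : Type*} [CommRing A] [Algebra ℂ A] (x y : A) :
    expSeries ((2 * Real.pi * Complex.I : ℂ) • x) -
        expSeries ((2 * Real.pi * Complex.I : ℂ) • y) =
      PowerSeries.C (algebraMap ℂ A (2 * Real.pi * Complex.I)) *
        (PowerSeries.C (x - y) * PowerSeries.X) *
        (scaledSeries (x - y) gammaSeries⁻¹ * scaledSeries (y - x) gammaSeries⁻¹) *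
        expSeries ((Real.pi * Complex.I : ℂ) • (x + y)) := by
  have scaled_mul_inv (a : A) : scaledSeries a gammaSeries * scaledSeries a gammaSeries⁻¹ = 1 := by
    rw [← map_mul, gammaSeries_mul_inv, map_one]
  have reflection : scaledSeries (x - y) gammaSeries * scaledSeries (y - x) gammaSeries *
      (expSeries ((2 * Real.pi * Complex.I : ℂ) • (x - y)) - 1) =
      PowerSeries.C (algebraMap ℂ A (2 * Real.pi * Complex.I)) *
        (PowerSeries.C (x - y) * PowerSeries.X) *
        expSeries ((Real.pi * Complex.I : ℂ) • (x - y)) := by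
    have h := congrArg (scaledSeries (x - y)) gammaSeries_reflection
    rw [map_mul, map_mul, map_sub, map_one, map_mul, map_mul, scaledSeries_C, scaledSeries_X,
      ← expSeries_smul, ← expSeries_smul, ← scaledSeries_smul, neg_one_smul, neg_sub] at h
    exact h
  have exp_half : expSeries ((Real.pi * Complex.I : ℂ) • (x + y)) =
      expSeries ((Real.pi * Complex.I : ℂ) • (x - y)) *
        expSeries ((2 * Real.pi * Complex.I : ℂ) • y) := by
    rw [← expSeries_add]; congr 1; module
  have exp_full : expSeries ((2 * Real.pi * Complex.I : ℂ) • x) =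
      expSeries ((2 * Real.pi * Complex.I : ℂ) • (x - y)) *
        expSeries ((2 * Real.pi * Complex.I : ℂ) • y) := by
    rw [← expSeries_add]; congr 1; module
  rw [exp_half, exp_full]
  linear_combination
    scaledSeries (x - y) gammaSeries⁻¹ * scaledSeries (y - x) gammaSeries⁻¹ *
        expSeries ((2 * Real.pi * Complex.I : ℂ) • y) * reflection
      - (expSeries ((2 * Real.pi * Complex.I : ℂ) • (x - y)) - 1) *
        expSeries ((2 * Real.pi * Complex.I : ℂ) • y) *
        (scaledSeries (y - x) gammaSeries * scaledSeries (y - x) gammaSeries⁻¹ *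
          scaled_mul_inv (x - y) + scaled_mul_inv (y - x))

/-! ### Generating function of the complete symmetric polynomials -/

theorem mk_pow_mul_one_sub {R : Type*} [CommRing R] (a : R) :
    PowerSeries.mk (a ^ ·) * (1 - PowerSeries.C a * PowerSeries.X) = 1 := by
  have h := congrArg (PowerSeries.rescale a) (PowerSeries.mk_one_mul_one_sub_eq_one R)
  rw [map_mul, map_sub, map_one, PowerSeries.rescale_X, PowerSeries.rescale_mk] at h
  simpa using h

theorem mk_hsymm (σ R : Type*) [Fintype σ] [DecidableEq σ] [CommRing R] :
    PowerSeries.mk (MvPolynomial.hsymm σ R) =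
      ∏ i : σ, PowerSeries.mk ((MvPolynomial.X i : MvPolynomial σ R) ^ ·) := by
  ext1 d
  simp only [PowerSeries.coeff_prod, PowerSeries.coeff_mk, MvPolynomial.hsymm]
  refine Finset.sum_bij' (fun s _ => Multiset.toFinsupp (s : Multiset σ))
    (fun f hf => ⟨Finsupp.toMultiset f, ?_⟩) ?_ ?_ ?_ ?_ ?_
  · rw [Finsupp.card_toMultiset, Finsupp.sum_fintype _ _ fun _ => rfl]
    exact (Finset.mem_finsuppAntidiag.1 hf).1
  · intro s _
    simp only [Finset.mem_finsuppAntidiag, Finset.subset_univ, and_true, Multiset.toFinsupp_apply]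
    exact (Multiset.sum_count_eq_card fun a _ => Finset.mem_univ a).trans s.2
  · exact fun _ _ => Finset.mem_univ _
  · exact fun s _ => Subtype.ext (by simp)
  · exact fun f _ => by simp
  · intro s _
    rw [Finset.prod_multiset_map_count]
    simp only [Multiset.toFinsupp_apply]
    exact Finset.prod_subset (Finset.subset_univ _) fun i _ hi => by
      rw [Multiset.count_eq_zero.2 (by simpa using hi), pow_zero]

theorem mk_hsymm_mul_prod (σ R : Type*) [Fintype σ] [DecidableEq σ] [CommRing R] :
    PowerSeries.mk (MvPolynomial.hsymm σ R) *
      ∏ i : σ, (1 - PowerSeries.C (MvPolynomial.X i : MvPolynomial σ R) * PowerSeries.X) = 1 := by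
  rw [mk_hsymm, ← Finset.prod_mul_distrib]
  exact Finset.prod_eq_one fun i _ => mk_pow_mul_one_sub _

theorem mk_X_pow_eq {σ : Type*} (R : Type*) [Fintype σ] [DecidableEq σ] [CommRing R] (i : σ) :
    PowerSeries.mk ((MvPolynomial.X i : MvPolynomial σ R) ^ ·)
      = PowerSeries.mk (MvPolynomial.hsymm σ R) * ∏ l ∈ Finset.univ.erase i,
        (1 - PowerSeries.C (MvPolynomial.X l : MvPolynomial σ R) * PowerSeries.X) := by
  have hprod := mk_hsymm_mul_prod σ R
  rw [← Finset.mul_prod_erase _ _ (Finset.mem_univ i)] at hprod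
  exact left_inv_eq_right_inv (mk_pow_mul_one_sub _) ((mul_left_comm _ _ _).trans hprod)

theorem coeff_prod_one_sub_eq_zero {ι R : Type*} [CommRing R] (s : Finset ι) (a : ι → R)
    {k : ℕ} (hk : s.card < k) :
    PowerSeries.coeff k (∏ i ∈ s, (1 - PowerSeries.C (a i) * PowerSeries.X)) = 0 := by
  let P : Polynomial R := ∏ i ∈ s, (1 - Polynomial.C (a i) * Polynomial.X)
  have hdeg : P.natDegree ≤ s.card := by
    refine (Polynomial.natDegree_prod_le _ _).trans
      ((Finset.sum_le_card_nsmul _ _ 1 fun i _ => ?_).trans_eq (by simp))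
    compute_degree
  have hP : (P : R⟦X⟧) = ∏ i ∈ s, (1 - PowerSeries.C (a i) * PowerSeries.X) := by
    rw [← Polynomial.coeToPowerSeries.ringHom_apply, map_prod]
    exact Finset.prod_congr rfl fun i _ => by simp
  rw [← hP, Polynomial.coeff_coe, Polynomial.coeff_eq_zero_of_natDegree_lt (hdeg.trans_lt hk)]

/-! ### The flag ring -/

/-- The ideal of `ℂ[x_1, …, x_r]` generated by `h_{N-r+1}, …, h_N`. -/
def flagIdeal (r N : ℕ) : Ideal (MvPolynomial (Fin r) ℂ) :=
  (relIdeal r N).map (MvPolynomial.symmetricSubalgebra (Fin r) ℂ).val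

/-- The ring `ℂ[x_1, …, x_r] / ⟨h_{N-r+1}, …, h_N⟩`, that is, the cohomology of the bundle of
complete flags in `V` over `G(r,N)`, in which the Chern roots `x_i` of `V^*` exist. -/
abbrev FlagRing (r N : ℕ) : Type := MvPolynomial (Fin r) ℂ ⧸ flagIdeal r N

/-- The class of a polynomial in the flag ring. -/
abbrev toFlagRing (r N : ℕ) : MvPolynomial (Fin r) ℂ →ₐ[ℂ] FlagRing r N :=
  Ideal.Quotient.mkₐ ℂ (flagIdeal r N)

/-- The pullback map from the cohomology of the Grassmannian to that of the flag bundle. -/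
def pullback (r N : ℕ) : HG r N →ₐ[ℂ] FlagRing r N :=
  Ideal.quotientMapₐ (flagIdeal r N) (MvPolynomial.symmetricSubalgebra (Fin r) ℂ).val
    Ideal.le_comap_map

theorem pullback_toHG (r N : ℕ) (f : SymPoly r) :
    pullback r N (toHG r N f) = toFlagRing r N f := rfl

theorem hsymm_mem_flagIdeal {r N : ℕ} (k : ℕ) (hk : N < k + r) :
    MvPolynomial.hsymm (Fin r) ℂ k ∈ flagIdeal r N := by
  induction k using Nat.strong_induction_on with
  | _ k ih =>
    rcases le_or_gt k N with hkN | hNk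
    · exact Ideal.mem_map_of_mem (MvPolynomial.symmetricSubalgebra (Fin r) ℂ).val
        (Ideal.subset_span ⟨k, hk, hkN, rfl⟩ : hSym r k ∈ relIdeal r N)
    have hcoeff := congrArg (PowerSeries.coeff k) (mk_hsymm_mul_prod (Fin r) ℂ)
    rw [PowerSeries.coeff_mul, PowerSeries.coeff_one, if_neg (by omega),
      ← Finset.Nat.sum_antidiagonal_swap, Finset.Nat.sum_antidiagonal_eq_sum_range_succ_mk,
      Finset.sum_range_succ'] at hcoeff
    simp only [Prod.swap, PowerSeries.coeff_mk, Nat.sub_zero,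
      PowerSeries.coeff_zero_eq_constantCoeff, map_prod, map_sub, map_one, map_mul,
      PowerSeries.constantCoeff_X, mul_zero, sub_zero, Finset.prod_const_one, mul_one] at hcoeff
    rw [eq_neg_of_add_eq_zero_right hcoeff]
    refine neg_mem (Ideal.sum_mem _ fun j hj => ?_)
    rw [Finset.mem_range] at hj
    rcases le_or_gt (j + 1) r with hjr | hrj
    · exact Ideal.mul_mem_right _ _ (ih _ (by omega) (by omega))
    · rw [coeff_prod_one_sub_eq_zero _ _ (by simpa using hrj), mul_zero]
      exact Ideal.zero_mem _

theorem X_pow_mem_flagIdeal {r N : ℕ} (i : Fin r) :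
    (MvPolynomial.X i : MvPolynomial (Fin r) ℂ) ^ N ∈ flagIdeal r N := by
  have hcoeff := congrArg (PowerSeries.coeff N) (mk_X_pow_eq ℂ i)
  rw [PowerSeries.coeff_mul, PowerSeries.coeff_mk] at hcoeff
  rw [hcoeff]
  refine Ideal.sum_mem _ fun p hp => ?_
  rw [Finset.HasAntidiagonal.mem_antidiagonal] at hp
  rcases lt_or_ge N (p.1 + r) with hlt | hge
  · rw [PowerSeries.coeff_mk]
    exact Ideal.mul_mem_right _ _ (hsymm_mem_flagIdeal _ hlt)
  · rw [coeff_prod_one_sub_eq_zero, mul_zero]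
    · exact Ideal.zero_mem _
    · have hr : 0 < r := i.pos
      rw [Finset.card_erase_of_mem (Finset.mem_univ i), Finset.card_univ, Fintype.card_fin]
      omega

/-! ### Antisymmetrization -/

section Antisymmetrization

variable {σ R : Type*} [Fintype σ] [DecidableEq σ] [CommRing R]

/-- A polynomial `g` is antisymmetric if `e(g) = sgn(e) g` for every permutation `e` of the
variables. -/
def IsAntisymmetric (g : MvPolynomial σ R) : Prop :=
  ∀ e : Equiv.Perm σ, MvPolynomial.rename e g = Equiv.Perm.sign e • g

theorem IsAntisymmetric.mul {g s : MvPolynomial σ R} (hg : IsAntisymmetric g)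
    (hs : s.IsSymmetric) : IsAntisymmetric (g * s) := fun e => by
  rw [map_mul, hs e, hg e, smul_mul_assoc]

theorem IsAntisymmetric.sub {g h : MvPolynomial σ R} (hg : IsAntisymmetric g)
    (hh : IsAntisymmetric h) : IsAntisymmetric (g - h) := fun e => by
  rw [map_sub, hg e, hh e, smul_sub]

theorem IsAntisymmetric.isSymmetric_of_mul [IsDomain R] {v s : MvPolynomial σ R} (hv0 : v ≠ 0)
    (hv : IsAntisymmetric v) (h : IsAntisymmetric (v * s)) : s.IsSymmetric := by
  intro e
  have hmul := h e
  rw [map_mul, hv e, smul_mul_assoc] at hmul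
  exact mul_left_cancel₀ hv0 (MulAction.injective _ hmul)

/-- The antisymmetrization `∑_e sgn(e) e(g)` of a polynomial `g`. -/
def antisymm : MvPolynomial σ R →ₗ[R] MvPolynomial σ R :=
  ∑ e : Equiv.Perm σ, Equiv.Perm.sign e •
    (MvPolynomial.rename e : MvPolynomial σ R →ₐ[R] MvPolynomial σ R).toLinearMap

theorem antisymm_apply (g : MvPolynomial σ R) :
    antisymm g = ∑ e : Equiv.Perm σ, Equiv.Perm.sign e • MvPolynomial.rename e g := by
  simp [antisymm]

theorem antisymm_mul_of_isSymmetric {s : MvPolynomial σ R} (hs : s.IsSymmetric)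
    (g : MvPolynomial σ R) : antisymm (g * s) = antisymm g * s := by
  rw [antisymm_apply, antisymm_apply, Finset.sum_mul]
  exact Finset.sum_congr rfl fun e _ => by rw [map_mul, hs e, smul_mul_assoc]

theorem IsAntisymmetric.antisymm_eq {g : MvPolynomial σ R} (hg : IsAntisymmetric g) :
    antisymm g = (Fintype.card σ).factorial • g := by
  rw [antisymm_apply]
  simp_rw [hg _, smul_smul, Int.units_mul_self, one_smul]
  rw [Finset.sum_const, Finset.card_univ, Fintype.card_perm]

theorem isAntisymmetric_antisymm (g : MvPolynomial σ R) : IsAntisymmetric (antisymm g) := by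
  intro e
  rw [antisymm_apply, map_sum, Finset.smul_sum]
  refine Fintype.sum_equiv (Equiv.mulLeft e) _ _ fun f => ?_
  rw [Equiv.coe_mulLeft, Equiv.Perm.coe_mul, ← MvPolynomial.rename_rename, map_mul, smul_smul,
    ← mul_assoc, Int.units_mul_self, one_mul, Units.smul_def, Units.smul_def, map_zsmul]

end Antisymmetrization

/-- The Vandermonde determinant `det (x_i ^ {r - j})`. -/
def vand (r : ℕ) : MvPolynomial (Fin r) ℂ := (alternant r fun j => (j.rev : ℕ)).det

theorem vand_ne_zero (r : ℕ) : vand r ≠ 0 := det_alternant_rev_ne_zero r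

theorem isAntisymmetric_det_alternant {r : ℕ} (a : Fin r → ℕ) :
    IsAntisymmetric (alternant r a).det := fun e => by
  rw [rename_det_alternant, Units.smul_def, zsmul_eq_mul]

theorem isAntisymmetric_vand (r : ℕ) : IsAntisymmetric (vand r) :=
  isAntisymmetric_det_alternant _

theorem antisymm_monomial {r : ℕ} (α : Fin r →₀ ℕ) (c : ℂ) :
    antisymm (MvPolynomial.monomial α c) = c • (alternant r α).det := by
  rw [antisymm_apply, Matrix.det_apply, Finset.smul_sum]
  refine Finset.sum_congr rfl fun e _ => ?_
  rw [MvPolynomial.monomial_eq, map_mul, MvPolynomial.rename_C,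
    Finsupp.prod_fintype _ _ fun _ => pow_zero _, map_prod, smul_comm, MvPolynomial.smul_eq_C_mul]
  simp only [map_pow, MvPolynomial.rename_X, alternant, Matrix.of_apply]

theorem antisymm_eq_sum {r : ℕ} (g : MvPolynomial (Fin r) ℂ) :
    antisymm g = ∑ α ∈ g.support, g.coeff α • (alternant r α).det := by
  conv_lhs => rw [g.as_sum, map_sum]
  exact Finset.sum_congr rfl fun α _ => antisymm_monomial α _

theorem vand_dvd_antisymm {r : ℕ} (g : MvPolynomial (Fin r) ℂ) : vand r ∣ antisymm g := by
  rw [antisymm_eq_sum]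
  exact Finset.dvd_sum fun α _ => by
    rw [MvPolynomial.smul_eq_C_mul]
    exact Dvd.dvd.mul_left (det_alternant_dvd α) _

theorem exists_antisymm_eq_vand_mul {r : ℕ} (g : MvPolynomial (Fin r) ℂ) :
    ∃ s : SymPoly r, antisymm g = vand r * s := by
  obtain ⟨s, hs⟩ := vand_dvd_antisymm g
  exact ⟨⟨s, (isAntisymmetric_vand r).isSymmetric_of_mul (vand_ne_zero r)
    (hs ▸ isAntisymmetric_antisymm g)⟩, hs⟩

/-! ### Injectivity of the pullback -/

theorem exists_antisymm_mul_eq_vand_mul {r N : ℕ} {x : MvPolynomial (Fin r) ℂ}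
    (hx : x ∈ flagIdeal r N) (g : MvPolynomial (Fin r) ℂ) :
    ∃ s ∈ relIdeal r N, antisymm (g * x) = vand r * s := by
  rw [flagIdeal, Ideal.map] at hx
  induction hx using Submodule.span_induction generalizing g with
  | mem x hx =>
    obtain ⟨s, hs, rfl⟩ := hx
    obtain ⟨s', hs'⟩ := exists_antisymm_eq_vand_mul g
    refine ⟨s' * s, Ideal.mul_mem_left _ _ hs, (antisymm_mul_of_isSymmetric s.2 g).trans ?_⟩
    rw [hs', mul_assoc, MulMemClass.coe_mul]
  | zero => exact ⟨0, Ideal.zero_mem _, by simp⟩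
  | add x y _ _ hx hy =>
    obtain ⟨s, hs, hxs⟩ := hx g
    obtain ⟨t, ht, hyt⟩ := hy g
    exact ⟨s + t, Ideal.add_mem _ hs ht, by
      rw [mul_add, map_add, hxs, hyt, AddMemClass.coe_add, mul_add]⟩
  | smul a x _ hx =>
    obtain ⟨s, hs, hxs⟩ := hx (g * a)
    exact ⟨s, hs, by rw [← hxs, smul_eq_mul, mul_assoc]⟩

theorem mem_relIdeal_of_vand_mul_mem {r N : ℕ} {f : SymPoly r}
    (h : vand r * f ∈ flagIdeal r N) : f ∈ relIdeal r N := by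
  obtain ⟨s, hs, hfs⟩ := exists_antisymm_mul_eq_vand_mul h 1
  rw [one_mul, ((isAntisymmetric_vand r).mul f.2).antisymm_eq, Fintype.card_fin,
    ← Nat.cast_smul_eq_nsmul ℂ, ← mul_smul_comm] at hfs
  have hs' : s = (r.factorial : ℂ) • f := Subtype.ext (mul_left_cancel₀ (vand_ne_zero r) hfs).symm
  have hr : (r.factorial : ℂ) ≠ 0 := by exact_mod_cast r.factorial_ne_zero
  rw [show f = (r.factorial : ℂ)⁻¹ • s by rw [hs', inv_smul_smul₀ hr]]
  exact Submodule.smul_of_tower_mem _ _ hs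

theorem eq_of_vand_mul_pullback_eq {r N : ℕ} {u v : HG r N}
    (h : toFlagRing r N (vand r) * pullback r N u = toFlagRing r N (vand r) * pullback r N v) :
    u = v := by
  obtain ⟨f, rfl⟩ := Ideal.Quotient.mk_surjective u
  obtain ⟨g, rfl⟩ := Ideal.Quotient.mk_surjective v
  rw [← sub_eq_zero, ← mul_sub, ← map_sub, ← map_sub] at h
  rw [← sub_eq_zero, ← map_sub, Ideal.Quotient.eq_zero_iff_mem]
  apply mem_relIdeal_of_vand_mul_mem
  rw [← Ideal.Quotient.eq_zero_iff_mem, map_mul]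
  exact h

theorem pullback_injective (r N : ℕ) : Function.Injective (pullback r N) := fun u v h =>
  eq_of_vand_mul_pullback_eq (by rw [h])

/-! ### Vanishing above the dimension -/

theorem sum_range_card_le_sum {ι : Type*} [Fintype ι] {β : ι → ℕ} (hβ : Function.Injective β) :
    ∑ i ∈ Finset.range (Fintype.card ι), i ≤ ∑ i, β i := by
  have h := Finset.sum_range_le_sum (s := Finset.univ.image fun i => (β i : ℤ)) (c := 0) (by simp)
  have hinj : Function.Injective fun i => (β i : ℤ) := Nat.cast_injective.comp hβ
  rw [Finset.card_image_of_injective _ hinj, Finset.card_univ,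
    Finset.sum_image hinj.injOn] at h
  simp only [zero_add] at h
  rw [← Nat.cast_le (α := ℤ), Nat.cast_sum, Nat.cast_sum]
  exact h

theorem exists_le_of_injective_of_lt_sum {r N : ℕ} (hrN : r ≤ N) {α : Fin r → ℕ}
    (hα : Function.Injective α) (h : r * (N - r) + ∑ i ∈ Finset.range r, i < ∑ i, α i) :
    ∃ i, N ≤ α i := by
  by_contra! hlt
  have hinj : Function.Injective fun i => N - 1 - α i := fun i j hij => by
    have hi := hlt i
    have hj := hlt j
    simp only at hij
    exact hα (by omega)
  have hle := sum_range_card_le_sum hinj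
  rw [Fintype.card_fin] at hle
  have hsum : ∑ i, α i + ∑ i, (N - 1 - α i) = r * (N - 1) := by
    rw [← Finset.sum_add_distrib, Finset.sum_congr rfl fun i _ =>
      (show α i + (N - 1 - α i) = N - 1 by have := hlt i; omega)]
    simp
  have hgauss := Finset.sum_range_id_mul_two r
  rcases Nat.eq_zero_or_pos r with rfl | hr
  · simp at h
  obtain ⟨m, rfl⟩ := Nat.exists_eq_add_of_le hrN
  obtain ⟨k, rfl⟩ := Nat.exists_eq_add_of_le' hr
  simp only [Nat.add_sub_cancel_left, Nat.add_sub_cancel] at *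
  rw [show k + 1 + m - 1 = k + m by omega] at *
  nlinarith

theorem isHomogeneous_det_alternant {r : ℕ} (a : Fin r → ℕ) :
    (alternant r a).det.IsHomogeneous (∑ j, a j) := by
  rw [Matrix.det_apply]
  refine MvPolynomial.IsHomogeneous.sum _ _ _ fun e _ => ?_
  have h : (∏ i, alternant r a (e i) i).IsHomogeneous (∑ j, a j) :=
    MvPolynomial.IsHomogeneous.prod _ _ _ fun i _ => by
      simpa [alternant] using (MvPolynomial.isHomogeneous_X_pow (R := ℂ) (e i) (a i))
  rcases Int.units_eq_one_or (Equiv.Perm.sign e) with h' | h'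
  · simpa [h'] using h
  · simpa [h'] using h.neg

theorem sum_rev (r : ℕ) : ∑ j : Fin r, (j.rev : ℕ) = ∑ i ∈ Finset.range r, i := by
  rw [← Fin.sum_univ_eq_sum_range (fun i => i) r]
  exact Equiv.sum_comp Fin.revPerm (fun j : Fin r => (j : ℕ))

theorem det_alternant_mem_flagIdeal {r N : ℕ} {a : Fin r → ℕ} (i : Fin r) (h : N ≤ a i) :
    (alternant r a).det ∈ flagIdeal r N := by
  rw [← Ideal.Quotient.eq_zero_iff_mem, RingHom.map_det]
  refine Matrix.det_eq_zero_of_column_eq_zero i fun k => ?_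
  rw [RingHom.mapMatrix_apply, Matrix.map_apply, Ideal.Quotient.eq_zero_iff_mem]
  exact Ideal.mem_of_dvd _ (pow_dvd_pow _ h) (X_pow_mem_flagIdeal k)

theorem det_alternant_eq_zero_of_not_injective {r : ℕ} {a : Fin r → ℕ}
    (ha : ¬ Function.Injective a) : (alternant r a).det = 0 := by
  simp only [Function.Injective, not_forall] at ha
  obtain ⟨i, j, hij, hne⟩ := ha
  exact Matrix.det_zero_of_column_eq hne fun k => by simp only [alternant, Matrix.of_apply, hij]

theorem IsAntisymmetric.mem_flagIdeal {r N : ℕ} (hrN : r ≤ N) {g : MvPolynomial (Fin r) ℂ} {d : ℕ}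
    (hg : IsAntisymmetric g) (hhom : g.IsHomogeneous d)
    (hd : r * (N - r) + ∑ i ∈ Finset.range r, i < d) : g ∈ flagIdeal r N := by
  have hr : (r.factorial : ℂ) ≠ 0 := by exact_mod_cast r.factorial_ne_zero
  have hgeq : g = (r.factorial : ℂ)⁻¹ • antisymm g := by
    rw [hg.antisymm_eq, Fintype.card_fin, ← Nat.cast_smul_eq_nsmul ℂ, inv_smul_smul₀ hr]
  rw [hgeq, antisymm_eq_sum]
  refine Submodule.smul_of_tower_mem _ _ (Ideal.sum_mem _ fun α hα =>
    Submodule.smul_of_tower_mem _ _ ?_)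
  by_cases hinj : Function.Injective α
  · have hsum : ∑ i, α i = d := by
      rw [← Finsupp.degree_eq_sum, Finsupp.degree_eq_weight_one]
      exact hhom (MvPolynomial.mem_support_iff.1 hα)
    obtain ⟨i, hi⟩ := exists_le_of_injective_of_lt_sum hrN hinj (hsum ▸ hd)
    exact det_alternant_mem_flagIdeal i hi
  · rw [det_alternant_eq_zero_of_not_injective hinj]
    exact Ideal.zero_mem _

theorem mem_flagIdeal_of_isSymmetric {r N : ℕ} (hrN : r ≤ N) {f : MvPolynomial (Fin r) ℂ} {d : ℕ}
    (hs : f.IsSymmetric) (hf : f.IsHomogeneous d) (hd : r * (N - r) < d) :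
    f ∈ flagIdeal r N := by
  have hmul : vand r * f ∈ flagIdeal r N := by
    refine ((isAntisymmetric_vand r).mul hs).mem_flagIdeal hrN
      ((isHomogeneous_det_alternant _).mul hf) ?_
    rw [sum_rev]
    omega
  exact Ideal.mem_map_of_mem (MvPolynomial.symmetricSubalgebra (Fin r) ℂ).val
    (mem_relIdeal_of_vand_mul_mem (f := ⟨f, hs⟩) hmul)

/-! ### Symmetric power series -/

section SymmetricSeries

variable {σ R : Type*} [CommRing R]

/-- A power series with polynomial coefficients is symmetric if it is invariant under all
permutations of the variables of the coefficients. -/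
def IsSymmetricSeries (u : (MvPolynomial σ R)⟦X⟧) : Prop :=
  ∀ e : Equiv.Perm σ, PowerSeries.map
    ((MvPolynomial.rename e : MvPolynomial σ R →ₐ[R] _) : _ →+* MvPolynomial σ R) u = u

theorem IsSymmetricSeries.mul {u v : (MvPolynomial σ R)⟦X⟧}
    (hu : IsSymmetricSeries u) (hv : IsSymmetricSeries v) : IsSymmetricSeries (u * v) := fun e => by
  rw [map_mul, hu e, hv e]

theorem IsSymmetricSeries.isSymmetric_coeff {u : (MvPolynomial σ R)⟦X⟧} (hu : IsSymmetricSeries u)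
    (d : ℕ) : (PowerSeries.coeff d u).IsSymmetric := fun e => by
  have h := congrArg (PowerSeries.coeff d) (hu e)
  rwa [PowerSeries.coeff_map] at h

/-- A symmetric series regarded as a series over the ring of symmetric polynomials. -/
def symmetricLift (u : (MvPolynomial σ R)⟦X⟧) (hu : IsSymmetricSeries u) :
    (MvPolynomial.symmetricSubalgebra σ R)⟦X⟧ :=
  PowerSeries.mk fun d => ⟨PowerSeries.coeff d u, hu.isSymmetric_coeff d⟩

theorem map_val_symmetricLift {u : (MvPolynomial σ R)⟦X⟧} (hu : IsSymmetricSeries u) :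
    PowerSeries.map ((MvPolynomial.symmetricSubalgebra σ R).val : _ →+* MvPolynomial σ R)
      (symmetricLift u hu) = u := by
  ext1 d
  simp [symmetricLift]

theorem map_val_injective : Function.Injective (PowerSeries.map
    (RingHomClass.toRingHom (MvPolynomial.symmetricSubalgebra σ R).val)) :=
  PowerSeries.map_injective _ Subtype.val_injective

variable [Fintype σ]

theorem coeff_prod_one_add_X (k : ℕ) :
    PowerSeries.coeff k (∏ i : σ, (1 + PowerSeries.C (MvPolynomial.X i : MvPolynomial σ R) *
      PowerSeries.X)) = MvPolynomial.esymm σ R k := by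
  classical
  rw [Finset.prod_one_add, map_sum, MvPolynomial.esymm, Finset.powersetCard_eq_filter,
    Finset.sum_filter]
  refine Finset.sum_congr rfl fun t _ => ?_
  rw [Finset.prod_mul_distrib, Finset.prod_const, ← map_prod, PowerSeries.coeff_C_mul,
    PowerSeries.coeff_X_pow]
  simp [eq_comm]

variable (σ R) in
theorem isSymmetricSeries_prod_one_add_X : IsSymmetricSeries
    (∏ i : σ, (1 + PowerSeries.C (MvPolynomial.X i : MvPolynomial σ R) * PowerSeries.X)) :=
  fun e => by
    simp only [map_prod, map_add, map_one, map_mul, PowerSeries.map_C, PowerSeries.map_X,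
      RingHom.coe_coe, MvPolynomial.rename_X]
    exact Equiv.prod_comp e fun i =>
      1 + PowerSeries.C (MvPolynomial.X i : MvPolynomial σ R) * PowerSeries.X

variable (σ R) in
/-- The generating series `∑ e_k t^k` of the elementary symmetric polynomials. -/
def esymmSeries : (MvPolynomial.symmetricSubalgebra σ R)⟦X⟧ :=
  symmetricLift _ (isSymmetricSeries_prod_one_add_X σ R)

theorem coeff_esymmSeries (k : ℕ) : PowerSeries.coeff k (esymmSeries σ R)
    = ⟨MvPolynomial.esymm σ R k, MvPolynomial.esymm_isSymmetric σ R k⟩ :=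
  Subtype.ext <| (congrArg Subtype.val (PowerSeries.coeff_mk _ _)).trans (coeff_prod_one_add_X k)

theorem symmetric_algHom_ext {B : Type*} [CommRing B] [Algebra R B]
    {F G : MvPolynomial.symmetricSubalgebra σ R →ₐ[R] B}
    (h : PowerSeries.map (F : _ →+* B) (esymmSeries σ R)
      = PowerSeries.map (G : _ →+* B) (esymmSeries σ R)) : F = G := by
  have hFG : F.comp (MvPolynomial.esymmAlgHom σ R (Fintype.card σ))
      = G.comp (MvPolynomial.esymmAlgHom σ R (Fintype.card σ)) :=
    MvPolynomial.algHom_ext fun k => by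
      have hk := congrArg (PowerSeries.coeff ((k : ℕ) + 1)) h
      simp only [PowerSeries.coeff_map, coeff_esymmSeries] at hk
      simpa [MvPolynomial.esymmAlgHom] using hk
  exact (AlgHom.cancel_right (MvPolynomial.esymmAlgHom_surjective R le_rfl)).1 hFG

end SymmetricSeries

/-! ### Symmetric functions of the roots of `V ⊕ Q` -/

section Roots

variable {ι K : Type*} (τ : Type*) [CommRing K]

/-- Substitution of the variables `y_j` and the elements `-x_k` for the variables indexed by
`τ ⊕ ι`; here `x_k` and `y_j` play the roles of the Chern roots of `V^*` and `Q`. -/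
def substRoots (x : ι → K) : MvPolynomial (τ ⊕ ι) K →ₐ[K] MvPolynomial τ K :=
  MvPolynomial.aeval (Sum.elim MvPolynomial.X fun k => MvPolynomial.C (-x k))

variable {τ} in
theorem isSymmetric_substRoots (x : ι → K) {p : MvPolynomial (τ ⊕ ι) K}
    (hp : p.IsSymmetric) : (substRoots τ x p).IsSymmetric := by
  intro e
  have hcomm : (MvPolynomial.rename e : _ →ₐ[K] _).comp (substRoots τ x)
      = (substRoots τ x).comp (MvPolynomial.rename (Equiv.sumCongr e (Equiv.refl ι))) := by
    apply MvPolynomial.algHom_ext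
    rintro (i | i) <;> simp [substRoots]
  refine (DFunLike.congr_fun hcomm p).trans ?_
  rw [AlgHom.comp_apply, hp]

/-- `substRoots` on symmetric polynomials. -/
def symmSubstRoots (x : ι → K) :
    MvPolynomial.symmetricSubalgebra (τ ⊕ ι) K →ₐ[K] MvPolynomial.symmetricSubalgebra τ K :=
  ((substRoots τ x).comp (MvPolynomial.symmetricSubalgebra (τ ⊕ ι) K).val).codRestrict _
    fun p => isSymmetric_substRoots x p.2

variable {τ} in
theorem map_val_map_symmSubstRoots (x : ι → K) {u : (MvPolynomial (τ ⊕ ι) K)⟦X⟧}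
    (hu : IsSymmetricSeries u) :
    PowerSeries.map ((MvPolynomial.symmetricSubalgebra τ K).val : _ →+* MvPolynomial τ K)
      (PowerSeries.map (RingHomClass.toRingHom (symmSubstRoots τ x)) (symmetricLift u hu))
      = PowerSeries.map (substRoots τ x : _ →+* MvPolynomial τ K) u := by
  conv_rhs => rw [← map_val_symmetricLift hu]
  rfl

theorem map_val_map_algebraMap (u : K⟦X⟧) :
    PowerSeries.map ((MvPolynomial.symmetricSubalgebra τ K).val : _ →+* MvPolynomial τ K)
      (PowerSeries.map (algebraMap K (MvPolynomial.symmetricSubalgebra τ K)) u)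
      = PowerSeries.map MvPolynomial.C u := rfl

/-- The augmentation sending every variable to `0`. -/
def symmEvalZero (σ K : Type*) [CommRing K] : MvPolynomial.symmetricSubalgebra σ K →ₐ[K] K :=
  (MvPolynomial.aeval fun _ => 0).comp (MvPolynomial.symmetricSubalgebra σ K).val

variable {σ : Type*} in
theorem map_symmEvalZero_symmetricLift {u : (MvPolynomial σ K)⟦X⟧} (hu : IsSymmetricSeries u) :
    PowerSeries.map (symmEvalZero σ K : _ →+* K) (symmetricLift u hu)
      = PowerSeries.map
        ((MvPolynomial.aeval fun _ => 0 : MvPolynomial σ K →ₐ[K] K) : _ →+* K) u := by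
  conv_rhs => rw [← map_val_symmetricLift hu]
  rfl

theorem map_symmEvalZero_esymmSeries (σ K : Type*) [CommRing K] [Fintype σ] :
    PowerSeries.map (symmEvalZero σ K : _ →+* K) (esymmSeries σ K) = 1 := by
  simp [esymmSeries, map_symmEvalZero_symmetricLift]

variable [Fintype τ] [Fintype ι]

theorem map_symmSubstRoots_esymmSeries (x : ι → K) :
    PowerSeries.map (RingHomClass.toRingHom (symmSubstRoots τ x)) (esymmSeries (τ ⊕ ι) K)
      = esymmSeries τ K * PowerSeries.map (algebraMap K _)
        (∏ i, (1 - PowerSeries.C (x i) * PowerSeries.X)) := by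
  apply map_val_injective
  rw [map_mul, map_val_map_algebraMap, esymmSeries, esymmSeries, map_val_map_symmSubstRoots,
    map_val_symmetricLift, map_prod, map_prod, Fintype.prod_sum_type]
  congr 1 <;> refine Finset.prod_congr rfl fun i _ => ?_ <;> simp [substRoots, sub_eq_add_neg]

variable {τ} {B : Type*} [CommRing B] [Algebra K B] {x : ι → K}
  {F : MvPolynomial.symmetricSubalgebra τ K →ₐ[K] B}

/-- The elements `F y_j` and `-x_k` together have trivial Chern polynomial. -/
theorem comp_symmSubstRoots_eq (hF : PowerSeries.map (F : _ →+* B) (esymmSeries τ K) *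
      PowerSeries.map (algebraMap K B) (∏ i, (1 - PowerSeries.C (x i) * PowerSeries.X)) = 1) :
    F.comp (symmSubstRoots τ x) = (Algebra.ofId K B).comp (symmEvalZero (τ ⊕ ι) K) := by
  apply symmetric_algHom_ext
  have hL : PowerSeries.map (F.comp (symmSubstRoots τ x) : _ →+* B) (esymmSeries (τ ⊕ ι) K)
      = PowerSeries.map (F : _ →+* B)
        (PowerSeries.map (RingHomClass.toRingHom (symmSubstRoots τ x)) (esymmSeries (τ ⊕ ι) K)) :=
    rfl
  have hR : PowerSeries.map ((Algebra.ofId K B).comp (symmEvalZero (τ ⊕ ι) K) : _ →+* B)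
      (esymmSeries (τ ⊕ ι) K) = PowerSeries.map (algebraMap K B)
        (PowerSeries.map (symmEvalZero (τ ⊕ ι) K : _ →+* K) (esymmSeries (τ ⊕ ι) K)) := rfl
  have hF_algebraMap : (RingHomClass.toRingHom F).comp (algebraMap K _) = algebraMap K B :=
    F.comp_algebraMap
  rw [hL, hR, map_symmSubstRoots_esymmSeries, map_symmEvalZero_esymmSeries, map_mul, map_one,
    ← hF, ← hF_algebraMap, PowerSeries.map_comp]
  rfl

variable [Algebra ℂ K]

theorem isSymmetricSeries_prod_scaledSeries {σ : Type*} [Fintype σ] (x : ι → K) (φ : ℂ⟦X⟧) :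
    IsSymmetricSeries (∏ p : ι × σ, scaledSeries
      (MvPolynomial.C (x p.1) + MvPolynomial.X p.2 : MvPolynomial σ K) φ) := fun e => by
  rw [map_prod]
  refine Fintype.prod_equiv (Equiv.prodCongr (Equiv.refl ι) e) _ _ fun p => ?_
  refine (map_scaledSeries ((MvPolynomial.rename e : MvPolynomial σ K
    →ₐ[K] _).restrictScalars ℂ) _ _).trans ?_
  simp

/-- `∏_{i,j} φ((x_i + y_j) t)`. -/
def prodSumRoots (σ : Type*) [Fintype σ] (x : ι → K) (φ : ℂ⟦X⟧) :
    (MvPolynomial.symmetricSubalgebra σ K)⟦X⟧ :=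
  symmetricLift _ (isSymmetricSeries_prod_scaledSeries (σ := σ) x φ)

theorem map_symmSubstRoots_prodSumRoots (x : ι → K) (φ : ℂ⟦X⟧) :
    PowerSeries.map (RingHomClass.toRingHom (symmSubstRoots τ x)) (prodSumRoots (τ ⊕ ι) x φ)
      = prodSumRoots τ x φ * PowerSeries.map (algebraMap K _)
        (∏ p : ι × ι, scaledSeries (x p.1 - x p.2) φ) := by
  apply map_val_injective
  have hsubst (p : ι × (τ ⊕ ι)) : PowerSeries.map (substRoots τ x : _ →+* MvPolynomial τ K)
      (scaledSeries (MvPolynomial.C (x p.1) + MvPolynomial.X p.2) φ)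
      = scaledSeries (MvPolynomial.C (x p.1) +
          Sum.elim MvPolynomial.X (fun k => MvPolynomial.C (-x k)) p.2) φ := by
    refine (map_scaledSeries ((substRoots τ x).restrictScalars ℂ) _ _).trans ?_
    simp [substRoots]
  have hC (a : K) : PowerSeries.map MvPolynomial.C (scaledSeries a φ)
      = scaledSeries (MvPolynomial.C a : MvPolynomial τ K) φ :=
    map_scaledSeries (IsScalarTower.toAlgHom ℂ K (MvPolynomial τ K)) _ _
  rw [map_mul, map_val_map_algebraMap, prodSumRoots, prodSumRoots, map_val_map_symmSubstRoots,
    map_val_symmetricLift]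
  simp only [map_prod, hsubst, hC]
  simp only [Fintype.prod_prod_type, Fintype.prod_sum_type, Finset.prod_mul_distrib, Sum.elim_inl,
    Sum.elim_inr, ← map_add, sub_eq_add_neg]

theorem map_symmEvalZero_prodSumRoots {σ : Type*} [Fintype σ] (x : ι → K) (φ : ℂ⟦X⟧) :
    PowerSeries.map (symmEvalZero σ K : _ →+* K) (prodSumRoots σ x φ)
      = ∏ i, scaledSeries (x i) φ ^ Fintype.card σ := by
  have heval (p : ι × σ) : PowerSeries.map ((MvPolynomial.aeval fun _ => 0 :
      MvPolynomial σ K →ₐ[K] K) : _ →+* K)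
      (scaledSeries (MvPolynomial.C (x p.1) + MvPolynomial.X p.2) φ) = scaledSeries (x p.1) φ := by
    refine (map_scaledSeries ((MvPolynomial.aeval fun _ => 0 :
      MvPolynomial σ K →ₐ[K] K).restrictScalars ℂ) _ _).trans ?_
    simp
  rw [prodSumRoots, map_symmEvalZero_symmetricLift]
  simp only [map_prod, heval]
  simp only [Fintype.prod_prod_type, Finset.prod_const, Finset.card_univ]

/-- The multiplicative characteristic class of `Hom(V, V) ⊕ Hom(V, Q) = Hom(V, K^N)` is that of
`(V^*)^{⊕ N}`. -/
theorem map_prodSumRoots_mul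
    (hF : PowerSeries.map (F : _ →+* B) (esymmSeries τ K) *
      PowerSeries.map (algebraMap K B) (∏ i, (1 - PowerSeries.C (x i) * PowerSeries.X)) = 1)
    (φ : ℂ⟦X⟧) :
    PowerSeries.map (F : _ →+* B) (prodSumRoots τ x φ) *
        PowerSeries.map (algebraMap K B) (∏ p : ι × ι, scaledSeries (x p.1 - x p.2) φ)
      = PowerSeries.map (algebraMap K B)
        (∏ i, scaledSeries (x i) φ ^ (Fintype.card τ + Fintype.card ι)) := by
  have hF_algebraMap : (RingHomClass.toRingHom F).comp (algebraMap K _) = algebraMap K B :=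
    F.comp_algebraMap
  calc _ = PowerSeries.map (F.comp (symmSubstRoots τ x) : _ →+* B) (prodSumRoots (τ ⊕ ι) x φ) := by
        rw [← hF_algebraMap, PowerSeries.map_comp, RingHom.comp_apply, ← map_mul,
          ← map_symmSubstRoots_prodSumRoots]
        rfl
    _ = PowerSeries.map (algebraMap K B)
        (PowerSeries.map (symmEvalZero (τ ⊕ ι) K : _ →+* K) (prodSumRoots (τ ⊕ ι) x φ)) := by
        rw [comp_symmSubstRoots_eq hF]
        rfl
    _ = _ := by rw [map_symmEvalZero_prodSumRoots, Fintype.card_sum]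

end Roots

/-! ### The Gamma class in terms of the Chern roots of `V^*` -/

theorem evalQuotientRoots_esymm (r m k : ℕ) :
    evalQuotientRoots r m ⟨MvPolynomial.esymm (Fin m) _ k, MvPolynomial.esymm_isSymmetric _ _ k⟩
      = if k ≤ m then MvPolynomial.hsymm (Fin r) ℂ k else 0 := by
  rcases k with _ | k
  · have hone : (⟨MvPolynomial.esymm (Fin m) (MvPolynomial (Fin r) ℂ) 0,
        MvPolynomial.esymm_isSymmetric _ _ 0⟩ : MvPolynomial.symmetricSubalgebra (Fin m)
          (MvPolynomial (Fin r) ℂ)) = 1 := Subtype.ext (by simp)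
    rw [hone, map_one]
    simp
  split_ifs with hk
  · have hX := MvPolynomial.esymmAlgEquiv_symm_apply (R := MvPolynomial (Fin r) ℂ)
      (Fintype.card_fin m) (⟨k, hk⟩ : Fin m)
    change MvPolynomial.aeval _ ((MvPolynomial.esymmAlgEquiv (Fin m) (MvPolynomial (Fin r) ℂ)
      (Fintype.card_fin m)).symm _) = _
    rw [hX]
    simp
  · have hzero : (⟨MvPolynomial.esymm (Fin m) (MvPolynomial (Fin r) ℂ) (k + 1),
        MvPolynomial.esymm_isSymmetric _ _ (k + 1)⟩ : MvPolynomial.symmetricSubalgebra (Fin m)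
          (MvPolynomial (Fin r) ℂ)) = 0 := by
      apply Subtype.ext
      change MvPolynomial.esymm (Fin m) (MvPolynomial (Fin r) ℂ) (k + 1) = 0
      rw [MvPolynomial.esymm, Finset.powersetCard_eq_empty.2 (by simpa using hk), Finset.sum_empty]
    rw [hzero, map_zero]

/-- Evaluation of a symmetric polynomial in the Chern roots of `Q` in the ring of the Chern roots
of `V^*`. -/
def quotientRootsToFlagRing (r m : ℕ) :
    MvPolynomial.symmetricSubalgebra (Fin m) (MvPolynomial (Fin r) ℂ)
      →ₐ[MvPolynomial (Fin r) ℂ] FlagRing r (m + r) :=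
  (Algebra.ofId _ _).comp (evalQuotientRoots r m)

theorem map_quotientRootsToFlagRing_esymmSeries (r m : ℕ) :
    PowerSeries.map (quotientRootsToFlagRing r m : _ →+* FlagRing r (m + r))
        (esymmSeries (Fin m) (MvPolynomial (Fin r) ℂ))
      = PowerSeries.map (algebraMap _ _) (PowerSeries.mk (MvPolynomial.hsymm (Fin r) ℂ)) := by
  ext1 k
  rw [PowerSeries.coeff_map, PowerSeries.coeff_map, coeff_esymmSeries, PowerSeries.coeff_mk]
  change algebraMap _ (FlagRing r (m + r)) (evalQuotientRoots r m _) = _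
  rw [evalQuotientRoots_esymm]
  split_ifs with hk
  · rfl
  · rw [map_zero]
    exact (Ideal.Quotient.eq_zero_iff_mem.2 (hsymm_mem_flagIdeal k (by omega))).symm

/-- `∏_i Γ(1 + x_i t)^N / ∏_{i,k} Γ(1 + (x_i - x_k) t)`. -/
def gammaRatio (r N : ℕ) : (MvPolynomial (Fin r) ℂ)⟦X⟧ :=
  (∏ i : Fin r, scaledSeries (MvPolynomial.X i) gammaSeries ^ N) *
    ∏ p : Fin r × Fin r, scaledSeries (MvPolynomial.X p.1 - MvPolynomial.X p.2) gammaSeries⁻¹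

theorem map_quotientRootsToFlagRing_prodSumRoots (r m : ℕ) :
    PowerSeries.map (quotientRootsToFlagRing r m : _ →+* FlagRing r (m + r))
        (prodSumRoots (Fin m) (MvPolynomial.X : Fin r → MvPolynomial (Fin r) ℂ) gammaSeries)
      = PowerSeries.map (algebraMap _ _) (gammaRatio r (m + r)) := by
  have hroots : PowerSeries.map (quotientRootsToFlagRing r m : _ →+* FlagRing r (m + r))
      (esymmSeries (Fin m) (MvPolynomial (Fin r) ℂ)) * PowerSeries.map (algebraMap _ _)
        (∏ i, (1 - PowerSeries.C (MvPolynomial.X i : MvPolynomial (Fin r) ℂ) * PowerSeries.X))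
      = 1 := by
    rw [map_quotientRootsToFlagRing_esymmSeries, ← map_mul, mk_hsymm_mul_prod, map_one]
  have hinv : (∏ p : Fin r × Fin r, scaledSeries (MvPolynomial.X p.1 - MvPolynomial.X p.2 :
        MvPolynomial (Fin r) ℂ) gammaSeries) * ∏ p : Fin r × Fin r,
      scaledSeries (MvPolynomial.X p.1 - MvPolynomial.X p.2 : MvPolynomial (Fin r) ℂ)
        gammaSeries⁻¹ = 1 := by
    rw [← Finset.prod_mul_distrib]
    exact Finset.prod_eq_one fun p _ => by rw [← map_mul, gammaSeries_mul_inv, map_one]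
  have hgamma := map_prodSumRoots_mul hroots gammaSeries
  rw [Fintype.card_fin, Fintype.card_fin] at hgamma
  rw [gammaRatio, map_mul, ← hgamma, mul_assoc, ← map_mul, hinv, map_one, mul_one]

theorem coeffSum_prodSumRoots (r m : ℕ) :
    coeffSum (r * m) (prodSumRoots (Fin m) (MvPolynomial.X : Fin r → MvPolynomial (Fin r) ℂ)
      gammaSeries) = ⟨gammaRoots r m, gammaRoots_isSymmetric r m⟩ := by
  apply Subtype.ext
  rw [← Subalgebra.val_apply, ← RingHom.coe_coe (f := Subalgebra.val _), ← coeffSum_map,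
    prodSumRoots, map_val_symmetricLift]
  exact (truncProd_eq_coeffSum _ _ _).symm

theorem toFlagRing_gammaPoly (r m : ℕ) :
    toFlagRing r (m + r) (gammaPoly r m)
      = toFlagRing r (m + r) (coeffSum (r * m) (gammaRatio r (m + r))) :=
  calc toFlagRing r (m + r) (gammaPoly r m)
      = quotientRootsToFlagRing r m (coeffSum (r * m) (prodSumRoots (Fin m) _ gammaSeries)) := by
        rw [coeffSum_prodSumRoots]
        rfl
    _ = coeffSum (r * m) (PowerSeries.map (algebraMap _ _) (gammaRatio r (m + r))) := by
        rw [← map_quotientRootsToFlagRing_prodSumRoots, coeffSum_map]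
        rfl
    _ = _ := coeffSum_map _ _ _

/-! ### The Satake identification as a quotient of determinants -/

theorem coe_hSym_one_one : ((hSym 1 1 : SymPoly 1) : MvPolynomial (Fin 1) ℂ)
    = MvPolynomial.X 0 := by
  simp [hSym]

section Satake

variable {r N : ℕ}

variable (N) in
/-- The map `H(ℙ^{N-1}) → ℂ[x_1, …, x_r] / ⟨h_{N-r+1}, …, h_N⟩` with `h ↦ x_i`. -/
def rootEval (i : Fin r) : HG 1 N →ₐ[ℂ] FlagRing r N :=
  Ideal.Quotient.liftₐ (relIdeal 1 N)
    ((MvPolynomial.aeval fun _ => toFlagRing r N (MvPolynomial.X i)).comp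
      (MvPolynomial.symmetricSubalgebra (Fin 1) ℂ).val) (by
    intro a ha
    rw [relIdeal_one, Ideal.mem_span_singleton] at ha
    obtain ⟨c, rfl⟩ := ha
    have hpow : toFlagRing r N (MvPolynomial.X i) ^ N = 0 := by
      rw [← map_pow]
      exact Ideal.Quotient.eq_zero_iff_mem.2 (X_pow_mem_flagIdeal i)
    rw [map_mul, map_pow, AlgHom.comp_apply, Subalgebra.val_apply, coe_hSym_one_one,
      MvPolynomial.aeval_X, hpow, zero_mul])

theorem rootEval_specialClass (i : Fin r) :
    rootEval N i (specialClass 1 N 1) = toFlagRing r N (MvPolynomial.X i) := by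
  change MvPolynomial.aeval (fun _ => toFlagRing r N (MvPolynomial.X i))
    ((hSym 1 1 : SymPoly 1) : MvPolynomial (Fin 1) ℂ) = _
  rw [coe_hSym_one_one, MvPolynomial.aeval_X]

variable (r N) in
/-- The alternating map `(u_1, …, u_r) ↦ det (u_j(x_i))`. -/
def detRootEval : (HG 1 N) [⋀^Fin r]→ₗ[ℂ] FlagRing r N :=
  { ((Matrix.detRowAlternating (n := Fin r) (R := FlagRing r N)).toMultilinearMap.restrictScalars
      ℂ).compLinearMap (fun _ => LinearMap.pi fun i => (rootEval N i).toLinearMap) with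
    map_eq_zero_of_eq' := fun u i j hij hne =>
      (Matrix.detRowAlternating (n := Fin r) (R := FlagRing r N)).map_eq_zero_of_eq _
        (by simp [hij]) hne }

theorem detRootEval_apply (u : Fin r → HG 1 N) :
    detRootEval r N u = (Matrix.of fun i j => rootEval N i (u j)).det := by
  rw [← Matrix.det_transpose]
  rfl

theorem strictAnti_wedgeExponents (s : Set.powersetCard (Fin N)ᵒᵈ r) :
    StrictAnti (wedgeExponents s) := fun _ _ hik =>
  (Set.powersetCard.ofFinEmbEquiv.symm s).strictMono hik

theorem rev_le_of_strictAnti {f : Fin r → ℕ} (hf : StrictAnti f) (j : Fin r) :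
    (j.rev : ℕ) ≤ f j := by
  have h := Finset.card_le_card_of_injOn f (s := Finset.Ioi j) (t := Finset.range (f j))
    (fun i hi => by simpa using hf (Finset.mem_Ioi.1 (by simpa using hi))) hf.injective.injOn
  simpa [Fin.val_rev, Nat.sub_sub, add_comm] using h

theorem wedgeBasis_apply (s : Set.powersetCard (Fin N)ᵒᵈ r) :
    wedgeBasis r N s
      = exteriorPower.ιMulti ℂ r fun j => specialClass 1 N 1 ^ wedgeExponents s j := by
  rw [wedgeBasis, exteriorPower.basis_apply]
  simp only [exteriorPower.ιMulti_family]
  congr 1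
  ext1 j
  simp [hyperplaneBasis_apply, wedgeExponents]

theorem vand_mul_pullback_schubertClass (l : Fin r → ℕ) :
    toFlagRing r N (vand r) * pullback r N (schubertClass N l)
      = (Matrix.of fun i j => toFlagRing r N (MvPolynomial.X i) ^ (l j + (j.rev : ℕ))).det := by
  rw [schubertClass, pullback_toHG, ← map_mul, vand, ← schurPoly_spec, AlgHom.map_det]
  congr 1

theorem vand_mul_pullback_satake (u : Fin r → HG 1 N) :
    toFlagRing r N (vand r) * pullback r N (satake r N (exteriorPower.ιMulti ℂ r u))
      = (Matrix.of fun i j => rootEval N i (u j)).det := by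
  have hlin : (LinearMap.mulLeft ℂ (toFlagRing r N (vand r))) ∘ₗ (pullback r N).toLinearMap ∘ₗ
      satake r N = exteriorPower.alternatingMapLinearEquiv (detRootEval r N) := by
    refine (wedgeBasis r N).ext fun s => ?_
    have hsat : satake r N (wedgeBasis r N s) = schubertClass N fun j =>
        wedgeExponents s j - (j.rev : ℕ) := Module.Basis.constr_basis _ _ _ _
    rw [LinearMap.comp_apply, LinearMap.comp_apply, hsat, wedgeBasis_apply,
      exteriorPower.alternatingMapLinearEquiv_apply_ιMulti, detRootEval_apply]
    refine (vand_mul_pullback_schubertClass _).trans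
      (congrArg Matrix.det (Matrix.ext fun i j => ?_))
    simp only [Matrix.of_apply, map_pow, rootEval_specialClass]
    rw [Nat.sub_add_cancel (rev_le_of_strictAnti (strictAnti_wedgeExponents s) j)]
  have hu := DFunLike.congr_fun hlin (exteriorPower.ιMulti ℂ r u)
  rwa [exteriorPower.alternatingMapLinearEquiv_apply_ιMulti, detRootEval_apply] at hu

end Satake

/-! ### Functions on words -/

section Words

variable {X ι R : Type*} [CommRing R]

theorem comp_swap_eq_self [DecidableEq X] {w : X → ι} {a b : X} (h : w a = w b) :
    w ∘ Equiv.swap a b = w := by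
  rw [Equiv.comp_swap_eq_update, h, Function.update_eq_self, ← h, Function.update_eq_self]

/-- The action of the permutations of the positions `X` on the `X`-th tensor power of the free
module on the letters `ι`, realized as the functions on words. -/
def permRep : Equiv.Perm X →* Module.End R ((X → ι) → R) where
  toFun p := LinearMap.funLeft R R fun w => w ∘ p
  map_one' := rfl
  map_mul' _ _ := rfl

theorem permRep_apply (p : Equiv.Perm X) (f : (X → ι) → R) (w : X → ι) :
    permRep p f w = f (w ∘ p) := rfl

variable (X ι R) in
/-- The sum over all pairs `(a, b)` of positions, including `a = b`, of the action of the
transposition of `a` and `b`. -/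
def swapSum [Fintype X] [DecidableEq X] : Module.End R ((X → ι) → R) :=
  ∑ a, ∑ b, permRep (Equiv.swap a b)

theorem swapSum_mul_permRep [Fintype X] [DecidableEq X] (p : Equiv.Perm X) :
    swapSum X ι R * permRep p = permRep p * swapSum X ι R := by
  simp only [swapSum, Finset.sum_mul, Finset.mul_sum, ← map_mul]
  rw [← Equiv.sum_comp p]
  refine Finset.sum_congr rfl fun a _ => ?_
  rw [← Equiv.sum_comp p]
  refine Finset.sum_congr rfl fun b _ => ?_
  rw [Equiv.mul_swap_eq_swap_mul]

variable [Fintype X] [DecidableEq ι]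

/-- The number of occurrences of the letter `i` in the word `w`. -/
def letterCount (w : X → ι) (i : ι) : ℕ := (Finset.univ.filter fun a => w a = i).card

theorem letterCount_eq_sum (w : X → ι) (i : ι) :
    letterCount w i = ∑ a, if w a = i then 1 else 0 := by
  rw [letterCount, Finset.card_filter]

theorem sum_letterCount [Fintype ι] (w : X → ι) : ∑ i, letterCount w i = Fintype.card X :=
  (Finset.card_eq_sum_card_fiberwise fun a _ => Finset.mem_univ (w a)).symm

theorem letterCount_comp_perm (w : X → ι) (p : Equiv.Perm X) :
    letterCount (w ∘ p) = letterCount w := by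
  funext i
  rw [letterCount_eq_sum, letterCount_eq_sum]
  exact Equiv.sum_comp p (fun a => if w a = i then 1 else 0)

variable (X R) in
/-- The functions supported on the words of content `μ`, that is, the weight space of weight `μ`. -/
def contentSpace (μ : ι → ℕ) : Submodule R ((X → ι) → R) where
  carrier := {f | ∀ w, letterCount w ≠ μ → f w = 0}
  add_mem' hf hg w hw := by rw [Pi.add_apply, hf w hw, hg w hw, add_zero]
  zero_mem' _ _ := rfl
  smul_mem' c f hf w hw := by rw [Pi.smul_apply, hf w hw, smul_zero]

theorem permRep_mem_contentSpace (p : Equiv.Perm X) {μ : ι → ℕ} {f : (X → ι) → R}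
    (hf : f ∈ contentSpace X R μ) : permRep p f ∈ contentSpace X R μ := fun w hw =>
  hf _ (by rwa [letterCount_comp_perm])

variable [DecidableEq X]

theorem letterCount_update (w : X → ι) (a : X) (j : ι) :
    letterCount (Function.update w a j) + Pi.single (w a) 1 = letterCount w + Pi.single j 1 := by
  funext k
  have hrest : ∑ b ∈ Finset.univ.erase a, (if Function.update w a j b = k then 1 else 0)
      = ∑ b ∈ Finset.univ.erase a, if w b = k then 1 else 0 :=
    Finset.sum_congr rfl fun b hb => by rw [Function.update_of_ne (Finset.ne_of_mem_erase hb)]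
  simp only [Pi.add_apply, letterCount_eq_sum, Pi.single_apply, eq_comm (a := k)]
  rw [← Finset.add_sum_erase _ _ (Finset.mem_univ a), hrest, Function.update_self,
    ← Finset.add_sum_erase _ (fun b => if w b = k then 1 else 0) (Finset.mem_univ a)]
  ring

/-- The action on functions on words of the elementary matrix `E_{ij}` (as an element of the Lie
algebra of all matrices). -/
def elemAct (i j : ι) : Module.End R ((X → ι) → R) where
  toFun f w := ∑ a, if w a = i then f (Function.update w a j) else 0
  map_add' f g := by
    funext w
    simp only [Pi.add_apply, ← Finset.sum_add_distrib]
    exact Finset.sum_congr rfl fun a _ => by split_ifs <;> simp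
  map_smul' c f := by
    funext w
    simp only [Pi.smul_apply, smul_eq_mul, Finset.mul_sum, RingHom.id_apply, mul_ite, mul_zero]

theorem elemAct_apply (i j : ι) (f : (X → ι) → R) (w : X → ι) :
    elemAct i j f w = ∑ a, if w a = i then f (Function.update w a j) else 0 := rfl

theorem elemAct_self_apply (i : ι) (f : (X → ι) → R) (w : X → ι) :
    elemAct i i f w = letterCount w i * f w := by
  rw [elemAct_apply, letterCount_eq_sum, Nat.cast_sum, Finset.sum_mul]
  refine Finset.sum_congr rfl fun a _ => ?_
  split_ifs with ha
  · rw [← ha, Function.update_eq_self, Nat.cast_one, one_mul]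
  · rw [Nat.cast_zero, zero_mul]

theorem elemAct_mul_permRep (i j : ι) (p : Equiv.Perm X) :
    elemAct i j * permRep p = permRep p * elemAct (R := R) i j := by
  refine LinearMap.ext fun f => funext fun w => ?_
  simp only [Module.End.mul_apply, elemAct_apply, permRep_apply]
  refine (Equiv.sum_comp p _).symm.trans (Finset.sum_congr rfl fun a _ => ?_)
  rw [Function.update_comp_eq_of_injective w p.injective]
  rfl

theorem elemAct_elemAct (i j : ι) (f : (X → ι) → R) (w : X → ι) :
    elemAct i j (elemAct j i f) w
      = (∑ a, ∑ b, if w a = i ∧ w b = j then f (w ∘ Equiv.swap a b) else 0)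
        + if i = j then 0 else letterCount w i * f w := by
  have key : ∀ a, w a = i → elemAct j i f (Function.update w a j)
      = (∑ b, if w b = j then f (w ∘ Equiv.swap a b) else 0) + if i = j then 0 else f w := by
    rintro a rfl
    have hrest : ∀ b ∈ Finset.univ.erase a,
        (if Function.update w a j b = j then
          f (Function.update (Function.update w a j) b (w a)) else 0)
          = if w b = j then f (w ∘ Equiv.swap a b) else 0 := fun b hb => by
      rw [Function.update_of_ne (Finset.ne_of_mem_erase hb)]
      split_ifs with hbj
      · rw [← hbj, Equiv.swap_comm, Equiv.comp_swap_eq_update]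
      · rfl
    rw [elemAct_apply, ← Finset.add_sum_erase _ _ (Finset.mem_univ a), Finset.sum_congr rfl hrest,
      ← Finset.add_sum_erase _ (fun b => if w b = j then _ else 0) (Finset.mem_univ a),
      if_pos (Function.update_self ..), Function.update_idem, Function.update_eq_self,
      comp_swap_eq_self rfl]
    split_ifs <;> ring
  have hcount : (if i = j then 0 else (letterCount w i : R) * f w)
      = ∑ a, if w a = i then if i = j then 0 else f w else 0 := by
    rw [letterCount_eq_sum, Nat.cast_sum, Finset.sum_mul]
    split_ifs <;> simp
  rw [hcount, ← Finset.sum_add_distrib, elemAct_apply]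
  refine Finset.sum_congr rfl fun a _ => ?_
  by_cases ha : w a = i
  · simp only [ha, if_true, true_and, key a ha]
  · simp only [ha, if_false, false_and, Finset.sum_const_zero, add_zero]

theorem elemAct_commutator (i j : ι) (f : (X → ι) → R) (w : X → ι) :
    elemAct i j (elemAct j i f) w - elemAct j i (elemAct i j f) w
      = (letterCount w i - letterCount w j) * f w := by
  have hsymm : (∑ a, ∑ b, if w a = j ∧ w b = i then f (w ∘ Equiv.swap a b) else 0)
      = ∑ a, ∑ b, if w a = i ∧ w b = j then f (w ∘ Equiv.swap a b) else 0 := by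
    rw [Finset.sum_comm]
    refine Finset.sum_congr rfl fun a _ => Finset.sum_congr rfl fun b _ => ?_
    rw [Equiv.swap_comm]
    exact if_congr and_comm rfl rfl
  rw [elemAct_elemAct, elemAct_elemAct, hsymm]
  rcases eq_or_ne i j with rfl | hij
  · simp
  · rw [if_neg hij, if_neg hij.symm]
    ring

/-- The Casimir element of `𝔤𝔩` acts on a tensor power through the sum of all transpositions, an
instance of Schur–Weyl duality. -/
theorem sum_elemAct_elemAct [Fintype ι] (f : (X → ι) → R) (w : X → ι) :
    ∑ i, ∑ j, elemAct i j (elemAct j i f) w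
      = (Fintype.card ι - 1) * Fintype.card X * f w + swapSum X ι R f w := by
  have hswap : (∑ i, ∑ j, ∑ a, ∑ b, if w a = i ∧ w b = j then f (w ∘ Equiv.swap a b) else 0)
      = swapSum X ι R f w := by
    simp only [swapSum, LinearMap.sum_apply, Finset.sum_apply, permRep_apply]
    simp_rw [Finset.sum_comm (s := (Finset.univ : Finset ι)) (t := (Finset.univ : Finset X))]
    refine Finset.sum_congr rfl fun a _ => Finset.sum_congr rfl fun b _ => ?_
    simp [ite_and]
  have hcount : ∑ i : ι, ∑ j : ι, (if i = j then 0 else (letterCount w i : R) * f w)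
      = (Fintype.card ι - 1) * Fintype.card X * f w := by
    have hrow : ∀ i : ι, ∑ j : ι, (if i = j then 0 else (letterCount w i : R) * f w)
        = (Fintype.card ι - 1) * f w * letterCount w i := fun i => by
      rw [Finset.sum_congr rfl fun j _ => (ite_not (i = j) _ _).symm, ← Finset.sum_filter,
        Finset.sum_const, Finset.filter_ne, Finset.card_erase_of_mem (Finset.mem_univ i),
        Finset.card_univ, nsmul_eq_mul, Nat.cast_pred (Fintype.card_pos_iff.2 ⟨i⟩)]
      ring
    rw [Finset.sum_congr rfl fun i _ => hrow i, ← Finset.mul_sum, ← Nat.cast_sum, sum_letterCount]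
    ring
  simp only [elemAct_elemAct, Finset.sum_add_distrib, hswap, hcount]
  ring

theorem elemAct_mem_contentSpace {i j : ι} {κ : ι → ℕ} {f : (X → ι) → R}
    (hf : f ∈ contentSpace X R (κ + Pi.single j 1)) :
    elemAct i j f ∈ contentSpace X R (κ + Pi.single i 1) := by
  intro w hw
  rw [elemAct_apply]
  refine Finset.sum_eq_zero fun a _ => ite_eq_right_iff.2 fun ha => hf _ fun h => hw ?_
  have hupdate := letterCount_update w a j
  rw [h, ha, add_right_comm] at hupdate
  exact (add_right_cancel hupdate).symm

theorem elemAct_elemAct_mem_contentSpace (i j : ι) {μ : ι → ℕ} {f : (X → ι) → R}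
    (hf : f ∈ contentSpace X R μ) : elemAct i j (elemAct j i f) ∈ contentSpace X R μ := by
  intro w hw
  have hswap : ∀ a b, f (w ∘ Equiv.swap a b) = 0 := fun a b =>
    permRep_mem_contentSpace (Equiv.swap a b) hf w hw
  simp [elemAct_elemAct, hf w hw, hswap]

end Words

/-! ### Traces on weight spaces -/

section Traces

variable {X ι K : Type*} [Fintype X] [DecidableEq ι] [Field K]
  (W : Submodule K ((X → ι) → K))

/-- The dimension of the space of elements of `W` of content `μ`. -/
def contentDim (μ : ι → ℕ) : ℕ :=
  Module.finrank K (W ⊓ contentSpace X K μ : Submodule K ((X → ι) → K))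

variable {W}

theorem contentEnd_ext {μ : ι → ℕ} {S T : Module.End K (W ⊓ contentSpace X K μ : Submodule K _)}
    (h : ∀ f w, letterCount w = μ → (S f : (X → ι) → K) w = (T f : (X → ι) → K) w) : S = T := by
  refine LinearMap.ext fun f => Subtype.ext (funext fun w => ?_)
  by_cases hw : letterCount w = μ
  · exact h f w hw
  · rw [(S f).2.2 w hw, (T f).2.2 w hw]

theorem trace_smul_id [Finite ι] (c : K) (μ : ι → ℕ) :
    LinearMap.trace K (W ⊓ contentSpace X K μ : Submodule K _) (c • LinearMap.id)
      = c * contentDim W μ := by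
  rw [map_smul, LinearMap.trace_id, smul_eq_mul, contentDim]

variable [DecidableEq X]

theorem elemAct_mem_inf (hW : ∀ i j : ι, ∀ f ∈ W, elemAct i j f ∈ W)
    (i j : ι) (κ : ι → ℕ) :
    ∀ f ∈ W ⊓ contentSpace X K (κ + Pi.single j 1),
      elemAct i j f ∈ W ⊓ contentSpace X K (κ + Pi.single i 1) :=
  fun f hf => ⟨hW i j f hf.1, elemAct_mem_contentSpace hf.2⟩

theorem elemAct_elemAct_mem_inf (hW : ∀ i j : ι, ∀ f ∈ W, elemAct i j f ∈ W)
    (i j : ι) (μ : ι → ℕ) :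
    ∀ f ∈ W ⊓ contentSpace X K μ,
      (elemAct i j * elemAct j i : Module.End K ((X → ι) → K)) f ∈ W ⊓ contentSpace X K μ :=
  fun f hf => ⟨hW i j _ (hW j i f hf.1), elemAct_elemAct_mem_contentSpace i j hf.2⟩

variable (hW : ∀ i j : ι, ∀ f ∈ W, elemAct i j f ∈ W)

/-- The operator `E_{ij} E_{ji}` on the elements of content `μ` of a submodule `W` that is stable
under all `E_{ij}`. -/
def elemEnd (i j : ι) (μ : ι → ℕ) : Module.End K (W ⊓ contentSpace X K μ : Submodule K _) :=
  (elemAct i j * elemAct j i).restrict (elemAct_elemAct_mem_inf hW i j μ)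

theorem elemEnd_apply (i j : ι) (μ : ι → ℕ) (f : (W ⊓ contentSpace X K μ : Submodule K _))
    (w : X → ι) :
    (elemEnd hW i j μ f : (X → ι) → K) w = elemAct i j (elemAct j i (f : (X → ι) → K)) w := rfl

/-- The trace of `E_{ij} E_{ji}` on the elements of content `μ` of a submodule `W` that is stable
under all `E_{ij}`. -/
def elemTrace (i j : ι) (μ : ι → ℕ) : K := LinearMap.trace K _ (elemEnd hW i j μ)

theorem elemTrace_add_single [Finite ι] (i j : ι) (κ : ι → ℕ) :
    elemTrace hW i j (κ + Pi.single i 1) = elemTrace hW j i (κ + Pi.single j 1) :=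
  LinearMap.trace_comp_comm' ((elemAct j i).restrict (elemAct_mem_inf hW j i κ))
    ((elemAct i j).restrict (elemAct_mem_inf hW i j κ))

theorem elemTrace_self [Finite ι] (i : ι) (μ : ι → ℕ) :
    elemTrace hW i i μ = (μ i : K) ^ 2 * contentDim W μ := by
  have hsq : elemEnd hW i i μ = (μ i : K) ^ 2 • LinearMap.id := contentEnd_ext fun f w hw => by
    rw [elemEnd_apply, elemAct_self_apply, elemAct_self_apply, hw, ← mul_assoc, ← sq]
    rfl
  rw [elemTrace, hsq, trace_smul_id]

theorem elemTrace_eq_zero (i j : ι) {μ : ι → ℕ} (hμ : μ i = 0) : elemTrace hW i j μ = 0 := by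
  rw [elemTrace, show elemEnd hW i j μ = 0 from contentEnd_ext fun f w hw => ?_, map_zero]
  rw [← hw, letterCount, Finset.card_eq_zero, Finset.filter_eq_empty_iff] at hμ
  exact Finset.sum_eq_zero fun a ha => if_neg (hμ ha)

theorem elemTrace_sub [Finite ι] (i j : ι) (μ : ι → ℕ) :
    elemTrace hW i j μ - elemTrace hW j i μ = ((μ i : K) - μ j) * contentDim W μ := by
  have hcomm : elemEnd hW i j μ - elemEnd hW j i μ = ((μ i : K) - μ j) • LinearMap.id :=
    contentEnd_ext fun f w hw => by
      subst hw
      exact elemAct_commutator i j f.1 w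
  rw [elemTrace, elemTrace, ← map_sub, hcomm, trace_smul_id]

theorem sum_elemTrace [Fintype ι] {z : K} (hz : ∀ f ∈ W, swapSum X ι K f = z • f) (μ : ι → ℕ) :
    ∑ i, ∑ j, elemTrace hW i j μ
      = ((Fintype.card ι - 1) * Fintype.card X + z) * contentDim W μ := by
  have hcasimir : ∑ i, ∑ j, elemEnd hW i j μ
      = (((Fintype.card ι : K) - 1) * Fintype.card X + z) • LinearMap.id := by
    refine LinearMap.ext fun f => Subtype.ext (funext fun w => ?_)
    simp only [LinearMap.sum_apply, AddSubmonoidClass.coe_finsetSum, Finset.sum_apply,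
      elemEnd_apply, sum_elemAct_elemAct, hz _ f.2.1]
    exact (add_mul _ _ _).symm
  simp only [elemTrace, ← map_sum]
  rw [hcasimir, trace_smul_id]

end Traces

/-! ### The dominance order -/

section Dominance

variable {r : ℕ}

/-- The sum of the first `k` entries `a_1 + ⋯ + a_k` (of all entries if `k ≥ r`). -/
def headSum (a : Fin r → ℕ) (k : ℕ) : ℕ := ∑ i with (i : Fin r).val < k, a i

theorem headSum_add (a b : Fin r → ℕ) (k : ℕ) : headSum (a + b) k = headSum a k + headSum b k :=
  Finset.sum_add_distrib

theorem headSum_succ (a : Fin r → ℕ) (j : Fin r) :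
    headSum a (j.val + 1) = headSum a j.val + a j := by
  have hinsert : Finset.univ.filter (fun i : Fin r => i.val < j.val + 1)
      = insert j (Finset.univ.filter fun i : Fin r => i.val < j.val) := by
    ext i
    simp only [Finset.mem_filter, Finset.mem_univ, true_and, Finset.mem_insert, Fin.ext_iff]
    omega
  rw [headSum, hinsert, Finset.sum_insert (by simp), add_comm, headSum]

theorem eq_of_headSum_eq {a b : Fin r → ℕ} (h : ∀ k, headSum a k = headSum b k) : a = b := by
  funext j
  have hj := h (j.val + 1)
  rw [headSum_succ, headSum_succ, h j.val] at hj
  exact add_left_cancel hj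

/-- The dominance order, extended to all sequences (whose totals are not required to agree). -/
def DominatedBy (a b : Fin r → ℕ) : Prop := ∀ k, headSum a k ≤ headSum b k

theorem DominatedBy.add {a b c d : Fin r → ℕ} (hab : DominatedBy a b) (hcd : DominatedBy c d) :
    DominatedBy (a + c) (b + d) := fun k => by
  rw [headSum_add, headSum_add]
  exact add_le_add (hab k) (hcd k)

theorem DominatedBy.eq_and_eq_of_add_eq {a b c d : Fin r → ℕ} (hab : DominatedBy a b)
    (hcd : DominatedBy c d) (h : a + c = b + d) : a = b ∧ c = d := by
  have hsum : ∀ k, headSum a k + headSum c k = headSum b k + headSum d k := fun k => by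
    rw [← headSum_add, ← headSum_add, h]
  exact ⟨eq_of_headSum_eq fun k => by linarith [hab k, hcd k, hsum k],
    eq_of_headSum_eq fun k => by linarith [hab k, hcd k, hsum k]⟩

theorem exists_lt_iff_of_antitone {a : Fin r → ℕ} (ha : Antitone a) (m : ℕ) :
    ∃ k : ℕ, ∀ i : Fin r, m < a i ↔ i.val < k := by
  refine ⟨(Finset.univ.filter fun i => m < a i).sup fun i => i.val + 1, fun i => ?_⟩
  rw [Finset.lt_sup_iff]
  constructor
  · exact fun h => ⟨i, by simpa using h, by omega⟩
  · rintro ⟨j, hj, hij⟩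
    have hmj : m < a j := by simpa using hj
    exact hmj.trans_le (ha (Fin.le_def.2 (by omega)))

theorem DominatedBy.sum_mul_le {a b c : Fin r → ℕ} (h : DominatedBy a b) (hc : Antitone c) :
    ∑ i, c i * a i ≤ ∑ i, c i * b i := by
  have layer : ∀ d : Fin r → ℕ, ∑ i, c i * d i
      = ∑ m ∈ Finset.range (∑ i, c i), ∑ i with m < c i, d i := fun d => by
    simp only [Finset.sum_filter]
    rw [Finset.sum_comm]
    refine Finset.sum_congr rfl fun i _ => ?_
    have hrange : (Finset.range (∑ i, c i)).filter (fun m => m < c i) = Finset.range (c i) := by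
      ext m
      simp only [Finset.mem_filter, Finset.mem_range, and_iff_right_iff_imp]
      exact fun hm => hm.trans_le
        (Finset.single_le_sum (f := c) (fun _ _ => Nat.zero_le _) (Finset.mem_univ i))
    rw [← Finset.sum_filter, Finset.sum_const, smul_eq_mul, hrange, Finset.card_range]
  rw [layer, layer]
  refine Finset.sum_le_sum fun m _ => ?_
  obtain ⟨k, hk⟩ := exists_lt_iff_of_antitone hc m
  simp only [hk]
  exact h k

theorem DominatedBy.eq_of_sum_sq_eq {a b : Fin r → ℕ} (h : DominatedBy a b) (ha : Antitone a)
    (hsq : ∑ i, a i ^ 2 = ∑ i, b i ^ 2) : a = b := by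
  have hinner : ∑ i, a i ^ 2 ≤ ∑ i, a i * b i := by
    simpa only [sq] using h.sum_mul_le ha
  have hdist : ∑ i, ((b i : ℤ) - a i) ^ 2 ≤ 0 := by
    have hexpand : ∑ i, ((b i : ℤ) - a i) ^ 2
        = ((∑ i, b i ^ 2 : ℕ) : ℤ) + ((∑ i, a i ^ 2 : ℕ) : ℤ)
          - 2 * ((∑ i, a i * b i : ℕ) : ℤ) := by
      push_cast
      rw [Finset.mul_sum, ← Finset.sum_add_distrib, ← Finset.sum_sub_distrib]
      exact Finset.sum_congr rfl fun i _ => by ring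
    rw [hexpand, ← hsq]
    omega
  have hzero := (Finset.sum_eq_zero_iff_of_nonneg fun i _ => sq_nonneg ((b i : ℤ) - a i)).1
    (le_antisymm hdist (Finset.sum_nonneg fun i _ => sq_nonneg _))
  funext i
  have hi := pow_eq_zero_iff two_ne_zero |>.1 (hzero i (Finset.mem_univ i))
  omega

theorem dominatedBy_comp_perm_of_antitone {a : Fin r → ℕ} (ha : Antitone a)
    (σ : Equiv.Perm (Fin r)) : DominatedBy (a ∘ σ) a := fun k => by
  have hind : Antitone fun i : Fin r => if i.val < k then 1 else 0 := fun i j hij => by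
    have : i.val ≤ j.val := hij
    dsimp only
    split_ifs <;> omega
  have hrearr := (ha.monovary hind).sum_comp_perm_mul_le_sum_mul (σ := σ)
  simp only [mul_ite, mul_one, mul_zero] at hrearr
  simp only [headSum, Finset.sum_filter, Function.comp_apply]
  exact hrearr

end Dominance

/-! ### The Young symmetrizer on functions on words -/

section FiberPerm

variable {X Y M : Type*} [Fintype X] [DecidableEq X] [DecidableEq Y] [AddCommMonoid M] (P : X → Y)
  {s : Equiv.Perm X}

theorem sum_fiberPerm_mul_right (hs : ∀ c, P (s c) = P c) (F : Equiv.Perm X → M) :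
    ∑ p : {p : Equiv.Perm X // ∀ c, P (p c) = P c}, F (p.1 * s)
      = ∑ p : {p : Equiv.Perm X // ∀ c, P (p c) = P c}, F p.1 := by
  refine Fintype.sum_equiv ((Equiv.mulRight s).subtypeEquiv fun p => ⟨fun h c => ?_, fun h c => ?_⟩)
    _ _ fun _ => rfl
  · exact (h (s c)).trans (hs c)
  · obtain ⟨d, rfl⟩ := s.surjective c
    exact (h d).trans (hs d).symm

theorem sum_fiberPerm_mul_left (hs : ∀ c, P (s c) = P c) (F : Equiv.Perm X → M) :
    ∑ p : {p : Equiv.Perm X // ∀ c, P (p c) = P c}, F (s * p.1)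
      = ∑ p : {p : Equiv.Perm X // ∀ c, P (p c) = P c}, F p.1 :=
  Fintype.sum_equiv
    ((Equiv.mulLeft s).subtypeEquiv fun p => forall_congr' fun c => by
      rw [Equiv.coe_mulLeft, Equiv.Perm.mul_apply, hs])
    _ _ fun _ => rfl

end FiberPerm

section Young

variable {r : ℕ} (ν : Fin r → ℕ)

/-- The sum of the permutations preserving the rows. -/
def rowSum : Module.End ℂ ((Boxes ν → Fin r) → ℂ) := ∑ p : RowPerm ν, permRep p.1

/-- The signed sum of the permutations preserving the columns. -/
def colSum : Module.End ℂ ((Boxes ν → Fin r) → ℂ) :=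
  ∑ q : ColPerm ν, Equiv.Perm.sign q.1 • permRep q.1

/-- The Young symmetrizer on functions on words, the coordinate form of `youngSymmetrizer`. -/
def youngOp : Module.End ℂ ((Boxes ν → Fin r) → ℂ) := rowSum ν * colSum ν

variable {ν}

theorem rowSum_mul_permRep {s : Equiv.Perm (Boxes ν)} (hs : ∀ c, (s c).1 = c.1) :
    rowSum ν * permRep s = rowSum ν := by
  simp only [rowSum, Finset.sum_mul, ← map_mul]
  exact sum_fiberPerm_mul_right (fun c : Boxes ν => c.1) hs permRep

theorem permRep_mul_colSum {s : Equiv.Perm (Boxes ν)} (hs : ∀ c, ((s c).2 : ℕ) = (c.2 : ℕ)) :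
    permRep s * colSum ν = Equiv.Perm.sign s • colSum ν := by
  rw [colSum, Finset.mul_sum, Finset.smul_sum,
    ← sum_fiberPerm_mul_left (fun c : Boxes ν => (c.2 : ℕ)) hs
      fun q => Equiv.Perm.sign s • Equiv.Perm.sign q • permRep q]
  refine Finset.sum_congr rfl fun q _ => ?_
  rw [smul_smul, Equiv.Perm.sign_mul, ← mul_assoc, Int.units_mul_self, one_mul, map_mul,
    mul_smul_comm]

theorem colSum_mul_permRep {s : Equiv.Perm (Boxes ν)} (hs : ∀ c, ((s c).2 : ℕ) = (c.2 : ℕ)) :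
    colSum ν * permRep s = Equiv.Perm.sign s • colSum ν := by
  rw [colSum, Finset.sum_mul, Finset.smul_sum,
    ← sum_fiberPerm_mul_right (fun c : Boxes ν => (c.2 : ℕ)) hs
      fun q => Equiv.Perm.sign s • Equiv.Perm.sign q • permRep q]
  refine Finset.sum_congr rfl fun q _ => ?_
  rw [smul_smul, Equiv.Perm.sign_mul, mul_left_comm, Int.units_mul_self, mul_one, map_mul,
    smul_mul_assoc]

theorem mul_youngOp_comm {T : Module.End ℂ ((Boxes ν → Fin r) → ℂ)}
    (hT : ∀ p, T * permRep p = permRep p * T) : T * youngOp ν = youngOp ν * T := by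
  have hrow : T * rowSum ν = rowSum ν * T := by
    simp only [rowSum, Finset.mul_sum, Finset.sum_mul, hT]
  have hcol : T * colSum ν = colSum ν * T := by
    simp only [colSum, Finset.mul_sum, Finset.sum_mul, mul_smul_comm, smul_mul_assoc, hT]
  rw [youngOp, ← mul_assoc, hrow, mul_assoc, hcol, mul_assoc]

theorem elemAct_mem_range_youngOp (i j : Fin r) :
    ∀ f ∈ LinearMap.range (youngOp ν), elemAct i j f ∈ LinearMap.range (youngOp ν) := by
  rintro _ ⟨g, rfl⟩
  exact ⟨elemAct i j g,
    (DFunLike.congr_fun (mul_youngOp_comm (elemAct_mul_permRep i j)) g).symm⟩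

/-! ### The sum of transpositions acts by a scalar -/

variable (ν) in
/-- The sum of all permutations that preserve the rows up to moving the box `b` into row `i`: the
transpositions of `b` with the boxes of row `i`, and `1`, represent the cosets of the row group. -/
def garnirSum (i : Fin r) (b : Boxes ν) : Module.End ℂ ((Boxes ν → Fin r) → ℂ) :=
  rowSum ν * (1 + ∑ j : Fin (ν i), permRep (Equiv.swap ⟨i, j⟩ b))

theorem rowSum_mul_swap_mul_swap {a a' b : Boxes ν} (haa' : a ≠ a') (ha'b : a' ≠ b)
    (hrow : a.1 = a'.1) :
    rowSum ν * (permRep (Equiv.swap a b) * permRep (Equiv.swap a' b))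
      = rowSum ν * permRep (Equiv.swap a b) := by
  have hswap : Equiv.swap a b * Equiv.swap a' b = Equiv.swap a a' * Equiv.swap a b := by
    rw [Equiv.mul_swap_eq_swap_mul, Equiv.swap_apply_right,
      Equiv.swap_apply_of_ne_of_ne haa'.symm ha'b, Equiv.swap_comm a']
  rw [← map_mul, hswap, map_mul, ← mul_assoc, rowSum_mul_permRep]
  exact congrFun (comp_swap_eq_self (w := fun c : Boxes ν => c.1) hrow)

theorem garnirSum_mul_swap {i : Fin r} {b : Boxes ν} (hib : i ≠ b.1) (d : Fin (ν i)) :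
    garnirSum ν i b * permRep (Equiv.swap ⟨i, d⟩ b) = garnirSum ν i b := by
  have hne : (⟨i, d⟩ : Boxes ν) ≠ b := fun h => hib (congrArg Sigma.fst h)
  have hothers : ∀ j ∈ Finset.univ.erase d,
      rowSum ν * (permRep (Equiv.swap (⟨i, j⟩ : Boxes ν) b) * permRep (Equiv.swap ⟨i, d⟩ b))
        = rowSum ν * permRep (Equiv.swap ⟨i, j⟩ b) := fun j hj =>
    rowSum_mul_swap_mul_swap (fun h => Finset.ne_of_mem_erase hj (by simpa using h)) hne rfl
  have hself : permRep (Equiv.swap (⟨i, d⟩ : Boxes ν) b) * permRep (Equiv.swap ⟨i, d⟩ b)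
      = (1 : Module.End ℂ ((Boxes ν → Fin r) → ℂ)) := by
    rw [← map_mul, Equiv.swap_mul_self, map_one]
  simp only [garnirSum, mul_add, add_mul, mul_one, mul_assoc, Finset.mul_sum, Finset.sum_mul]
  rw [← Finset.add_sum_erase _ _ (Finset.mem_univ d), Finset.sum_congr rfl hothers, hself, mul_one,
    ← Finset.add_sum_erase _ (fun j => rowSum ν * permRep (Equiv.swap ⟨i, j⟩ b))
      (Finset.mem_univ d)]
  exact add_left_comm _ _ _

theorem garnirSum_mul_colSum (hν : Antitone ν) {i : Fin r} {b : Boxes ν} (hib : i < b.1) :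
    garnirSum ν i b * colSum ν = 0 := by
  let d : Fin (ν i) := ⟨b.2, b.2.2.trans_le (hν hib.le)⟩
  have hne : (⟨i, d⟩ : Boxes ν) ≠ b := fun h => hib.ne (congrArg Sigma.fst h)
  have hcol : ∀ c, ((Equiv.swap (⟨i, d⟩ : Boxes ν) b c).2 : ℕ) = c.2 :=
    congrFun (comp_swap_eq_self (w := fun c : Boxes ν => (c.2 : ℕ)) rfl)
  have : IsAddTorsionFree (Module.End ℂ ((Boxes ν → Fin r) → ℂ)) := .of_isTorsionFree ℂ _
  refine self_eq_neg.1 ?_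
  conv_lhs => rw [← garnirSum_mul_swap hib.ne d, mul_assoc, permRep_mul_colSum hcol,
    Equiv.Perm.sign_swap hne]
  rw [Units.neg_smul, one_smul]
  exact mul_neg (garnirSum ν i b) (colSum ν)

theorem sum_rowSum_swap_colSum (hν : Antitone ν) {i : Fin r} {b : Boxes ν} (hib : i < b.1) :
    ∑ j : Fin (ν i), rowSum ν * permRep (Equiv.swap ⟨i, j⟩ b) * colSum ν = -youngOp ν := by
  have hgarnir := garnirSum_mul_colSum hν hib
  rw [garnirSum, mul_add, mul_one, add_mul, Finset.mul_sum, Finset.sum_mul] at hgarnir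
  exact (neg_eq_of_add_eq_zero_right hgarnir).symm

theorem exists_sum_rowSum_swap_colSum_eq_smul (hν : Antitone ν) (i i' : Fin r) :
    ∃ z : ℂ, ∑ j : Fin (ν i), ∑ j' : Fin (ν i'),
      rowSum ν * permRep (Equiv.swap ⟨i, j⟩ ⟨i', j'⟩) * colSum ν = z • youngOp ν := by
  have hneg : ∀ m : ℕ, m • -youngOp ν = (-m : ℂ) • youngOp ν := fun m => by
    rw [← Nat.cast_smul_eq_nsmul ℂ, smul_neg]
    exact (neg_smul _ _).symm
  rcases lt_trichotomy i i' with h | rfl | h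
  · refine ⟨-(ν i' : ℂ), ?_⟩
    rw [Finset.sum_comm, Finset.sum_congr rfl fun j' _ =>
      sum_rowSum_swap_colSum hν (show i < (⟨i', j'⟩ : Boxes ν).1 from h)]
    rw [Finset.sum_const, Finset.card_fin, hneg]
  · refine ⟨(ν i * ν i : ℕ), ?_⟩
    have hrow : ∀ j j' : Fin (ν i), rowSum ν * permRep (Equiv.swap ⟨i, j⟩ ⟨i, j'⟩) = rowSum ν :=
      fun j j' => rowSum_mul_permRep
        (congrFun (comp_swap_eq_self (w := fun c : Boxes ν => c.1) rfl))
    simp only [hrow, Finset.sum_const, Finset.card_fin, smul_smul, Nat.cast_smul_eq_nsmul]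
    rfl
  · refine ⟨-(ν i : ℂ), ?_⟩
    simp only [Equiv.swap_comm (⟨i, _⟩ : Boxes ν) ⟨i', _⟩,
      sum_rowSum_swap_colSum hν (show i' < (⟨i, _⟩ : Boxes ν).1 from h)]
    rw [Finset.sum_const, Finset.card_fin, hneg]

theorem exists_swapSum_mul_youngOp_eq_smul (hν : Antitone ν) :
    ∃ z : ℂ, swapSum (Boxes ν) (Fin r) ℂ * youngOp ν = z • youngOp ν := by
  choose z hz using exists_sum_rowSum_swap_colSum_eq_smul hν
  refine ⟨∑ i, ∑ i', z i i', ?_⟩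
  have hrow : swapSum (Boxes ν) (Fin r) ℂ * rowSum ν = rowSum ν * swapSum (Boxes ν) (Fin r) ℂ := by
    simp only [rowSum, Finset.mul_sum, Finset.sum_mul, swapSum_mul_permRep]
  rw [youngOp, ← mul_assoc, hrow, swapSum]
  simp only [Finset.mul_sum, Finset.sum_mul, Finset.sum_smul]
  simp only [Fintype.sum_sigma]
  refine Finset.sum_congr rfl fun i _ => ?_
  rw [Finset.sum_comm]
  exact Finset.sum_congr rfl fun i' _ => hz i i'

theorem exists_swapSum_eq_smul (hν : Antitone ν) :
    ∃ z : ℂ, ∀ f ∈ LinearMap.range (youngOp ν), swapSum (Boxes ν) (Fin r) ℂ f = z • f := by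
  obtain ⟨z, hz⟩ := exists_swapSum_mul_youngOp_eq_smul hν
  refine ⟨z, ?_⟩
  rintro _ ⟨g, rfl⟩
  exact DFunLike.congr_fun hz g

/-! ### Weights of the image of the Young symmetrizer -/

theorem permRep_single (p : Equiv.Perm (Boxes ν)) (w : Boxes ν → Fin r) (c : ℂ) :
    permRep p (Pi.single w c) = Pi.single (w ∘ p.symm) c := by
  funext v
  simp only [permRep_apply, Pi.single_apply, p.eq_comp_symm]

/-- A word is injective on columns if the letters in each column are distinct. -/
def InjectiveOnColumns (w : Boxes ν → Fin r) : Prop :=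
  ∀ a b : Boxes ν, (a.2 : ℕ) = b.2 → w a = w b → a = b

theorem youngOp_single_eq_zero {w : Boxes ν → Fin r} (hw : ¬InjectiveOnColumns w) :
    youngOp ν (Pi.single w 1) = 0 := by
  rw [InjectiveOnColumns] at hw
  push Not at hw
  obtain ⟨a, b, hcol, hwab, hab⟩ := hw
  have hfixed : permRep (Equiv.swap a b) (Pi.single w (1 : ℂ)) = Pi.single w 1 := by
    rw [permRep_single, Equiv.symm_swap, comp_swap_eq_self hwab]
  have hsign := DFunLike.congr_fun (colSum_mul_permRep
    (congrFun (comp_swap_eq_self (w := fun c : Boxes ν => (c.2 : ℕ)) hcol))) (Pi.single w (1 : ℂ))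
  rw [Module.End.mul_apply, hfixed, Equiv.Perm.sign_swap hab, Units.neg_smul, one_smul] at hsign
  rw [youngOp, Module.End.mul_apply, self_eq_neg.1 hsign, map_zero]

theorem youngOp_single_mem_contentSpace (w : Boxes ν → Fin r) :
    youngOp ν (Pi.single w 1) ∈ contentSpace (Boxes ν) ℂ (letterCount w) := by
  rw [youngOp, Module.End.mul_apply, rowSum, LinearMap.sum_apply]
  refine Submodule.sum_mem _ fun p _ => permRep_mem_contentSpace _ ?_
  rw [colSum, LinearMap.sum_apply]
  refine Submodule.sum_mem _ fun q _ => ?_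
  rw [LinearMap.smul_apply]
  refine Submodule.smul_of_tower_mem _ _ (permRep_mem_contentSpace _ ?_)
  exact fun v hv => Pi.single_eq_of_ne (fun h => hv (by rw [h])) _

theorem range_youngOp_inf_contentSpace (μ : Fin r → ℕ) :
    LinearMap.range (youngOp ν) ⊓ contentSpace (Boxes ν) ℂ μ
      = Submodule.span ℂ ((fun w => youngOp ν (Pi.single w 1)) '' {w | letterCount w = μ}) := by
  apply le_antisymm
  · rintro _ ⟨⟨g, rfl⟩, hμ⟩
    have hexpand : youngOp ν g = ∑ w, g w • youngOp ν (Pi.single w 1) := by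
      conv_lhs => rw [pi_eq_sum_univ' g, map_sum]
      exact Finset.sum_congr rfl fun w _ => map_smul _ _ _
    have hcontent : youngOp ν g
        = ∑ w with letterCount w = μ, g w • youngOp ν (Pi.single w 1) := by
      funext v
      simp only [Finset.sum_filter, Finset.sum_apply]
      by_cases hv : letterCount v = μ
      · rw [hexpand, Finset.sum_apply]
        refine Finset.sum_congr rfl fun w _ => ?_
        split_ifs with hw
        · rfl
        · rw [Pi.smul_apply, youngOp_single_mem_contentSpace w v (hv.trans_ne (Ne.symm hw)),
            smul_zero]
      · rw [hμ v hv]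
        refine (Finset.sum_eq_zero fun w _ => ?_).symm
        split_ifs with hw
        · rw [Pi.smul_apply, youngOp_single_mem_contentSpace w v (hw ▸ hv), smul_zero]
        · rfl
    rw [hcontent]
    exact Submodule.sum_mem _ fun w hw => Submodule.smul_mem _ _
      (Submodule.subset_span ⟨w, (Finset.mem_filter.1 hw).2, rfl⟩)
  · rw [Submodule.span_le]
    rintro _ ⟨w, rfl, rfl⟩
    exact ⟨⟨_, rfl⟩, youngOp_single_mem_contentSpace w⟩

theorem exists_youngOp_single_ne_zero {μ : Fin r → ℕ}
    (h : contentDim (LinearMap.range (youngOp ν)) μ ≠ 0) :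
    ∃ w : Boxes ν → Fin r, letterCount w = μ ∧ youngOp ν (Pi.single w 1) ≠ 0 := by
  contrapose! h
  have hbot : LinearMap.range (youngOp ν) ⊓ contentSpace (Boxes ν) ℂ μ = ⊥ := by
    rw [range_youngOp_inf_contentSpace, Submodule.span_eq_bot]
    rintro _ ⟨w, hw, rfl⟩
    exact h w hw
  rw [contentDim, hbot, finrank_bot]

theorem sum_eq_of_contentDim_ne_zero {μ : Fin r → ℕ}
    (h : contentDim (LinearMap.range (youngOp ν)) μ ≠ 0) : ∑ i, μ i = ∑ i, ν i := by
  obtain ⟨w, rfl, -⟩ := exists_youngOp_single_ne_zero h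
  rw [sum_letterCount, Fintype.card_sigma]
  simp only [Fintype.card_fin]

/-- The number of boxes in column `j` whose letter is less than `k`. -/
def columnCount (w : Boxes ν → Fin r) (j k : ℕ) : ℕ :=
  (Finset.univ.filter fun a : Boxes ν => (a.2 : ℕ) = j ∧ (w a : ℕ) < k).card

theorem snd_lt_sum (a : Boxes ν) : (a.2 : ℕ) < ∑ i, ν i :=
  a.2.2.trans_le (Finset.single_le_sum (f := ν) (fun _ _ => Nat.zero_le _) (Finset.mem_univ a.1))

theorem sum_columnCount (w : Boxes ν → Fin r) (k : ℕ) :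
    ∑ j ∈ Finset.range (∑ i, ν i), columnCount w j k = headSum (letterCount w) k := by
  have hcolumns : (Finset.univ.filter fun a : Boxes ν => (w a : ℕ) < k).card
      = ∑ j ∈ Finset.range (∑ i, ν i), columnCount w j k := by
    rw [Finset.card_eq_sum_card_fiberwise (f := fun a : Boxes ν => (a.2 : ℕ))
      (t := Finset.range (∑ i, ν i))
      fun a _ => Finset.mem_coe.2 (Finset.mem_range.2 (snd_lt_sum a))]
    refine Finset.sum_congr rfl fun j _ => ?_
    simp only [columnCount, Finset.filter_filter, and_comm]
  have hletters : (Finset.univ.filter fun a : Boxes ν => (w a : ℕ) < k).card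
      = headSum (letterCount w) k := by
    rw [Finset.card_eq_sum_card_fiberwise (f := w)
      (t := Finset.univ.filter (fun i : Fin r => (i : ℕ) < k)) fun a ha => by simpa using ha,
      headSum]
    refine Finset.sum_congr rfl fun i hi => ?_
    rw [letterCount, Finset.filter_filter]
    congr 1
    ext a
    simp only [Finset.mem_filter, Finset.mem_univ, true_and] at hi ⊢
    exact ⟨fun h => h.2, fun h => ⟨h ▸ hi, h⟩⟩
  rw [← hcolumns, hletters]

/-- The word whose letter in each box is the row of the box. -/
def rowWord (ν : Fin r → ℕ) : Boxes ν → Fin r := Sigma.fst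

theorem letterCount_rowWord : letterCount (rowWord ν) = ν := by
  funext i
  rw [letterCount_eq_sum, Fintype.sum_sigma]
  have hrow : ∀ x, (∑ y : Fin (ν x), if rowWord ν ⟨x, y⟩ = i then 1 else 0)
      = if x = i then ν x else 0 := fun x => by
    change (∑ _y : Fin (ν x), if x = i then 1 else 0) = _
    rw [Finset.sum_const, Finset.card_fin, smul_eq_mul, mul_ite, mul_one, mul_zero]
  simp only [hrow, Finset.sum_ite_eq', Finset.mem_univ, if_true]

theorem columnCount_le_self {w : Boxes ν → Fin r} (hw : InjectiveOnColumns w) (j k : ℕ) :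
    columnCount w j k ≤ k := by
  have hle : columnCount w j k ≤ (Finset.range k).card := by
    refine Finset.card_le_card_of_injOn (fun a => (w a : ℕ)) (fun a ha => ?_)
      fun a ha a' ha' haa' => ?_
    · exact Finset.mem_coe.2 (Finset.mem_range.2 (Finset.mem_filter.1 ha).2.2)
    · exact hw a a' ((Finset.mem_filter.1 ha).2.1.trans (Finset.mem_filter.1 ha').2.1.symm)
        (Fin.ext haa')
  rwa [Finset.card_range] at hle

theorem le_columnCount_rowWord (hν : Antitone ν) {b : Boxes ν} {k : ℕ} (hk : k ≤ (b.1 : ℕ)) :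
    k ≤ columnCount (rowWord ν) b.2 k := by
  have hle : (Finset.univ : Finset (Fin k)).card ≤ columnCount (rowWord ν) b.2 k :=
    Finset.card_le_card_of_injOn
      (fun i => ⟨⟨i, i.2.trans_le (hk.trans b.1.2.le)⟩,
        ⟨b.2, b.2.2.trans_le (hν (Fin.le_def.2 (i.2.le.trans hk)))⟩⟩)
      (fun i _ => Finset.mem_coe.2 (Finset.mem_filter.2 ⟨Finset.mem_univ _, rfl, i.2⟩))
      fun i _ i' _ hii' => Fin.ext (congrArg (fun a : Boxes ν => (a.1 : ℕ)) hii')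
  rwa [Finset.card_fin] at hle

theorem columnCount_le_rowWord (hν : Antitone ν) {w : Boxes ν → Fin r}
    (hw : InjectiveOnColumns w) (j k : ℕ) : columnCount w j k ≤ columnCount (rowWord ν) j k := by
  by_cases h : ∃ b : Boxes ν, (b.2 : ℕ) = j ∧ k ≤ (b.1 : ℕ)
  · obtain ⟨b, rfl, hkb⟩ := h
    exact (columnCount_le_self hw _ k).trans (le_columnCount_rowWord hν hkb)
  · push Not at h
    refine Finset.card_le_card fun a ha => ?_
    simp only [Finset.mem_filter, Finset.mem_univ, true_and] at ha ⊢
    exact ⟨ha.1, h a ha.1⟩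

theorem InjectiveOnColumns.dominatedBy (hν : Antitone ν) {w : Boxes ν → Fin r}
    (hw : InjectiveOnColumns w) : DominatedBy (letterCount w) ν := fun k => by
  conv_rhs => rw [← letterCount_rowWord (ν := ν)]
  rw [← sum_columnCount, ← sum_columnCount]
  exact Finset.sum_le_sum fun j _ => columnCount_le_rowWord hν hw j k

theorem dominatedBy_of_contentDim_ne_zero (hν : Antitone ν) {μ : Fin r → ℕ}
    (h : contentDim (LinearMap.range (youngOp ν)) μ ≠ 0) : DominatedBy μ ν := by
  obtain ⟨w, rfl, hw⟩ := exists_youngOp_single_ne_zero h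
  exact InjectiveOnColumns.dominatedBy hν (not_not.1 (mt youngOp_single_eq_zero hw))

theorem columnCount_succ (w : Boxes ν → Fin r) (j k : ℕ) :
    columnCount w j (k + 1) = columnCount w j k
      + (Finset.univ.filter fun a : Boxes ν => (a.2 : ℕ) = j ∧ (w a : ℕ) = k).card := by
  rw [columnCount, columnCount, ← Finset.card_union_of_disjoint]
  · congr 1
    ext a
    simp only [Finset.mem_filter, Finset.mem_univ, true_and, Finset.mem_union]
    omega
  · exact Finset.disjoint_filter.2 fun a _ h h' => h.2.ne h'.2

theorem columnCount_eq_rowWord (hν : Antitone ν) {w : Boxes ν → Fin r}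
    (hw : InjectiveOnColumns w) (hcount : letterCount w = ν) {j : ℕ} (hj : j < ∑ i, ν i) (k : ℕ) :
    columnCount w j k = columnCount (rowWord ν) j k := by
  have hsum : ∑ j ∈ Finset.range (∑ i, ν i), columnCount w j k
      = ∑ j ∈ Finset.range (∑ i, ν i), columnCount (rowWord ν) j k := by
    rw [sum_columnCount, sum_columnCount, hcount, letterCount_rowWord]
  exact (Finset.sum_eq_sum_iff_of_le fun j _ => columnCount_le_rowWord hν hw j k).1 hsum j
    (Finset.mem_range.2 hj)

theorem snd_lt_of_letterCount_eq (hν : Antitone ν) {w : Boxes ν → Fin r}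
    (hw : InjectiveOnColumns w) (hcount : letterCount w = ν) (a : Boxes ν) :
    (a.2 : ℕ) < ν (w a) := by
  have hsucc := columnCount_eq_rowWord hν hw hcount (snd_lt_sum a) ((w a : ℕ) + 1)
  rw [columnCount_succ, columnCount_succ, columnCount_eq_rowWord hν hw hcount (snd_lt_sum a),
    add_left_cancel_iff] at hsucc
  have hpos : 0 < (Finset.univ.filter fun b : Boxes ν =>
      (b.2 : ℕ) = a.2 ∧ (rowWord ν b : ℕ) = w a).card := by
    rw [← hsucc, Finset.card_pos]
    exact ⟨a, Finset.mem_filter.2 ⟨Finset.mem_univ _, rfl, rfl⟩⟩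
  obtain ⟨b, hb⟩ := Finset.card_pos.1 hpos
  obtain ⟨-, hcol, hrow⟩ := Finset.mem_filter.1 hb
  rw [← hcol, ← (Fin.ext hrow : rowWord ν b = w a)]
  exact b.2.2

theorem exists_colPerm_of_letterCount_eq (hν : Antitone ν) {w : Boxes ν → Fin r}
    (hw : InjectiveOnColumns w) (hcount : letterCount w = ν) :
    ∃ q : Equiv.Perm (Boxes ν), (∀ c, ((q c).2 : ℕ) = c.2) ∧ rowWord ν ∘ q = w := by
  let q : Boxes ν → Boxes ν := fun a => ⟨w a, ⟨a.2, snd_lt_of_letterCount_eq hν hw hcount a⟩⟩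
  have hq : Function.Injective q := fun a b hab =>
    hw a b (congrArg (fun c : Boxes ν => (c.2 : ℕ)) hab :) (congrArg Sigma.fst hab)
  exact ⟨Equiv.ofBijective q (Finite.injective_iff_bijective.1 hq), fun _ => rfl, rfl⟩

theorem colPerm_eq_one {q : ColPerm ν} (hq : rowWord ν ∘ q.1 = rowWord ν) :
    q = ⟨1, fun _ => rfl⟩ := by
  have hbox : ∀ {a b : Boxes ν}, a.1 = b.1 → (a.2 : ℕ) = b.2 → a = b := by
    rintro ⟨i, j⟩ ⟨i', j'⟩ (rfl : i = i') (hj : (j : ℕ) = j')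
    rw [Fin.ext hj]
  exact Subtype.ext (Equiv.ext fun c => hbox (congrFun hq c) (q.2 c))

theorem youngOp_rowWord_apply_rowWord :
    youngOp ν (Pi.single (rowWord ν) 1) (rowWord ν) = Fintype.card (RowPerm ν) := by
  have hcol : colSum ν (Pi.single (rowWord ν) 1) (rowWord ν) = 1 := by
    rw [colSum, LinearMap.sum_apply, Finset.sum_apply,
      Finset.sum_eq_single (⟨1, fun _ => rfl⟩ : ColPerm ν)]
    · rw [Equiv.Perm.sign_one, one_smul, map_one, Module.End.one_apply, Pi.single_eq_same]
    · intro q _ hq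
      rw [LinearMap.smul_apply, Pi.smul_apply, permRep_apply,
        Pi.single_eq_of_ne (mt colPerm_eq_one hq), smul_zero]
    · exact fun h => absurd (Finset.mem_univ _) h
  have hrow : ∀ p : RowPerm ν, rowWord ν ∘ p.1 = rowWord ν := fun p => funext p.2
  rw [youngOp, Module.End.mul_apply, rowSum, LinearMap.sum_apply, Finset.sum_apply]
  simp only [permRep_apply, hrow, hcol, Finset.sum_const, Finset.card_univ, nsmul_eq_mul, mul_one]

theorem youngOp_rowWord_ne_zero : youngOp ν (Pi.single (rowWord ν) 1) ≠ 0 := fun h => by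
  have hcard : (Fintype.card (RowPerm ν) : ℂ) = 0 := by
    rw [← youngOp_rowWord_apply_rowWord, h, Pi.zero_apply]
  exact (Fintype.card_pos_iff.2 ⟨(⟨1, fun _ => rfl⟩ : RowPerm ν)⟩).ne' (Nat.cast_eq_zero.1 hcard)

theorem youngOp_single_mem_span_rowWord (hν : Antitone ν) {w : Boxes ν → Fin r}
    (hcount : letterCount w = ν) :
    youngOp ν (Pi.single w 1) ∈ Submodule.span ℂ {youngOp ν (Pi.single (rowWord ν) 1)} := by
  by_cases hw : InjectiveOnColumns w
  · obtain ⟨q, hq, rfl⟩ := exists_colPerm_of_letterCount_eq hν hw hcount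
    have hsingle : Pi.single (rowWord ν ∘ q) (1 : ℂ)
        = permRep q.symm (Pi.single (rowWord ν) 1) := by
      rw [permRep_single, Equiv.symm_symm]
    have hcol : ∀ c, ((q.symm c).2 : ℕ) = c.2 := fun c => by
      rw [← hq, Equiv.apply_symm_apply]
    rw [hsingle, youngOp, ← Module.End.mul_apply, mul_assoc, colSum_mul_permRep hcol,
      mul_smul_comm, LinearMap.smul_apply]
    exact Submodule.smul_of_tower_mem _ _ (Submodule.mem_span_singleton_self _)
  · rw [youngOp_single_eq_zero hw]
    exact Submodule.zero_mem _

theorem contentDim_self (hν : Antitone ν) : contentDim (LinearMap.range (youngOp ν)) ν = 1 := by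
  have hspan : LinearMap.range (youngOp ν) ⊓ contentSpace (Boxes ν) ℂ ν
      = Submodule.span ℂ {youngOp ν (Pi.single (rowWord ν) 1)} := by
    rw [range_youngOp_inf_contentSpace]
    apply le_antisymm
    · rw [Submodule.span_le]
      rintro _ ⟨w, hw, rfl⟩
      exact youngOp_single_mem_span_rowWord hν hw
    · exact Submodule.span_mono (Set.singleton_subset_iff.2 ⟨_, letterCount_rowWord, rfl⟩)
  rw [contentDim, hspan, finrank_span_singleton youngOp_rowWord_ne_zero]

end Young

/-! ### Weight spaces of the Schur functor as functions on words -/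

section Transport

variable {r : ℕ} {ν : Fin r → ℕ}

/-- Coordinates on the tensor power of `ℂ^r`. -/
def wordCoords (ν : Fin r → ℕ) :
    (⨂[ℂ] _ : Boxes ν, (Fin r → ℂ)) ≃ₗ[ℂ] ((Boxes ν → Fin r) → ℂ) :=
  (Basis.piTensorProduct (fun _ : Boxes ν => Pi.basisFun ℂ (Fin r))).equivFun

theorem wordCoords_tprod (v : Boxes ν → Fin r → ℂ) (w : Boxes ν → Fin r) :
    wordCoords ν (PiTensorProduct.tprod ℂ v) w = ∏ a, v a (w a) := by
  rw [wordCoords, Module.Basis.equivFun_apply, Basis.piTensorProduct_repr_tprod_apply]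
  simp only [Pi.basisFun_repr]

theorem wordCoords_reindex (p : Equiv.Perm (Boxes ν)) (x : ⨂[ℂ] _ : Boxes ν, (Fin r → ℂ)) :
    wordCoords ν (PiTensorProduct.reindex ℂ (fun _ : Boxes ν => (Fin r → ℂ)) p x)
      = permRep p (wordCoords ν x) := by
  induction x using PiTensorProduct.induction_on with
  | smul_tprod a v =>
    rw [map_smul, map_smul, map_smul, map_smul]
    congr 1
    funext w
    rw [PiTensorProduct.reindex_tprod, permRep_apply, wordCoords_tprod, wordCoords_tprod,
      ← Equiv.prod_comp p]
    simp only [Equiv.symm_apply_apply, Function.comp_apply]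
  | add x y hx hy => simp only [map_add, hx, hy]

theorem wordCoords_youngSymmetrizer (x : ⨂[ℂ] _ : Boxes ν, (Fin r → ℂ)) :
    wordCoords ν (youngSymmetrizer ν (Fin r → ℂ) x) = youngOp ν (wordCoords ν x) := by
  simp only [youngSymmetrizer, youngOp, rowSum, colSum, LinearMap.sum_apply, LinearMap.smul_apply,
    LinearMap.comp_apply, LinearEquiv.coe_coe, map_sum, Module.End.mul_apply,
    wordCoords_reindex, Units.smul_def, Int.cast_smul_eq_zsmul, map_zsmul]
  rw [Finset.sum_comm]
  simp only [Finset.smul_sum]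

theorem mem_schurFunctor_iff (x : ⨂[ℂ] _ : Boxes ν, (Fin r → ℂ)) :
    x ∈ schurFunctor ν (Fin r → ℂ) ↔ wordCoords ν x ∈ LinearMap.range (youngOp ν) := by
  constructor
  · rintro ⟨y, rfl⟩
    exact ⟨wordCoords ν y, (wordCoords_youngSymmetrizer y).symm⟩
  · rintro ⟨f, hf⟩
    refine ⟨(wordCoords ν).symm f, (wordCoords ν).injective ?_⟩
    rw [wordCoords_youngSymmetrizer, LinearEquiv.apply_symm_apply, hf]

theorem prod_comp_eq_prod_pow_letterCount {X ι M : Type*} [Fintype X] [Fintype ι] [DecidableEq ι]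
    [CommMonoid M] (t : ι → M) (w : X → ι) : ∏ a, t (w a) = ∏ i, t i ^ letterCount w i := by
  rw [← Finset.prod_fiberwise' Finset.univ w t]
  exact Finset.prod_congr rfl fun i _ => Finset.prod_const _

theorem wordCoords_torusAction (t : Fin r → ℂˣ) (x : ⨂[ℂ] _ : Boxes ν, (Fin r → ℂ))
    (w : Boxes ν → Fin r) : wordCoords ν (torusAction ν t x) w
      = (∏ i, (t i : ℂ) ^ letterCount w i) * wordCoords ν x w := by
  induction x using PiTensorProduct.induction_on with
  | smul_tprod a v =>
    rw [map_smul, map_smul, map_smul, Pi.smul_apply, Pi.smul_apply, mul_smul_comm]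
    congr 1
    rw [torusAction, PiTensorProduct.map_tprod, wordCoords_tprod, wordCoords_tprod,
      ← prod_comp_eq_prod_pow_letterCount (fun i => (t i : ℂ)), ← Finset.prod_mul_distrib]
    simp only [Matrix.toLin'_apply, Matrix.mulVec_diagonal]
  | add x y hx hy => simp only [map_add, Pi.add_apply, hx, hy, mul_add]

theorem exists_torus_separating {κ μ : Fin r → ℕ} (h : κ ≠ μ) :
    ∃ t : Fin r → ℂˣ, ∏ i, (t i : ℂ) ^ κ i ≠ ∏ i, (t i : ℂ) ^ μ i := by
  obtain ⟨i, hi⟩ := Function.ne_iff.1 h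
  have hprod : ∀ η : Fin r → ℕ, ∏ j, (((Pi.mulSingle i (Units.mk0 2 two_ne_zero) :
      Fin r → ℂˣ) j : ℂˣ) : ℂ) ^ η j = 2 ^ η i := fun η => by
    rw [Fintype.prod_eq_single i fun j hj => by
      rw [Pi.mulSingle_eq_of_ne hj, Units.val_one, one_pow], Pi.mulSingle_eq_same, Units.val_mk0]
  refine ⟨Pi.mulSingle i (Units.mk0 2 two_ne_zero), fun heq => hi ?_⟩
  rw [hprod, hprod] at heq
  exact Nat.pow_right_injective le_rfl (mod_cast heq : (2 : ℕ) ^ κ i = 2 ^ μ i)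

theorem forall_mem_eigenspace_torusAction_iff (μ : Fin r → ℕ)
    (x : ⨂[ℂ] _ : Boxes ν, (Fin r → ℂ)) :
    (∀ t : Fin r → ℂˣ, x ∈ Module.End.eigenspace (torusAction ν t) (∏ i, (t i : ℂ) ^ μ i)) ↔
      wordCoords ν x ∈ contentSpace (Boxes ν) ℂ μ := by
  simp only [Module.End.mem_eigenspace_iff]
  constructor
  · intro h w hw
    obtain ⟨t, ht⟩ := exists_torus_separating hw
    have hweight := congrFun (congrArg (wordCoords ν) (h t)) w
    rw [wordCoords_torusAction, map_smul, Pi.smul_apply, smul_eq_mul] at hweight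
    by_contra hne
    exact ht (mul_right_cancel₀ hne hweight)
  · intro h t
    refine (wordCoords ν).injective (funext fun w => ?_)
    rw [wordCoords_torusAction, map_smul, Pi.smul_apply, smul_eq_mul]
    by_cases hw : letterCount w = μ
    · rw [hw]
    · rw [h w hw, mul_zero, mul_zero]

theorem schurWeightSpace_eq_comap (μ : Fin r → ℕ) :
    schurWeightSpace ν μ = (LinearMap.range (youngOp ν) ⊓ contentSpace (Boxes ν) ℂ μ).comap
      (wordCoords ν).toLinearMap := by
  ext x
  rw [schurWeightSpace, Submodule.mem_inf, Submodule.mem_iInf, mem_schurFunctor_iff,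
    forall_mem_eigenspace_torusAction_iff]
  rfl

theorem weightMult_eq_contentDim (μ : Fin r → ℕ) :
    weightMult ν μ = contentDim (LinearMap.range (youngOp ν)) μ := by
  rw [weightMult, contentDim, schurWeightSpace_eq_comap]
  exact ((wordCoords ν).ofSubmodule' _).finrank_eq

end Transport

/-! ### The Vandermonde product and the Euler operators -/

section Euler

/-- The operator `x_k ∂/∂x_k`. -/
def eulerOp {r : ℕ} (k : Fin r) :
    Derivation ℂ (MvPolynomial (Fin r) ℂ) (MvPolynomial (Fin r) ℂ) :=
  (MvPolynomial.X k : MvPolynomial (Fin r) ℂ) • MvPolynomial.pderiv k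

theorem eulerOp_X {r : ℕ} (k i : Fin r) :
    eulerOp k (MvPolynomial.X i) = if i = k then MvPolynomial.X k else 0 := by
  rw [eulerOp, Derivation.smul_apply, MvPolynomial.pderiv_X, smul_eq_mul, Pi.single_apply,
    mul_ite, mul_one, mul_zero]

theorem eulerOp_monomial {r : ℕ} (k : Fin r) (β : Fin r →₀ ℕ) (c : ℂ) :
    eulerOp k (MvPolynomial.monomial β c) = MvPolynomial.monomial β (c * β k) := by
  rw [eulerOp, Derivation.smul_apply, smul_eq_mul, MvPolynomial.X_mul_pderiv_monomial,
    ← Nat.cast_smul_eq_nsmul ℂ, MvPolynomial.smul_monomial, smul_eq_mul, mul_comm]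

theorem coeff_eulerOp {r : ℕ} (k : Fin r) (p : MvPolynomial (Fin r) ℂ) (α : Fin r →₀ ℕ) :
    MvPolynomial.coeff α (eulerOp k p) = (α k : ℂ) * MvPolynomial.coeff α p := by
  induction p using MvPolynomial.induction_on' with
  | monomial β c =>
    rw [eulerOp_monomial, MvPolynomial.coeff_monomial, MvPolynomial.coeff_monomial]
    split_ifs with h
    · rw [h, mul_comm]
    · rw [mul_zero]
  | add p q hp hq => rw [map_add, MvPolynomial.coeff_add, MvPolynomial.coeff_add, hp, hq, mul_add]

theorem derivation_prod {R A M ι : Type*} [CommSemiring R] [CommSemiring A] [Algebra R A]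
    [AddCommMonoid M] [Module A M] [Module R M] [DecidableEq ι] (d : Derivation R A M)
    (s : Finset ι) (f : ι → A) :
    d (∏ p ∈ s, f p) = ∑ p ∈ s, (∏ q ∈ s.erase p, f q) • d (f p) := by
  induction s using Finset.induction_on with
  | empty => rw [Finset.prod_empty, Finset.sum_empty, d.map_one_eq_zero]
  | insert a s ha ih =>
    rw [Finset.prod_insert ha, Derivation.leibniz, ih, Finset.sum_insert ha,
      Finset.erase_insert ha, add_comm, Finset.smul_sum]
    congr 1
    refine Finset.sum_congr rfl fun p hp => ?_
    have hap : a ≠ p := fun h => ha (h ▸ hp)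
    rw [Finset.erase_insert_of_ne hap, Finset.prod_insert fun h => ha (Finset.mem_of_mem_erase h),
      mul_smul]

variable {r : ℕ}

theorem det_pow_rev {R : Type*} [CommRing R] (v : Fin r → R) :
    (Matrix.of fun i j => v i ^ (j.rev : ℕ)).det = ∏ i, ∏ j ∈ Finset.Ioi i, (v i - v j) := by
  have hmatrix : Matrix.of (fun i j : Fin r => v i ^ (j.rev : ℕ)) = Matrix.projVandermonde 1 v := by
    ext1 i j
    rw [Matrix.projVandermonde_apply, Pi.one_apply, one_pow, one_mul]
    rfl
  rw [hmatrix, Matrix.det_projVandermonde]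
  simp only [Pi.one_apply, one_mul]

/-- The factors of the Vandermonde product, padded by `1` to all pairs of indices. -/
def vandFactor (p : Fin r × Fin r) : MvPolynomial (Fin r) ℂ :=
  if p.1 < p.2 then MvPolynomial.X p.1 - MvPolynomial.X p.2 else 1

theorem vand_eq_prod : vand r = ∏ p, vandFactor p := by
  rw [vand, Fintype.prod_prod_type]
  refine (det_pow_rev MvPolynomial.X).trans (Finset.prod_congr rfl fun i _ => ?_)
  simp only [vandFactor, ← Finset.prod_filter]
  exact Finset.prod_congr (by ext j; simp only [Finset.mem_Ioi, Finset.mem_filter,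
    Finset.mem_univ, true_and]) fun _ _ => rfl

/-- The Vandermonde product without the factor of a pair `i < j`, and `0` if `j ≤ i`. -/
def vandCofactor (i j : Fin r) : MvPolynomial (Fin r) ℂ :=
  if i < j then ∏ q ∈ Finset.univ.erase (i, j), vandFactor q else 0

/-- The quotient of the Vandermonde product by `x_i - x_j`, and `0` if `i = j`. -/
def vandQuotient (i j : Fin r) : MvPolynomial (Fin r) ℂ := vandCofactor i j - vandCofactor j i

theorem vandQuotient_swap (i j : Fin r) : vandQuotient j i = -vandQuotient i j :=
  (neg_sub _ _).symm

theorem sub_mul_vandCofactor {i j : Fin r} (hij : i < j) :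
    (MvPolynomial.X i - MvPolynomial.X j) * vandCofactor i j = vand r := by
  rw [vand_eq_prod, ← Finset.mul_prod_erase _ vandFactor (Finset.mem_univ (i, j)), vandCofactor,
    vandFactor, if_pos hij, if_pos hij]

theorem sub_mul_vandQuotient {i j : Fin r} (hij : i ≠ j) :
    (MvPolynomial.X i - MvPolynomial.X j) * vandQuotient i j = vand r := by
  have hlt : ∀ {i j : Fin r}, i < j →
      (MvPolynomial.X i - MvPolynomial.X j) * vandQuotient i j = vand r := fun {i j} h => by
    rw [vandQuotient, vandCofactor.eq_def j i, if_neg h.not_gt, sub_zero, sub_mul_vandCofactor h]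
  rcases hij.lt_or_gt with h | h
  · exact hlt h
  · rw [← hlt h, vandQuotient_swap, mul_neg, ← neg_mul, neg_sub]

theorem eulerOp_vand (k : Fin r) :
    eulerOp k (vand r) = ∑ j, MvPolynomial.X k * vandQuotient k j := by
  have hterm : ∀ i j : Fin r,
      (∏ q ∈ Finset.univ.erase (i, j), vandFactor q) • eulerOp k (vandFactor (i, j))
        = (if i = k then MvPolynomial.X k * vandCofactor i j else 0)
          - if j = k then MvPolynomial.X k * vandCofactor i j else 0 := fun i j => by
    rw [vandFactor, vandCofactor, smul_eq_mul]
    by_cases hij : i < j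
    · rw [if_pos hij, if_pos hij, map_sub, eulerOp_X, eulerOp_X]
      split_ifs <;> ring
    · rw [if_neg hij, if_neg hij, Derivation.map_one_eq_zero, mul_zero, mul_zero, ite_self,
        ite_self, sub_zero]
  rw [vand_eq_prod, derivation_prod, Fintype.sum_prod_type]
  simp only [hterm, Finset.sum_sub_distrib, vandQuotient, mul_sub]
  congr 1
  · rw [Finset.sum_comm]
    simp only [Finset.sum_ite_eq', Finset.mem_univ, if_true]
  · simp only [Finset.sum_ite_eq', Finset.mem_univ, if_true]

theorem two_mul_sum_mul_sub_sum_eq {A : Type*} [CommRing A] {x d : Fin r → A}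
    {W F : Fin r → Fin r → A} {V : A} (hV : ∀ i j, i ≠ j → (x i - x j) * W i j = V)
    (hF : ∀ i j, x j * F i j = x i * F j i) (hFd : ∀ i j, F i j - F j i = d i - d j) :
    2 * ∑ k, (∑ j, x k * W k j) * d k - V * (∑ i, ∑ j, F i j - ∑ i, F i i)
      = ∑ i, ∑ j, W i j * x i * (d i + d j) := by
  have hVF : ∀ i j, V * (F i j - if i = j then F i j else 0) = W i j * (x i * (d i - d j)) :=
    fun i j => by
      rcases eq_or_ne i j with rfl | hij
      · rw [if_pos rfl, sub_self, sub_self, mul_zero, mul_zero, mul_zero]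
      · rw [if_neg hij, ← hV i j hij]
        linear_combination (-W i j) * hF i j + (W i j * x i) * hFd i j
  have hdiag : ∑ i, ∑ j, F i j - ∑ i, F i i = ∑ i, ∑ j, (F i j - if i = j then F i j else 0) := by
    simp only [Finset.sum_sub_distrib, Finset.sum_ite_eq, Finset.mem_univ, if_true]
  rw [hdiag]
  simp only [Finset.mul_sum, Finset.sum_mul, hVF, ← Finset.sum_sub_distrib]
  exact Finset.sum_congr rfl fun i _ => Finset.sum_congr rfl fun j _ => by ring

theorem sum_vandermonde_quotient_mul_eq {A : Type*} [CommRing A] [IsAddTorsionFree A]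
    {x d : Fin r → A} {W : Fin r → Fin r → A} {V : A} (hW : ∀ i j, W j i = -W i j)
    (hV : ∀ i j, i ≠ j → (x i - x j) * W i j = V) :
    ∑ i, ∑ j, W i j * x i * (d i + d j) = ((r : A) - 1) * (V * ∑ k, d k) := by
  have hswap : ∑ i, ∑ j, W i j * x i * (d i + d j) = ∑ i, ∑ j, -(W i j * x j * (d i + d j)) := by
    rw [Finset.sum_comm]
    refine Finset.sum_congr rfl fun i _ => Finset.sum_congr rfl fun j _ => ?_
    rw [hW i j]
    ring
  have hterm : ∀ i j, -(W i j * x j * (d i + d j)) + W i j * x i * (d i + d j)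
      = V * (d i + d j) - if i = j then V * (d i + d j) else 0 := fun i j => by
    rcases eq_or_ne i j with rfl | hij
    · rw [if_pos rfl]
      ring
    · rw [if_neg hij, ← hV i j hij]
      ring
  refine nsmul_right_injective two_ne_zero ?_
  beta_reduce
  rw [two_nsmul]
  conv_lhs => lhs; rw [hswap]
  simp only [← Finset.sum_add_distrib, hterm]
  simp only [Finset.sum_sub_distrib, mul_add, Finset.sum_add_distrib, Finset.sum_ite_eq,
    Finset.mem_univ, if_true, Finset.sum_const, Finset.card_univ, Fintype.card_fin,
    nsmul_eq_mul, ← Finset.mul_sum]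
  ring

end Euler

section AntisymmetricCoefficients

variable {r : ℕ}

theorem IsAntisymmetric.coeff_mapDomain {σ R : Type*} [Fintype σ] [DecidableEq σ] [CommRing R]
    {p : MvPolynomial σ R} (hp : IsAntisymmetric p) (e : Equiv.Perm σ) (α : σ →₀ ℕ) :
    MvPolynomial.coeff (α.mapDomain e) p = Equiv.Perm.sign e • MvPolynomial.coeff α p := by
  have hrename := MvPolynomial.coeff_rename_mapDomain e e.injective p α
  rw [hp e, Units.smul_def, MvPolynomial.coeff_smul] at hrename
  rw [← hrename, ← Units.smul_def, smul_smul, Int.units_mul_self, one_smul]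

theorem coeff_det_alternant (a : Fin r → ℕ) (α : Fin r →₀ ℕ) :
    MvPolynomial.coeff α (alternant r a).det
      = ∑ e : Equiv.Perm (Fin r), if α ∘ e = a then ((Equiv.Perm.sign e : ℤ) : ℂ) else 0 := by
  have hmonomial := antisymm_monomial (Finsupp.equivFunOnFinite.symm a) 1
  rw [one_smul] at hmonomial
  rw [show alternant r a = alternant r (Finsupp.equivFunOnFinite.symm a) from rfl, ← hmonomial,
    antisymm_apply, MvPolynomial.coeff_sum]
  refine Finset.sum_congr rfl fun e _ => ?_
  have hiff : (Finsupp.equivFunOnFinite.symm a).mapDomain e = α ↔ α ∘ e = a := by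
    rw [← Finsupp.equivMapDomain_eq_mapDomain, ← DFunLike.coe_fn_eq, eq_comm]
    exact Equiv.eq_comp_symm e α a
  rw [MvPolynomial.rename_monomial, Units.smul_def, MvPolynomial.coeff_smul,
    MvPolynomial.coeff_monomial, zsmul_eq_mul, mul_ite, mul_one, mul_zero]
  exact if_congr hiff rfl rfl

theorem exists_perm_of_coeff_det_alternant_ne_zero {a : Fin r → ℕ} {α : Fin r →₀ ℕ}
    (h : MvPolynomial.coeff α (alternant r a).det ≠ 0) : ∃ e : Equiv.Perm (Fin r), α ∘ e = a := by
  rw [coeff_det_alternant] at h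
  obtain ⟨e, -, he⟩ := Finset.exists_ne_zero_of_sum_ne_zero h
  exact ⟨e, by_contra fun hne => he (if_neg hne)⟩

theorem perm_eq_one_of_strictMono {e : Equiv.Perm (Fin r)} (he : StrictMono e) : e = 1 :=
  Equiv.ext (congrFun ((he.range_inj strictMono_id).1
    (by rw [e.surjective.range_eq, Set.range_id])))

theorem coeff_det_alternant_of_strictAnti {a : Fin r → ℕ} (ha : StrictAnti a)
    {α : Fin r →₀ ℕ} (hα : StrictAnti α) :
    MvPolynomial.coeff α (alternant r a).det = if α = a then 1 else 0 := by
  rw [coeff_det_alternant, Finset.sum_eq_single 1]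
  · rw [Equiv.Perm.sign_one, Units.val_one, Int.cast_one]
    rfl
  · intro e _ he
    refine if_neg fun heq => he (perm_eq_one_of_strictMono fun i j hij => ?_)
    exact hα.lt_iff_gt.1 (by simpa only [← heq, Function.comp_apply] using ha hij)
  · exact fun h => absurd (Finset.mem_univ _) h

theorem IsAntisymmetric.eq_zero {R : Type*} [CommRing R] [IsAddTorsionFree R]
    {p : MvPolynomial (Fin r) R} (hp : IsAntisymmetric p)
    (h : ∀ α : Fin r →₀ ℕ, StrictAnti α → MvPolynomial.coeff α p = 0) : p = 0 := by
  refine MvPolynomial.ext _ _ fun α => ?_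
  rw [MvPolynomial.coeff_zero]
  by_cases hinj : Function.Injective α
  · let e := Tuple.sort (OrderDual.toDual ∘ α)
    have hanti : Antitone (α ∘ e) := (Tuple.monotone_sort (OrderDual.toDual ∘ α)).dual_right
    have hsorted := h (α.mapDomain e.symm) (by
      rw [← Finsupp.equivMapDomain_eq_mapDomain]
      exact hanti.strictAnti_of_injective (hinj.comp e.injective))
    rw [hp.coeff_mapDomain] at hsorted
    exact (smul_eq_zero_iff_eq _).1 hsorted
  · obtain ⟨i, j, hij, hne⟩ := Function.not_injective_iff.1 hinj
    have hswap := hp.coeff_mapDomain (Equiv.swap i j) α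
    rw [← Finsupp.equivMapDomain_eq_mapDomain, show α.equivMapDomain (Equiv.swap i j) = α from
      DFunLike.coe_injective (comp_swap_eq_self hij), Equiv.Perm.sign_swap hne, Units.neg_smul,
      one_smul] at hswap
    exact self_eq_neg.1 hswap

end AntisymmetricCoefficients

/-! ### The Weyl character formula -/

section Weyl

variable {r : ℕ}

/-- The homogeneous polynomial of degree `n` with coefficients given by `c`. -/
def genPoly (n : ℕ) (c : (Fin r → ℕ) → ℂ) : MvPolynomial (Fin r) ℂ :=
  ∑ μ ∈ Finset.univ.piAntidiag n, MvPolynomial.monomial (Finsupp.equivFunOnFinite.symm μ) (c μ)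

theorem coeff_genPoly (n : ℕ) (c : (Fin r → ℕ) → ℂ) (α : Fin r →₀ ℕ) :
    MvPolynomial.coeff α (genPoly n c) = if ∑ i, α i = n then c α else 0 := by
  simp only [genPoly, MvPolynomial.coeff_sum, MvPolynomial.coeff_monomial, Equiv.symm_apply_eq]
  rw [Finset.sum_ite_eq']
  simp only [Finset.mem_piAntidiag, Finset.mem_univ, implies_true, and_true,
    Finsupp.equivFunOnFinite_apply]
  rfl

/-- The character of `S^ν(ℂ^r)`. -/
def schurCharacter (ν : Fin r → ℕ) : MvPolynomial (Fin r) ℂ :=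
  genPoly (∑ i, ν i) fun μ => weightMult ν μ

variable {ν : Fin r → ℕ}

theorem coeff_schurCharacter (α : Fin r →₀ ℕ) :
    MvPolynomial.coeff α (schurCharacter ν) = weightMult ν α := by
  rw [schurCharacter, coeff_genPoly, ite_eq_left_iff]
  intro h
  have hzero := not_not.1 (mt sum_eq_of_contentDim_ne_zero h)
  rw [weightMult_eq_contentDim, hzero, Nat.cast_zero]

theorem isSymmetric_schurCharacter (ν : Fin r → ℕ) : (schurCharacter ν).IsSymmetric := by
  intro e
  refine MvPolynomial.ext _ _ fun α => ?_
  obtain ⟨β, rfl⟩ := (Finsupp.domCongr e).surjective α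
  rw [Finsupp.domCongr_apply, Finsupp.equivMapDomain_eq_mapDomain,
    MvPolynomial.coeff_rename_mapDomain _ e.injective, coeff_schurCharacter,
    coeff_schurCharacter, ← Finsupp.equivMapDomain_eq_mapDomain]
  exact congrArg Nat.cast (weightMult_comp ν β e.symm).symm

/-- The generating polynomial of the traces of `E_{ij} E_{ji}` on the weight spaces of
`S^ν(ℂ^r)`. -/
def tracePoly (ν : Fin r → ℕ) (i j : Fin r) : MvPolynomial (Fin r) ℂ :=
  genPoly (∑ i, ν i) (elemTrace (elemAct_mem_range_youngOp (ν := ν)) i j)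

theorem coeff_X_mul_tracePoly_eq_zero {i j : Fin r} {α : Fin r →₀ ℕ}
    (h : ¬Finsupp.single i 1 + Finsupp.single j 1 ≤ α) :
    MvPolynomial.coeff α (MvPolynomial.X j * tracePoly ν i j) = 0 := by
  rw [MvPolynomial.coeff_X_mul', ite_eq_right_iff]
  intro hj
  have hi : (α - Finsupp.single j 1 : Fin r →₀ ℕ) i = 0 := by
    by_contra hi
    have hle : Finsupp.single j 1 ≤ α :=
      Finsupp.single_le_iff.2 (Nat.one_le_iff_ne_zero.2 (Finsupp.mem_support_iff.1 hj))
    exact h (add_le_of_le_tsub_right_of_le hle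
      (Finsupp.single_le_iff.2 (Nat.one_le_iff_ne_zero.2 hi)))
  rw [tracePoly, coeff_genPoly, elemTrace_eq_zero _ _ _ hi, ite_self]

theorem coeff_tracePoly_add_single (i j : Fin r) (κ : Fin r →₀ ℕ) :
    MvPolynomial.coeff (κ + Finsupp.single i 1) (tracePoly ν i j)
      = if ∑ k, κ k + 1 = ∑ k, ν k then
          elemTrace (elemAct_mem_range_youngOp (ν := ν)) i j (⇑κ + Pi.single i 1) else 0 := by
  rw [tracePoly, coeff_genPoly, Finsupp.coe_add, Finsupp.single_eq_pi_single]
  simp only [Pi.add_apply, Finset.sum_add_distrib, Finset.sum_pi_single', Finset.mem_univ, if_true]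

theorem X_mul_tracePoly (i j : Fin r) :
    MvPolynomial.X j * tracePoly ν i j = MvPolynomial.X i * tracePoly ν j i := by
  refine MvPolynomial.ext _ _ fun α => ?_
  by_cases h : Finsupp.single i 1 + Finsupp.single j 1 ≤ α
  · obtain ⟨κ, rfl⟩ := exists_add_of_le h
    have hi : Finsupp.single i 1 + Finsupp.single j 1 + κ
        = Finsupp.single j 1 + (κ + Finsupp.single i 1) := by abel
    have hj : Finsupp.single i 1 + Finsupp.single j 1 + κ
        = Finsupp.single i 1 + (κ + Finsupp.single j 1) := by abel
    rw [hi, MvPolynomial.coeff_X_mul, ← hi, hj, MvPolynomial.coeff_X_mul,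
      coeff_tracePoly_add_single, coeff_tracePoly_add_single, elemTrace_add_single]
  · rw [coeff_X_mul_tracePoly_eq_zero h, coeff_X_mul_tracePoly_eq_zero (by rwa [add_comm])]

theorem tracePoly_sub (i j : Fin r) : tracePoly ν i j - tracePoly ν j i
    = eulerOp i (schurCharacter ν) - eulerOp j (schurCharacter ν) := by
  refine MvPolynomial.ext _ _ fun α => ?_
  rw [MvPolynomial.coeff_sub, MvPolynomial.coeff_sub, coeff_eulerOp, coeff_eulerOp, ← sub_mul,
    tracePoly, tracePoly, schurCharacter, coeff_genPoly, coeff_genPoly, coeff_genPoly]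
  split_ifs
  · rw [elemTrace_sub, weightMult_eq_contentDim]
  · rw [sub_zero, mul_zero]

/-- The operator `∑_k (x_k ∂/∂x_k)^2`. -/
def eulerSq (p : MvPolynomial (Fin r) ℂ) : MvPolynomial (Fin r) ℂ :=
  ∑ k, eulerOp k (eulerOp k p)

theorem coeff_eulerSq (p : MvPolynomial (Fin r) ℂ) (α : Fin r →₀ ℕ) :
    MvPolynomial.coeff α (eulerSq p) = (∑ k, (α k : ℂ) ^ 2) * MvPolynomial.coeff α p := by
  rw [eulerSq, MvPolynomial.coeff_sum, Finset.sum_mul]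
  exact Finset.sum_congr rfl fun k _ => by rw [coeff_eulerOp, coeff_eulerOp, sq, mul_assoc]

theorem sum_tracePoly_self :
    ∑ i, tracePoly ν i i = eulerSq (schurCharacter ν) := by
  refine MvPolynomial.ext _ _ fun α => ?_
  rw [coeff_eulerSq, MvPolynomial.coeff_sum, Finset.sum_mul]
  refine Finset.sum_congr rfl fun i _ => ?_
  rw [tracePoly, schurCharacter, coeff_genPoly, coeff_genPoly, elemTrace_self, mul_ite, mul_zero,
    weightMult_eq_contentDim]

theorem exists_sum_tracePoly_eq (hν : Antitone ν) : ∃ z : ℂ, ∑ i, ∑ j, tracePoly ν i j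
    = MvPolynomial.C z * schurCharacter ν := by
  obtain ⟨z, hz⟩ := exists_swapSum_eq_smul hν
  refine ⟨((Fintype.card (Fin r) : ℂ) - 1) * Fintype.card (Boxes ν) + z,
    MvPolynomial.ext _ _ fun α => ?_⟩
  simp only [MvPolynomial.coeff_sum, tracePoly, schurCharacter, coeff_genPoly,
    MvPolynomial.coeff_C_mul]
  split_ifs
  · rw [sum_elemTrace _ hz, weightMult_eq_contentDim]
  · simp only [Finset.sum_const_zero, mul_zero]

theorem sum_eulerOp_schurCharacter : ∑ k, eulerOp k (schurCharacter ν)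
    = MvPolynomial.C (∑ i, (ν i : ℂ)) * schurCharacter ν := by
  refine MvPolynomial.ext _ _ fun α => ?_
  simp only [MvPolynomial.coeff_C_mul, MvPolynomial.coeff_sum, coeff_eulerOp]
  rw [← Finset.sum_mul, schurCharacter, coeff_genPoly]
  split_ifs with h
  · rw [← Nat.cast_sum, ← Nat.cast_sum, h]
  · rw [mul_zero, mul_zero]

theorem eulerSq_vand (r : ℕ) :
    eulerSq (vand r) = MvPolynomial.C (∑ i : Fin r, ((i.rev : ℕ) : ℂ) ^ 2) * vand r := by
  refine MvPolynomial.ext _ _ fun α => ?_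
  rw [coeff_eulerSq, MvPolynomial.coeff_C_mul]
  by_cases h : MvPolynomial.coeff α (vand r) = 0
  · rw [h, mul_zero, mul_zero]
  · obtain ⟨e, he⟩ := exists_perm_of_coeff_det_alternant_ne_zero h
    rw [← Equiv.sum_comp e fun k => (α k : ℂ) ^ 2]
    simp only [← congrFun he, Function.comp_apply]

theorem eulerSq_mul (p q : MvPolynomial (Fin r) ℂ) :
    eulerSq (p * q) = eulerSq p * q + 2 * ∑ k, eulerOp k p * eulerOp k q + p * eulerSq q := by
  simp only [eulerSq, Finset.mul_sum, Finset.sum_mul, ← Finset.sum_add_distrib]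
  refine Finset.sum_congr rfl fun k _ => ?_
  simp only [Derivation.leibniz, map_add, smul_eq_mul]
  ring

theorem exists_eulerSq_vand_mul_schurCharacter_eq (hν : Antitone ν) :
    ∃ κ : ℂ, eulerSq (vand r * schurCharacter ν)
      = MvPolynomial.C κ * (vand r * schurCharacter ν) := by
  obtain ⟨z, hz⟩ := exists_sum_tracePoly_eq hν
  have : IsAddTorsionFree (MvPolynomial (Fin r) ℂ) := .of_isTorsionFree ℂ _
  have hcross : 2 * ∑ k, eulerOp k (vand r) * eulerOp k (schurCharacter ν)
      - vand r * (MvPolynomial.C z * schurCharacter ν - eulerSq (schurCharacter ν))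
      = ((r : MvPolynomial (Fin r) ℂ) - 1) *
        (vand r * (MvPolynomial.C (∑ i, (ν i : ℂ)) * schurCharacter ν)) := by
    rw [← hz, ← sum_tracePoly_self, ← sum_eulerOp_schurCharacter,
      ← sum_vandermonde_quotient_mul_eq (fun i j => vandQuotient_swap i j)
        fun i j => sub_mul_vandQuotient,
      ← two_mul_sum_mul_sub_sum_eq (fun i j => sub_mul_vandQuotient) X_mul_tracePoly tracePoly_sub]
    simp only [eulerOp_vand]
  refine ⟨∑ i : Fin r, ((i.rev : ℕ) : ℂ) ^ 2 + z + ((r : ℂ) - 1) * ∑ i, (ν i : ℂ), ?_⟩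
  rw [eulerSq_mul, eulerSq_vand]
  simp only [map_add, map_mul, map_sub, map_natCast, map_one]
  linear_combination hcross

theorem sum_sq_eq_of_coeff_ne_zero {κ : ℂ} {p : MvPolynomial (Fin r) ℂ}
    (hp : eulerSq p = MvPolynomial.C κ * p) {α : Fin r →₀ ℕ} (h : MvPolynomial.coeff α p ≠ 0) :
    ∑ k, (α k : ℂ) ^ 2 = κ := by
  have hcoeff := congrArg (MvPolynomial.coeff α) hp
  rw [coeff_eulerSq, MvPolynomial.coeff_C_mul] at hcoeff
  exact mul_right_cancel₀ h hcoeff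

theorem strictAnti_rev (r : ℕ) : StrictAnti fun i : Fin r => (i.rev : ℕ) := fun _ _ hij =>
  Fin.lt_def.1 (Fin.rev_lt_rev.2 hij)

theorem dominatedBy_rev_of_coeff_vand_ne_zero {β : Fin r →₀ ℕ}
    (h : MvPolynomial.coeff β (vand r) ≠ 0) : DominatedBy β fun i => (i.rev : ℕ) := by
  obtain ⟨e, he⟩ := exists_perm_of_coeff_det_alternant_ne_zero h
  rw [(Equiv.eq_comp_symm e _ _).2 he]
  exact dominatedBy_comp_perm_of_antitone (strictAnti_rev r).antitone e.symm

theorem dominatedBy_of_coeff_schurCharacter_ne_zero (hν : Antitone ν) {γ : Fin r →₀ ℕ}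
    (h : MvPolynomial.coeff γ (schurCharacter ν) ≠ 0) : DominatedBy γ ν := by
  rw [coeff_schurCharacter, weightMult_eq_contentDim, Nat.cast_ne_zero] at h
  exact dominatedBy_of_contentDim_ne_zero hν h

theorem coeff_vand_rev (r : ℕ) :
    MvPolynomial.coeff (Finsupp.equivFunOnFinite.symm fun i => (i.rev : ℕ)) (vand r) = 1 := by
  rw [vand, coeff_det_alternant_of_strictAnti (strictAnti_rev r) (strictAnti_rev r)]
  exact if_pos rfl

theorem coeff_schurCharacter_self (hν : Antitone ν) :
    MvPolynomial.coeff (Finsupp.equivFunOnFinite.symm ν) (schurCharacter ν) = 1 := by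
  rw [coeff_schurCharacter, weightMult_eq_contentDim]
  exact congrArg Nat.cast (contentDim_self hν) |>.trans Nat.cast_one

theorem coeff_vand_mul_schurCharacter_top (hν : Antitone ν) :
    MvPolynomial.coeff (Finsupp.equivFunOnFinite.symm ((fun i => (i.rev : ℕ)) + ν))
      (vand r * schurCharacter ν) = 1 := by
  rw [MvPolynomial.coeff_mul, Finset.sum_eq_single
    (Finsupp.equivFunOnFinite.symm fun i => (i.rev : ℕ), Finsupp.equivFunOnFinite.symm ν)]
  · rw [coeff_vand_rev, coeff_schurCharacter_self hν, mul_one]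
  · rintro ⟨β, γ⟩ hβγ hne
    rw [Finset.HasAntidiagonal.mem_antidiagonal] at hβγ
    by_contra hcoeff
    obtain ⟨hβ, hγ⟩ := mul_ne_zero_iff.1 hcoeff
    obtain ⟨hβ, hγ⟩ := (dominatedBy_rev_of_coeff_vand_ne_zero hβ).eq_and_eq_of_add_eq
      (dominatedBy_of_coeff_schurCharacter_ne_zero hν hγ) (congrArg DFunLike.coe hβγ)
    exact hne (Prod.ext (DFunLike.coe_injective hβ) (DFunLike.coe_injective hγ))
  · refine fun h => absurd (Finset.HasAntidiagonal.mem_antidiagonal.2 ?_) h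
    ext i
    rfl

theorem dominatedBy_of_coeff_vand_mul_schurCharacter_ne_zero (hν : Antitone ν) {α : Fin r →₀ ℕ}
    (h : MvPolynomial.coeff α (vand r * schurCharacter ν) ≠ 0) :
    DominatedBy α ((fun i => (i.rev : ℕ)) + ν) := by
  rw [MvPolynomial.coeff_mul] at h
  obtain ⟨⟨β, γ⟩, hβγ, hne⟩ := Finset.exists_ne_zero_of_sum_ne_zero h
  obtain ⟨hβ, hγ⟩ := mul_ne_zero_iff.1 hne
  rw [← Finset.HasAntidiagonal.mem_antidiagonal.1 hβγ]
  exact (dominatedBy_rev_of_coeff_vand_ne_zero hβ).add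
    (dominatedBy_of_coeff_schurCharacter_ne_zero hν hγ)

theorem eq_of_coeff_vand_mul_schurCharacter_ne_zero (hν : Antitone ν) {α : Fin r →₀ ℕ}
    (hα : Antitone α) (h : MvPolynomial.coeff α (vand r * schurCharacter ν) ≠ 0) :
    (α : Fin r → ℕ) = (fun i => (i.rev : ℕ)) + ν := by
  obtain ⟨κ, hκ⟩ := exists_eulerSq_vand_mul_schurCharacter_eq hν
  have htop := sum_sq_eq_of_coeff_ne_zero hκ
    ((coeff_vand_mul_schurCharacter_top hν).trans_ne one_ne_zero)
  have hsq := (sum_sq_eq_of_coeff_ne_zero hκ h).trans htop.symm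
  exact (dominatedBy_of_coeff_vand_mul_schurCharacter_ne_zero hν h).eq_of_sum_sq_eq hα
    (mod_cast hsq)

theorem vand_mul_schurCharacter (hν : Antitone ν) :
    vand r * schurCharacter ν = (alternant r fun j => ν j + (j.rev : ℕ)).det := by
  have hexponents : (fun j => ν j + (j.rev : ℕ)) = (fun j : Fin r => (j.rev : ℕ)) + ν :=
    add_comm ν fun j => (j.rev : ℕ)
  have hanti : StrictAnti ((fun j : Fin r => (j.rev : ℕ)) + ν) := fun i j hij =>
    add_lt_add_of_lt_of_le (strictAnti_rev r hij) (hν hij.le)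
  rw [hexponents, ← sub_eq_zero]
  refine (((isAntisymmetric_vand r).mul (isSymmetric_schurCharacter ν)).sub
    (isAntisymmetric_det_alternant _)).eq_zero fun α hα => ?_
  rw [MvPolynomial.coeff_sub, coeff_det_alternant_of_strictAnti hanti hα, sub_eq_zero]
  split_ifs with h
  · rw [← coeff_vand_mul_schurCharacter_top hν, ← h, Finsupp.equivFunOnFinite_symm_coe]
  · exact not_not.1 (mt (eq_of_coeff_vand_mul_schurCharacter_ne_zero hν hα.antitone) h)

end Weyl

/-! ### Determinants of exponential series -/

section ExpDeterminant

variable {r : ℕ}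

theorem sum_card_Ioi (r : ℕ) : ∑ i : Fin r, (Finset.Ioi i).card = r.choose 2 := by
  have hcard (i : Fin r) : (Finset.Ioi i).card = (i.rev : ℕ) := by
    rw [Fin.card_Ioi, Fin.val_rev]
    omega
  simp only [hcard]
  rw [sum_rev, Finset.sum_range_id, Nat.choose_two_right]

theorem sum_sum_Ioi_add {R M : Type*} [Ring R] [AddCommGroup M] [Module R M] (x : Fin r → M) :
    ∑ i, ∑ j ∈ Finset.Ioi i, (x i + x j) = ((r : R) - 1) • ∑ i, x i := by
  rw [Finset.sum_sum_Ioi_add_eq_sum_sum_off_diag fun _ i => x i, Finset.smul_sum]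
  refine Finset.sum_congr rfl fun i _ => ?_
  rw [Finset.sum_const, Finset.card_compl, Finset.card_singleton, Fintype.card_fin,
    ← Nat.cast_smul_eq_nsmul R, Nat.cast_sub i.pos, Nat.cast_one]

variable {A : Type*} [CommRing A] [Algebra ℂ A] (x : Fin r → A)

theorem prod_prod_Ioi_scaledSeries {φ : ℂ⟦X⟧} (hφ : PowerSeries.constantCoeff φ = 1) :
    ∏ i, ∏ j ∈ Finset.Ioi i, scaledSeries (x i - x j) φ * scaledSeries (x j - x i) φ
      = ∏ p : Fin r × Fin r, scaledSeries (x p.1 - x p.2) φ := by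
  rw [Finset.prod_prod_Ioi_mul_eq_prod_prod_off_diag (fun a b => scaledSeries (x b - x a) φ),
    Fintype.prod_prod_type]
  refine Finset.prod_congr rfl fun i _ => Finset.prod_subset (Finset.subset_univ _) fun j _ hj => ?_
  obtain rfl : j = i := by simpa using hj
  rw [sub_self, scaledSeries_zero, hφ, map_one, map_one]

theorem prod_prod_Ioi_expSeries_add (c : ℂ) :
    ∏ i, ∏ j ∈ Finset.Ioi i, expSeries (c • (x i + x j))
      = expSeries ((((r : ℂ) - 1) * c) • ∑ i, x i) := by
  simp only [← expSeries_sum, ← Finset.smul_sum]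
  rw [sum_sum_Ioi_add (R := ℂ), smul_smul, mul_comm]

theorem prod_prod_Ioi_const {M : Type*} [CommMonoid M] (c : M) :
    ∏ i : Fin r, ∏ _j ∈ Finset.Ioi i, c = c ^ r.choose 2 := by
  simp only [Finset.prod_const]
  rw [Finset.prod_pow_eq_pow_sum, sum_card_Ioi]

theorem det_expSeries_pow_rev :
    (Matrix.of fun i j : Fin r =>
        expSeries ((2 * Real.pi * Complex.I : ℂ) • x i) ^ (j.rev : ℕ)).det
      = (2 * Real.pi * Complex.I : ℂ) ^ r.choose 2 • (PowerSeries.X ^ r.choose 2 *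
        PowerSeries.C (Matrix.of fun i j : Fin r => x i ^ (j.rev : ℕ)).det *
        (∏ p : Fin r × Fin r, scaledSeries (x p.1 - x p.2) gammaSeries⁻¹) *
        expSeries ((((r : ℂ) - 1) * (Real.pi * Complex.I)) • ∑ i, x i)) := by
  rw [det_pow_rev, det_pow_rev, Algebra.smul_def, map_pow, PowerSeries.algebraMap_apply,
    ← prod_prod_Ioi_scaledSeries x constantCoeff_gammaSeries_inv, ← prod_prod_Ioi_expSeries_add]
  simp only [expSeries_sub_expSeries, Finset.prod_mul_distrib, prod_prod_Ioi_const, map_prod]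
  ring

end ExpDeterminant

/-! ### Graded symmetric series -/

section Graded

variable {r N : ℕ}

/-- The series whose coefficient of degree `d` is homogeneous of degree `d`: the generating series
of the graded pieces of a class. -/
def gradedSeries (σ R : Type*) [CommRing R] : Subalgebra R (MvPolynomial σ R)⟦X⟧ where
  carrier := {u | ∀ d, (PowerSeries.coeff d u).IsHomogeneous d}
  add_mem' hu hv d := by
    rw [map_add]
    exact (hu d).add (hv d)
  mul_mem' hu hv d := by
    rw [PowerSeries.coeff_mul]
    refine MvPolynomial.IsHomogeneous.sum _ _ _ fun p hp => ?_
    rw [← Finset.HasAntidiagonal.mem_antidiagonal.1 hp]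
    exact (hu p.1).mul (hv p.2)
  algebraMap_mem' c d := by
    rw [PowerSeries.algebraMap_apply, PowerSeries.coeff_C]
    split_ifs with h
    · rw [h]
      exact MvPolynomial.isHomogeneous_C _ _
    · exact MvPolynomial.isHomogeneous_zero _ _ _

theorem scaledSeries_mem_gradedSeries {σ : Type*} {a : MvPolynomial σ ℂ} (ha : a.IsHomogeneous 1)
    (φ : ℂ⟦X⟧) : scaledSeries a φ ∈ gradedSeries σ ℂ := fun d => by
  rw [coeff_scaledSeries, MvPolynomial.smul_eq_C_mul]
  simpa only [one_mul] using (ha.pow d).C_mul (PowerSeries.coeff d φ)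

theorem isHomogeneous_smul_X {σ R : Type*} [CommRing R] (c : R) (i : σ) :
    (c • MvPolynomial.X i : MvPolynomial σ R).IsHomogeneous 1 := by
  rw [MvPolynomial.smul_eq_C_mul]
  exact MvPolynomial.isHomogeneous_C_mul_X c i

/-- The generating series of a symmetric polynomial in the Chern roots, graded by degree. -/
structure IsGradedSymmetric {σ R : Type*} [CommRing R] (u : (MvPolynomial σ R)⟦X⟧) : Prop where
  mem_gradedSeries : u ∈ gradedSeries σ R
  isSymmetricSeries : IsSymmetricSeries u

namespace IsGradedSymmetric

theorem mul {σ R : Type*} [CommRing R] {u v : (MvPolynomial σ R)⟦X⟧} (hu : IsGradedSymmetric u)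
    (hv : IsGradedSymmetric v) : IsGradedSymmetric (u * v) :=
  ⟨mul_mem hu.1 hv.1, hu.2.mul hv.2⟩

theorem smul {σ R : Type*} [CommRing R] {u : (MvPolynomial σ R)⟦X⟧} (hu : IsGradedSymmetric u)
    (c : R) : IsGradedSymmetric (c • u) :=
  ⟨Subalgebra.smul_mem _ hu.1 c, fun e => by
    change PowerSeries.mapAlgHom (MvPolynomial.rename e) (c • u) = c • u
    rw [map_smul, PowerSeries.mapAlgHom_apply, hu.2 e]⟩

variable {u v : (MvPolynomial (Fin r) ℂ)⟦X⟧}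

theorem toFlagRing_coeff_eq_zero (hu : IsGradedSymmetric u) (hrN : r ≤ N) {d : ℕ}
    (hd : r * (N - r) < d) : toFlagRing r N (PowerSeries.coeff d u) = 0 :=
  Ideal.Quotient.eq_zero_iff_mem.2
    (mem_flagIdeal_of_isSymmetric hrN (hu.2.isSymmetric_coeff d) (hu.1 d) hd)

theorem toFlagRing_coeffSum_mul (hu : IsGradedSymmetric u) (hv : IsGradedSymmetric v)
    (hrN : r ≤ N) :
    toFlagRing r N (coeffSum (r * (N - r)) (u * v))
      = toFlagRing r N (coeffSum (r * (N - r)) u) * toFlagRing r N (coeffSum (r * (N - r)) v) := by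
  have hmap (w : (MvPolynomial (Fin r) ℂ)⟦X⟧) : toFlagRing r N (coeffSum (r * (N - r)) w)
      = coeffSum (r * (N - r)) (PowerSeries.map (toFlagRing r N : _ →+* FlagRing r N) w) :=
    (coeffSum_map _ _ w).symm
  rw [hmap, hmap, hmap, map_mul]
  refine coeffSum_mul _ _ _ fun i j hij => ?_
  rw [PowerSeries.coeff_map, PowerSeries.coeff_map, ← map_mul]
  exact Ideal.Quotient.eq_zero_iff_mem.2 (mem_flagIdeal_of_isSymmetric hrN
    (MvPolynomial.IsSymmetric.mul (hu.2.isSymmetric_coeff i) (hv.2.isSymmetric_coeff j))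
    ((hu.1 i).mul (hv.1 j)) hij)

end IsGradedSymmetric

theorem isGradedSymmetric_gammaRatio (r N : ℕ) : IsGradedSymmetric (gammaRatio r N) where
  mem_gradedSeries := mul_mem
    (prod_mem fun i _ => pow_mem
      (scaledSeries_mem_gradedSeries (MvPolynomial.isHomogeneous_X ℂ i) _) _)
    (prod_mem fun p _ => scaledSeries_mem_gradedSeries
      ((MvPolynomial.isHomogeneous_X ℂ p.1).sub (MvPolynomial.isHomogeneous_X ℂ p.2)) _)
  isSymmetricSeries e := by
    rw [gammaRatio, map_mul, map_prod, map_prod]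
    simp only [map_pow, map_scaledSeries, map_sub, MvPolynomial.rename_X]
    congr 1
    · exact Equiv.prod_comp e fun i =>
        scaledSeries (MvPolynomial.X i : MvPolynomial (Fin r) ℂ) gammaSeries ^ N
    · exact Equiv.prod_comp (Equiv.prodCongr e e) fun p : Fin r × Fin r => scaledSeries
        (MvPolynomial.X p.1 - MvPolynomial.X p.2 : MvPolynomial (Fin r) ℂ) gammaSeries⁻¹

theorem isGradedSymmetric_expSeries_smul_sum_X {σ : Type*} [Fintype σ] (c : ℂ) :
    IsGradedSymmetric (expSeries (c • ∑ i, (MvPolynomial.X i : MvPolynomial σ ℂ))) where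
  mem_gradedSeries := scaledSeries_mem_gradedSeries (by
    rw [Finset.smul_sum]
    exact MvPolynomial.IsHomogeneous.sum _ _ _ fun i _ => isHomogeneous_smul_X c i) _
  isSymmetricSeries e := by
    rw [map_expSeries, map_smul, map_sum]
    simp only [MvPolynomial.rename_X]
    rw [Equiv.sum_comp e fun i => (MvPolynomial.X i : MvPolynomial σ ℂ)]

/-- The series `e^{2πi x_i t}`. -/
def rootExp {σ : Type*} (i : σ) : (MvPolynomial σ ℂ)⟦X⟧ :=
  expSeries ((2 * Real.pi * Complex.I : ℂ) • MvPolynomial.X i)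

theorem map_rename_rootExp {σ : Type*} (e : Equiv.Perm σ) (i : σ) :
    PowerSeries.mapAlgHom (MvPolynomial.rename e : MvPolynomial σ ℂ →ₐ[ℂ] MvPolynomial σ ℂ)
      (rootExp i) = rootExp (e i) := by
  rw [PowerSeries.mapAlgHom_apply, rootExp, rootExp, map_expSeries, map_smul,
    MvPolynomial.rename_X]

/-- The Chern character series of `S^ν V^*`. -/
def chSeries (ν : Fin r → ℕ) : (MvPolynomial (Fin r) ℂ)⟦X⟧ :=
  MvPolynomial.aeval rootExp (schurCharacter ν)

theorem chSeries_eq_sum (ν : Fin r → ℕ) : chSeries ν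
    = ∑ μ ∈ Finset.piAntidiag (Finset.univ : Finset (Fin r)) (∑ i, ν i),
      (weightMult ν μ : ℂ) • ∏ i, rootExp i ^ μ i := by
  rw [chSeries, schurCharacter, genPoly, map_sum]
  refine Finset.sum_congr rfl fun μ _ => ?_
  rw [MvPolynomial.aeval_monomial, ← Algebra.smul_def,
    Finsupp.prod_fintype _ _ fun i => pow_zero _]
  rfl

theorem isGradedSymmetric_chSeries (ν : Fin r → ℕ) : IsGradedSymmetric (chSeries ν) where
  mem_gradedSeries := by
    rw [chSeries_eq_sum]
    exact sum_mem fun μ _ => Subalgebra.smul_mem _ (prod_mem fun i _ => pow_mem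
      (scaledSeries_mem_gradedSeries (isHomogeneous_smul_X _ i) _) _) _
  isSymmetricSeries e := by
    change PowerSeries.mapAlgHom (MvPolynomial.rename e) (chSeries ν) = chSeries ν
    rw [chSeries, MvPolynomial.comp_aeval_apply]
    simp only [map_rename_rootExp]
    conv_rhs => rw [← isSymmetric_schurCharacter ν e, MvPolynomial.aeval_rename]
    rfl

theorem chSchurPoly_eq_coeffSum (ν : Fin r → ℕ) (D : ℕ) :
    chSchurPoly ν D = coeffSum D (chSeries ν) := by
  rw [chSchurPoly, chSeries_eq_sum, map_sum]
  refine Finset.sum_congr rfl fun μ _ => ?_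
  have hweight : (2 * Real.pi * Complex.I : ℂ) • ∑ i, (μ i : ℂ) • (MvPolynomial.X i :
      MvPolynomial (Fin r) ℂ) = ∑ i, μ i • ((2 * Real.pi * Complex.I : ℂ) • MvPolynomial.X i) := by
    rw [Finset.smul_sum]
    exact Finset.sum_congr rfl fun i _ => by rw [smul_comm, Nat.cast_smul_eq_nsmul]
  rw [LinearMap.map_smul_of_tower, truncExp_eq_coeffSum, hweight, expSeries_sum]
  simp only [expSeries_nsmul]
  rfl

end Graded

section EventualCoeffSum

variable {B : Type*} [CommRing B]

theorem eventually_coeffSum_coe (q : Polynomial B) :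
    ∀ᶠ E in Filter.atTop, coeffSum E (q : B⟦X⟧) = q.eval 1 := by
  filter_upwards [Filter.eventually_ge_atTop q.natDegree] with E hE
  rw [coeffSum_apply, Polynomial.eval_eq_sum_range' (Nat.lt_succ_of_le hE)]
  simp only [Polynomial.coeff_coe, one_pow, mul_one]

theorem exists_polynomial_coe_eq {u : B⟦X⟧} {D : ℕ}
    (hu : ∀ d, D < d → PowerSeries.coeff d u = 0) :
    ∃ q : Polynomial B, (q : B⟦X⟧) = u ∧ q.eval 1 = coeffSum D u := by
  refine ⟨PowerSeries.trunc (D + 1) u, ?_, ?_⟩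
  · ext d
    rw [Polynomial.coeff_coe, PowerSeries.coeff_trunc]
    split_ifs with h
    · rfl
    · exact (hu d (by omega)).symm
  · rw [coeffSum_apply, Polynomial.eval, PowerSeries.eval₂_trunc_eq_sum_range]
    simp only [RingHom.id_apply, one_pow, mul_one]

theorem eventually_coeffSum_det {n : Type*} [Fintype n] [DecidableEq n]
    (M : Matrix n n B⟦X⟧) {D : ℕ} (hM : ∀ i j d, D < d → PowerSeries.coeff d (M i j) = 0) :
    ∀ᶠ E in Filter.atTop, coeffSum E M.det = (M.map (coeffSum D)).det := by
  choose P hcoe heval using fun i j => exists_polynomial_coe_eq (hM i j)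
  have hM : M = (Polynomial.coeToPowerSeries.ringHom (R := B)).mapMatrix (Matrix.of P) :=
    Matrix.ext fun i j => (hcoe i j).symm
  have hsum : M.map (coeffSum D) = (Polynomial.evalRingHom 1).mapMatrix (Matrix.of P) :=
    Matrix.ext fun i j => (heval i j).symm
  rw [hsum, ← RingHom.map_det, hM, ← RingHom.map_det]
  exact eventually_coeffSum_coe _

theorem eventually_coeffSum_X_pow_mul {u : B⟦X⟧} {D : ℕ}
    (hu : ∀ d, D < d → PowerSeries.coeff d u = 0) (k : ℕ) :
    ∀ᶠ E in Filter.atTop, coeffSum E (PowerSeries.X ^ k * u) = coeffSum D u := by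
  obtain ⟨q, rfl, heval⟩ := exists_polynomial_coe_eq hu
  have h := eventually_coeffSum_coe (Polynomial.X ^ k * q)
  simpa only [Polynomial.coe_mul, Polynomial.coe_pow, Polynomial.coe_X, Polynomial.eval_mul,
    Polynomial.eval_pow, Polynomial.eval_X, one_pow, one_mul, heval] using h

end EventualCoeffSum

/-! ### Gamma classes as sums of coefficients -/

section GammaClass

variable {r N : ℕ}

theorem coeffSum_scaledSeries_map {A B : Type*} [CommRing A] [Algebra ℂ A] [CommRing B]
    [Algebra ℂ B] (F : A →ₐ[ℂ] B) (D : ℕ) (a : A) (φ : ℂ⟦X⟧) :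
    coeffSum D (scaledSeries (F a) φ) = F (coeffSum D (scaledSeries a φ)) := by
  rw [← map_scaledSeries F, coeffSum_map, RingHom.coe_coe]

theorem toFlagRing_X_pow_eq_zero (i : Fin r) {k : ℕ} (hk : N ≤ k) :
    toFlagRing r N (MvPolynomial.X i) ^ k = 0 := by
  rw [← map_pow]
  exact Ideal.Quotient.eq_zero_iff_mem.2
    (Ideal.mem_of_dvd _ (pow_dvd_pow _ hk) (X_pow_mem_flagIdeal i))

theorem pullback_specialClass_one (r N : ℕ) : pullback r N (specialClass r N 1)
    = toFlagRing r N (∑ i, MvPolynomial.X i) := by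
  rw [specialClass, pullback_toHG]
  simp [hSym, MvPolynomial.hsymm_one]

theorem pullback_hyperplaneClass (N : ℕ) :
    pullback 1 N (specialClass 1 N 1) = toFlagRing 1 N (MvPolynomial.X 0) := by
  rw [pullback_specialClass_one, Fin.sum_univ_one]

theorem hyperplaneClass_pow_eq_zero {k : ℕ} (hk : N ≤ k) : specialClass 1 N 1 ^ k = 0 := by
  apply pullback_injective 1 N
  rw [map_pow, pullback_hyperplaneClass, toFlagRing_X_pow_eq_zero 0 hk, map_zero]

theorem pullback_gammaClass (hrN : r ≤ N) : pullback r N (gammaClass r N)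
    = toFlagRing r N (coeffSum (r * (N - r)) (gammaRatio r N)) := by
  have h := toFlagRing_gammaPoly r (N - r)
  rw [Nat.sub_add_cancel hrN] at h
  exact h

theorem pullback_chSchurBundle (N : ℕ) (ν : Fin r → ℕ) : pullback r N (chSchurBundle N ν)
    = toFlagRing r N (coeffSum (r * (N - r)) (chSeries ν)) := by
  rw [← chSchurPoly_eq_coeffSum]
  rfl

theorem pullback_truncExp_smul_specialClass (D : ℕ) (c : ℂ) :
    pullback r N (truncExp D (c • specialClass r N 1))
      = toFlagRing r N (coeffSum D (expSeries (c • ∑ i, MvPolynomial.X i))) := by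
  rw [← truncExp_eq_coeffSum]
  refine (map_truncExp (A := HG r N) (B := FlagRing r N) (pullback r N) _ _).trans ?_
  rw [map_smul, pullback_specialClass_one, ← map_smul]
  exact (map_truncExp (B := FlagRing r N) (toFlagRing r N) _ _).symm

theorem gammaRatio_one (N : ℕ) :
    gammaRatio 1 N = scaledSeries (MvPolynomial.X 0) (gammaSeries ^ N) := by
  rw [gammaRatio, Fintype.prod_prod_type]
  simp [scaledSeries_zero, constantCoeff_gammaSeries]

theorem gammaClass_one (hN : 1 ≤ N) : gammaClass 1 N
    = coeffSum (N - 1) (scaledSeries (specialClass 1 N 1) (gammaSeries ^ N)) := by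
  apply pullback_injective 1 N
  have hmap := coeffSum_scaledSeries_map (A := HG 1 N) (B := FlagRing 1 N) (pullback 1 N) (N - 1)
    (specialClass 1 N 1) (gammaSeries ^ N)
  rw [pullback_hyperplaneClass] at hmap
  rw [pullback_gammaClass hN, gammaRatio_one, one_mul, ← coeffSum_scaledSeries_map]
  exact hmap

/-- The series `Γ(1 + z)^N e^{2πi k z}`, which gives `Γ_ℙ Ch(O(k))` at `z = h`. -/
def twistedGammaSeries (N k : ℕ) : ℂ⟦X⟧ :=
  gammaSeries ^ N * PowerSeries.rescale (2 * Real.pi * Complex.I * k : ℂ) (PowerSeries.exp ℂ)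

theorem gammaClass_mul_chO (hN : 1 ≤ N) (k : ℕ) : gammaClass 1 N * chO N (k : ℤ)
    = coeffSum (N - 1) (scaledSeries (specialClass 1 N 1) (twistedGammaSeries N k)) := by
  have hch : chO N (k : ℤ) = coeffSum (N - 1) (scaledSeries (specialClass 1 N 1)
      (PowerSeries.rescale (2 * Real.pi * Complex.I * k : ℂ) (PowerSeries.exp ℂ))) := by
    rw [chO, truncExp_eq_coeffSum, expSeries_smul, Int.cast_natCast]
  rw [gammaClass_one hN, hch, ← coeffSum_mul, ← map_mul, twistedGammaSeries]
  intro i j hij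
  rw [coeff_scaledSeries, coeff_scaledSeries, smul_mul_smul_comm, ← pow_add,
    hyperplaneClass_pow_eq_zero (by omega), smul_zero]

theorem rootEval_gammaClass_mul_chO (hN : 1 ≤ N) (i : Fin r) (k : ℕ) :
    rootEval N i (gammaClass 1 N * chO N (k : ℤ)) = coeffSum (N - 1)
      (scaledSeries (toFlagRing r N (MvPolynomial.X i)) (twistedGammaSeries N k)) := by
  rw [gammaClass_mul_chO hN, ← rootEval_specialClass]
  exact (coeffSum_scaledSeries_map (A := HG 1 N) (B := FlagRing r N) (rootEval N i) _ _ _).symm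

end GammaClass

/-! ### The determinant of Gamma classes -/

section WedgeSeries

variable {r N : ℕ} {ν : Fin r → ℕ}

/-- The generating series of `(2πi)^{r(r-1)/2} Γ_𝔾 Ch(S^ν V^*) e^{(r-1)πi σ_1}`. -/
def wedgeSeries (N : ℕ) (ν : Fin r → ℕ) : (MvPolynomial (Fin r) ℂ)⟦X⟧ :=
  (2 * Real.pi * Complex.I : ℂ) ^ r.choose 2 • (gammaRatio r N * chSeries ν *
    expSeries ((((r : ℂ) - 1) * Real.pi * Complex.I) • ∑ i, MvPolynomial.X i))

theorem isGradedSymmetric_wedgeSeries (N : ℕ) (ν : Fin r → ℕ) :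
    IsGradedSymmetric (wedgeSeries N ν) :=
  (((isGradedSymmetric_gammaRatio r N).mul (isGradedSymmetric_chSeries ν)).mul
    (isGradedSymmetric_expSeries_smul_sum_X _)).smul _

theorem expSeries_neg_mul_wedgeSeries (N : ℕ) (ν : Fin r → ℕ) :
    expSeries ((-(((r : ℂ) - 1) * Real.pi * Complex.I)) • ∑ i, MvPolynomial.X i)
      * wedgeSeries N ν
      = (2 * Real.pi * Complex.I : ℂ) ^ r.choose 2 • (gammaRatio r N * chSeries ν) := by
  have hcancel : expSeries ((-(((r : ℂ) - 1) * Real.pi * Complex.I)) • ∑ i : Fin r,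
      (MvPolynomial.X i : MvPolynomial (Fin r) ℂ))
      * expSeries ((((r : ℂ) - 1) * Real.pi * Complex.I) • ∑ i, MvPolynomial.X i) = 1 := by
    rw [← expSeries_add, ← add_smul, neg_add_cancel, zero_smul, expSeries_zero]
  rw [wedgeSeries, mul_smul_comm, mul_left_comm, hcancel, mul_one]

theorem scaledSeries_twistedGammaSeries {σ : Type*} (i : σ) (N k : ℕ) :
    scaledSeries (MvPolynomial.X i) (twistedGammaSeries N k)
      = scaledSeries (MvPolynomial.X i) gammaSeries ^ N * rootExp i ^ k := by
  rw [twistedGammaSeries, map_mul, map_pow, ← expSeries_smul, rootExp, ← expSeries_nsmul,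
    ← Nat.cast_smul_eq_nsmul ℂ, smul_smul, mul_comm (k : ℂ)]

theorem det_rootExp_pow (a : Fin r → ℕ) :
    (Matrix.of fun i j : Fin r => rootExp i ^ a j).det
      = MvPolynomial.aeval rootExp (alternant r a).det := by
  rw [AlgHom.map_det]
  refine congrArg Matrix.det (Matrix.ext fun i j => ?_)
  simp [alternant]

/-- The Weyl character formula makes the twists a multiple of the determinant for `ν = 0`, which is
a Vandermonde determinant in the exponentials of the roots. -/
theorem det_scaledSeries_twistedGammaSeries (N : ℕ) (hν : Antitone ν) :
    (Matrix.of fun i j : Fin r => scaledSeries (MvPolynomial.X i : MvPolynomial (Fin r) ℂ)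
      (twistedGammaSeries N (ν j + (j.rev : ℕ)))).det
      = PowerSeries.X ^ r.choose 2 * (PowerSeries.C (vand r) * wedgeSeries N ν) := by
  have hweyl : (Matrix.of fun i j : Fin r => rootExp i ^ (ν j + (j.rev : ℕ))).det
      = (Matrix.of fun i j : Fin r => rootExp i ^ (j.rev : ℕ)).det * chSeries ν := by
    rw [det_rootExp_pow, det_rootExp_pow, ← vand_mul_schurCharacter hν, map_mul]
    rfl
  have hvand := det_expSeries_pow_rev (MvPolynomial.X : Fin r → MvPolynomial (Fin r) ℂ)
  simp only [scaledSeries_twistedGammaSeries]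
  refine (Matrix.det_mul_column
    (fun i => scaledSeries (MvPolynomial.X i : MvPolynomial (Fin r) ℂ) gammaSeries ^ N)
    (Matrix.of fun i j : Fin r => rootExp i ^ (ν j + (j.rev : ℕ)))).trans ?_
  rw [hweyl]
  simp only [rootExp]
  rw [hvand, wedgeSeries, gammaRatio, ← mul_assoc ((r : ℂ) - 1)]
  simp only [Algebra.smul_def, vand, alternant]
  ring

theorem coeff_scaledSeries_toFlagRing_X_eq_zero (i : Fin r) (φ : ℂ⟦X⟧) {d : ℕ} (hd : N - 1 < d) :
    PowerSeries.coeff d (scaledSeries (toFlagRing r N (MvPolynomial.X i)) φ) = 0 := by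
  rw [coeff_scaledSeries, toFlagRing_X_pow_eq_zero i (by omega), smul_zero]

theorem det_scaledSeries_toFlagRing_X (N : ℕ) (hν : Antitone ν) :
    (Matrix.of fun i j => scaledSeries (toFlagRing r N (MvPolynomial.X i))
      (twistedGammaSeries N (ν j + (j.rev : ℕ)))).det
      = PowerSeries.X ^ r.choose 2 * PowerSeries.map (toFlagRing r N : _ →+* FlagRing r N)
        (PowerSeries.C (vand r) * wedgeSeries N ν) := by
  have h := congrArg (PowerSeries.map (toFlagRing r N : _ →+* FlagRing r N))
    (det_scaledSeries_twistedGammaSeries N hν)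
  rw [map_mul, map_pow, PowerSeries.map_X] at h
  rw [← h, RingHom.map_det]
  exact congrArg Matrix.det (Matrix.ext fun i j => (map_scaledSeries (toFlagRing r N) _ _).symm)

theorem vand_mul_pullback_satake_gammaClass (hrN : r ≤ N) (hν : Antitone ν) :
    toFlagRing r N (vand r) * pullback r N (satake r N (exteriorPower.ιMulti ℂ r fun j : Fin r =>
        gammaClass 1 N * chO N ((ν j + (j.rev : ℕ) : ℕ) : ℤ)))
      = toFlagRing r N (vand r)
        * toFlagRing r N (coeffSum (r * (N - r)) (wedgeSeries N ν)) := by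
  have hvanish (d : ℕ) (hd : r * (N - r) < d) : PowerSeries.coeff d
      (PowerSeries.map (toFlagRing r N : _ →+* FlagRing r N)
        (PowerSeries.C (vand r) * wedgeSeries N ν)) = 0 := by
    rw [PowerSeries.coeff_map, PowerSeries.coeff_C_mul, map_mul, RingHom.coe_coe,
      (isGradedSymmetric_wedgeSeries N ν).toFlagRing_coeff_eq_zero hrN hd, mul_zero]
  obtain ⟨E, hdet, hsum⟩ := ((eventually_coeffSum_det
    (Matrix.of fun i j => scaledSeries (toFlagRing r N (MvPolynomial.X i))
      (twistedGammaSeries N (ν j + (j.rev : ℕ))))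
    fun i _ _ hd => coeff_scaledSeries_toFlagRing_X_eq_zero i _ hd).and
      (eventually_coeffSum_X_pow_mul hvanish (r.choose 2))).exists
  calc toFlagRing r N (vand r) * pullback r N (satake r N _)
      = (Matrix.of fun i j : Fin r => rootEval N i
          (gammaClass 1 N * chO N ((ν j + (j.rev : ℕ) : ℕ) : ℤ))).det := vand_mul_pullback_satake _
    _ = coeffSum E (Matrix.of fun i j => scaledSeries (toFlagRing r N (MvPolynomial.X i))
          (twistedGammaSeries N (ν j + (j.rev : ℕ)))).det := by
        rw [hdet]
        exact congrArg Matrix.det (Matrix.ext fun i j =>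
          rootEval_gammaClass_mul_chO (i.pos.trans_le hrN) i _)
    _ = toFlagRing r N (coeffSum (r * (N - r)) (PowerSeries.C (vand r) * wedgeSeries N ν)) := by
        rw [det_scaledSeries_toFlagRing_X N hν, hsum, coeffSum_map, RingHom.coe_coe]
    _ = toFlagRing r N (vand r) * toFlagRing r N (coeffSum (r * (N - r)) (wedgeSeries N ν)) := by
        rw [← PowerSeries.smul_eq_C_mul, map_smul, smul_eq_mul, map_mul]

end WedgeSeries

end GammaGrassmannian

end

open GammaGrassmannian in
theorem proposition6p15_general (r N : ℕ) (hrN : r ≤ N) (ν : Fin r → ℕ) (hν : Antitone ν) :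
    gammaClass r N * chSchurBundle N ν =
      ((2 * Real.pi * Complex.I : ℂ) ^ r.choose 2)⁻¹ •
        (truncExp (r * (N - r))
            ((-(((r : ℂ) - 1) * Real.pi * Complex.I)) • specialClass r N 1) *
          satake r N (exteriorPower.ιMulti ℂ r fun j : Fin r =>
            gammaClass 1 N * chO N ((ν j + (j.rev : ℕ) : ℕ) : ℤ))) := by
  have hpi : (2 * Real.pi * Complex.I : ℂ) ^ r.choose 2 ≠ 0 :=
    pow_ne_zero _ Complex.two_pi_I_ne_zero
  have hexp := (isGradedSymmetric_expSeries_smul_sum_X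
    (-(((r : ℂ) - 1) * Real.pi * Complex.I))).toFlagRing_coeffSum_mul
    (isGradedSymmetric_wedgeSeries N ν) hrN
  rw [expSeries_neg_mul_wedgeSeries, LinearMap.map_smul_of_tower, map_smul,
    (isGradedSymmetric_gammaRatio r N).toFlagRing_coeffSum_mul (isGradedSymmetric_chSeries ν) hrN,
    ← eq_inv_smul_iff₀ hpi] at hexp
  apply eq_of_vand_mul_pullback_eq
  rw [map_mul, pullback_gammaClass hrN, pullback_chSchurBundle, hexp, map_smul, map_mul,
    pullback_truncExp_smul_specialClass, mul_smul_comm, mul_smul_comm,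
    mul_left_comm _ _ (pullback r N _), vand_mul_pullback_satake_gammaClass hrN hν, mul_left_comm]

open GammaGrassmannian in
theorem proposition6p15 (r N : ℕ) (hrN : r ≤ N) (ν : Fin r → ℕ) (hν : Antitone ν)
    (hbox : ∀ j, ν j ≤ N - r) :
    gammaClass r N * chSchurBundle N ν =
      ((2 * Real.pi * Complex.I : ℂ) ^ r.choose 2)⁻¹ •
        (truncExp (r * (N - r))
            ((-(((r : ℂ) - 1) * Real.pi * Complex.I)) • specialClass r N 1) *
          satake r N (exteriorPower.ιMulti ℂ r fun j : Fin r =>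
            gammaClass 1 N * chO N ((ν j + (j.rev : ℕ) : ℕ) : ℤ))) :=
  proposition6p15_general r N hrN ν hν
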